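/- **Setting.** Let $0<c$, $B$ and $0<a<b$ be real numbers. A *cavity profile* with these bounds is a smooth, increasing, convex function $r:(0,1]\to\mathbb R$ with $|r^{(j)}|\le B$ for $j=0,1,2,3$, $r\ge c$, and $aR\le r'(R)\le bR$ on $(0,1]$; the corresponding radially symmetric cavity deformation is $u(x)=\frac{r(|x|)}{|x|}x$ in $\mathbb R^2$. Let $1<p<2$, $\omega>0$, and let $g:(0,\infty)\to(0,\infty)$ be continuously differentiable and strictly convex with $g(d)\to\infty$ as $d\to0^+$ and $g(d)/d\to\infty$ as $d\to\infty$. For $S\subset\mathbb R^2$ put $E(v;S)=\int_S \big(\omega|\nabla v|^p+g(\det\nabla v)\big)\,dx$, with $|\cdot|$ the Frobenius norm. For $0<\epsilon_0<1$ let $\Omega_{\epsilon_0}=B_1(0)\setminus B_{\epsilon_0}(0)$. **Elements.** Let $\hat T$ be the triangle with vertices $(0,0),(1,0),(0,1)$ and barycentric coordinates $\hat\lambda_1,\hat\lambda_2,\hat\lambda_3$, and let $\hat\mu_i=\hat\lambda_i(2\hat\lambda_i-1)$, $\hat\mu_{ij}=4\hat\lambda_i\hat\lambda_j$. Three points $a_i$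 with polar coordinates $(\rho_i,\theta_i)$ define edge nodes $a_{ij}$ with polar coordinates $\big(\frac{\rho_i+\rho_j}2,\frac{\theta_i+\theta_j}2\big)$, the map $F_T=\sum_i a_i\hat\mu_i+\sum_{i<j}a_{ij}\hat\mu_{ij}$ and the curved triangle $T=F_T(\hat T)$. On $T$ the interpolant $\Pi v$ is given by $\Pi v\circ F_T=\sum_i v(a_i)\hat\mu_i+\sum_{i<j}v(a_{ij})\hat\mu_{ij}$. A *standard layer* $(\epsilon,\tau,N)$ consists of $2N$ elements placed around the ring $\epsilon\le|x|\le\epsilon+\tau$: $N$ elements of type A, with vertices (up to rotation by multiples of $2\pi/N$) $(\epsilon,0),(\epsilon+\tau,-\frac\pi N),(\epsilon+\tau,\frac\pi N)$ in polar coordinates, and, rotated by a further $\frac\pi N$, $N$ elements of type B, with vertices $(\epsilon+\tau,0),(\epsilon,\frac\pi N),(\epsilon,-\frac\pi N)$. In a *conforming layer* each element of type B is replaced by its two halves, with vertices $(\epsilon,0),(\epsilon+\tau,0),(\epsilon,\frac\pi N)$ (type C) and $(\epsilon,0),(\epsilon,-\frac\pi N),(\epsilon+\tau,0)$ (type D).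 **Meshing strategy.** Let $C_1,C_2>0$, $C\ge(2-p)2^{p-1}$, $0<A_1<A_2$, and $0<h\le\min\{\frac{2-p}{2^{2-p}C},\frac{2-p}{2^{p-1}C}\}$. Let $d(x,h)=(x^{2-p}+Ch)^{1/(2-p)}-x$. Call $N\in\mathbb Z_+$ admissible for $(\epsilon,\tau)$ if $N^{-1}\le\min\{C_2(\epsilon\tau)^{1/4},(C^2\tau h^2)^{1/4}\}$. (1) Set $\tau_0=\min\{C_1\epsilon_0^{1/2},d(\epsilon_0,h)\}$, choose $\tilde N\in[(A_2h)^{-1},(A_1h)^{-1}]\cap\mathbb Z_+$, let $\bar N_0$ be the least $N$ admissible for $(\epsilon_0,\tau_0)$, let $k=\min\{j\ge 0:2^j\tilde N\ge\bar N_0\}$, $N_0=2^k\tilde N$, $k_0=0$. (2) For $i\ge1$ set $\epsilon_i=\epsilon_{i-1}+\tau_{i-1}$ and $\tau_i=\min\{1-\epsilon_i,C_1\epsilon_i^{1/2},d(\epsilon_i,h)\}$. If $k_{i-1}<k$ and $N_{i-1}/2$ is admissible for $(\epsilon_i,\tau_i)$, set $N_i=N_{i-1}/2$, $k_i=k_{i-1}+1$;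 otherwise set $N_i=N_{i-1}$, $k_i=k_{i-1}$. The last index $m$ is the one with $\epsilon_m+\tau_m=1$; it is required that $\epsilon_0<\epsilon_1<\dots<\epsilon_m<\epsilon_{m+1}=1$. (3) Layer $i$ has parameters $(\epsilon_i,\tau_i,N_i)$; it is a conforming layer if $i\ge1$ and $N_{i-1}=2N_i$, and a standard layer otherwise. The layers are rotated so that the vertices of neighbouring layers on their common circle coincide. It is required that $N_m$ is admissible for the last layer $(\epsilon_m,\tau_m)$. Let $\Omega^{\mathcal J_h}_{(\epsilon_i,\tau_i)}$ be the union of the elements of layer $i$, and $\Omega_h=\bigcup_{i=0}^m\Omega^{\mathcal J_h}_{(\epsilon_i,\tau_i)}$. **Theorem.** There are $C_1^*,C_2^*>0$ depending only on $c,B,a,b$ such that for all $0<C_1\le C_1^*$, $0<C_2\le C_2^*$ and all $p,\omega,g,C,A_1,A_2$ as above there is a constant $K$ (independent of $\epsilon_0$, $h$, the mesh, and $r$ within its class) such that, for every cavity profile $r$ with the bounds $c,B,a,b$, every $\epsilon_0\in(0,1)$, every $h$ as above and every mesh produced by the strategy, the interpolant $\Pi u$ of $u$ is well defined on $\Omega_h$,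 $\det\nabla\Pi u>0$ a.e. on $\Omega_h$, the energies $E(\Pi u;\Omega_h)$ and $E(u;\Omega_{\epsilon_0})$ are finite, and $$E(\Pi u;\Omega_h)=\sum_{i=0}^mE\big(\Pi u;\Omega^{\mathcal J_h}_{(\epsilon_i,\tau_i)}\big),\qquad \big|E(\Pi u;\Omega_h)-E(u;\Omega_{\epsilon_0})\big|\le K\,h^2\,E(u;\Omega_{\epsilon_0}).$$ -/

import Mathlib

open MeasureTheory Set Filter Topology

noncomputable section

namespace Cavity

/-- The plane with its Euclidean norm. -/
abbrev Plane : Type := EuclideanSpace ℝ (Fin 2)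

/-- The point with polar coordinates `(ρ, θ)`. -/
def polarPoint (ρ θ : ℝ) : Plane := !₂[ρ * Real.cos θ, ρ * Real.sin θ]

/-! ### Cavity deformations and the elastic energy -/

/-- `r` is the radial profile, on `(0, 1]`, of a cavity deformation: smooth, increasing and convex,
with `r` and its first three derivatives bounded by `B`, with `r ≥ c`, and with
`a R ≤ r'(R) ≤ b R`.  (The parameters `c`, `a`, `b` are positive where this is used, so `r` is
positive; derivatives at the end point `1` are one-sided.) -/
structure IsCavityProfile (c B a b : ℝ) (r : ℝ → ℝ) : Prop where
  smooth : ContDiffOn ℝ (⊤ : ℕ∞) r (Ioc 0 1)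
  increasing : StrictMonoOn r (Ioc 0 1)
  convex : ConvexOn ℝ (Ioc 0 1) r
  bounded : ∀ j ≤ 3, ∀ R ∈ Ioc (0 : ℝ) 1, |iteratedDerivWithin j r (Ioc 0 1) R| ≤ B
  lower : ∀ R ∈ Ioc (0 : ℝ) 1, c ≤ r R
  deriv_lower : ∀ R ∈ Ioc (0 : ℝ) 1, a * R ≤ derivWithin r (Ioc 0 1) R
  deriv_upper : ∀ R ∈ Ioc (0 : ℝ) 1, derivWithin r (Ioc 0 1) R ≤ b * R

/-- The radially symmetric map `x ↦ (r(|x|) / |x|) x`. -/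
def radialMap (r : ℝ → ℝ) (x : Plane) : Plane := (r ‖x‖ / ‖x‖) • x

/-- The volumetric part `g : (0, ∞) → (0, ∞)` of the energy density: continuously differentiable,
strictly convex, `g(d) → ∞` as `d → 0+`, and `g(d) / d → ∞` as `d → ∞`. -/
structure IsVolumetricEnergy (g : ℝ → ℝ) : Prop where
  contDiffOn : ContDiffOn ℝ 1 g (Ioi 0)
  strictConvexOn : StrictConvexOn ℝ (Ioi 0) g
  pos : ∀ d, 0 < d → 0 < g d
  tendsto_zero : Tendsto g (𝓝[>] 0) atTop
  superlinear : Tendsto (fun d => g d / d) atTop atTop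

/-- The Frobenius norm of a linear map of the plane, through its matrix entries. -/
def frobeniusNorm (F : Plane →L[ℝ] Plane) : ℝ :=
  √(∑ i : Fin 2, ∑ j : Fin 2, (F (EuclideanSpace.single j 1) i) ^ 2)

/-- The stored energy density `W(F) = ω |F|^p + g(det F)`. -/
def storedEnergy (ω p : ℝ) (g : ℝ → ℝ) (F : Plane →L[ℝ] Plane) : ℝ :=
  ω * frobeniusNorm F ^ p + g F.det

/-- The elastic energy `E(v; S) = ∫_S W(∇v) dx`. -/
def energy (ω p : ℝ) (g : ℝ → ℝ) (v : Plane → Plane) (S : Set Plane) : ℝ :=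
  ∫ x in S, storedEnergy ω p g (fderiv ℝ v x)

/-- The energy density of `v` is integrable on `S`. -/
def HasFiniteEnergy (ω p : ℝ) (g : ℝ → ℝ) (v : Plane → Plane) (S : Set Plane) : Prop :=
  IntegrableOn (fun x => storedEnergy ω p g (fderiv ℝ v x)) S

/-- The reference domain `B_1(0) \ B_{ε₀}(0)`. -/
def annulus (ε₀ : ℝ) : Set Plane := Metric.ball 0 1 \ Metric.ball 0 ε₀

/-! ### Quadratic iso-parametric elements -/

/-- The closed reference triangle, with vertices `(0,0)`, `(1,0)`, `(0,1)`. -/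
def refTriangle : Set (ℝ × ℝ) := {x | 0 ≤ x.1 ∧ 0 ≤ x.2 ∧ x.1 + x.2 ≤ 1}

/-- Barycentric coordinates on the reference triangle. -/
def bary (x : ℝ × ℝ) : Fin 3 → ℝ := ![1 - x.1 - x.2, x.1, x.2]

/-- The quadratic shape function of vertex `i`. -/
def vertexShape (i : Fin 3) (x : ℝ × ℝ) : ℝ := bary x i * (2 * bary x i - 1)

/-- The quadratic shape function of the edge `i j`. -/
def edgeShape (i j : Fin 3) (x : ℝ × ℝ) : ℝ := 4 * bary x i * bary x j

/-- A curved triangle, given by the polar coordinates of its three vertices. -/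
structure Element where
  radius : Fin 3 → ℝ
  angle : Fin 3 → ℝ

namespace Element

/-- The vertices `a_i`. -/
def vertex (T : Element) (i : Fin 3) : Plane := polarPoint (T.radius i) (T.angle i)

/-- The edge nodes `a_{ij}`: polar coordinates are averaged. -/
def edgeNode (T : Element) (i j : Fin 3) : Plane :=
  polarPoint ((T.radius i + T.radius j) / 2) ((T.angle i + T.angle j) / 2)

/-- The quadratic map on the reference triangle that takes, at the nodes of the reference triangle,
the values of `v` at the corresponding nodes of `T`. -/
def nodalInterp (T : Element) (v : Plane → Plane) (x : ℝ × ℝ) : Plane :=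
  ∑ i : Fin 3, vertexShape i x • v (T.vertex i)
    + ∑ i : Fin 3, ∑ j ∈ Finset.Ioi i, edgeShape i j x • v (T.edgeNode i j)

/-- The element map `F_T`. -/
def map (T : Element) : ℝ × ℝ → Plane := T.nodalInterp id

/-- The curved triangle `T = F_T(T̂)` as a set. -/
def carrier (T : Element) : Set Plane := T.map '' refTriangle

end Element

open Classical in
/-- The iso-parametric interpolant of `v` on a family of elements: on the element `T` it is
`(nodalInterp T v) ∘ F_T⁻¹`.  It is set to `0` off the union of the elements. -/
def interpolant (𝒯 : Set Element) (v : Plane → Plane) (x : Plane) : Plane :=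
  if h : ∃ q : Element × (ℝ × ℝ), q.1 ∈ 𝒯 ∧ q.2 ∈ refTriangle ∧ q.1.map q.2 = x then
    h.choose.1.nodalInterp v h.choose.2
  else 0

/-- The region covered by a family of elements. -/
def region (𝒯 : Set Element) : Set Plane := ⋃ T ∈ 𝒯, T.carrier

/-! ### Layers of elements

The four types of elements of a layer with inner radius `ε` and thickness `τ`, placed symmetrically
about (types A and B), or with one side on (types C and D), the ray with polar angle `φ`. -/

/-- Type A: one vertex on the inner circle, two on the outer circle. -/
def elementA (ε τ : ℝ) (N : ℕ) (φ : ℝ) : Element where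
  radius := ![ε, ε + τ, ε + τ]
  angle := ![φ, φ - Real.pi / N, φ + Real.pi / N]

/-- Type B: one vertex on the outer circle, two on the inner circle. -/
def elementB (ε τ : ℝ) (N : ℕ) (φ : ℝ) : Element where
  radius := ![ε + τ, ε, ε]
  angle := ![φ, φ + Real.pi / N, φ - Real.pi / N]

/-- Type C: the half of a type B triangle on the side of increasing angle. -/
def elementC (ε τ : ℝ) (N : ℕ) (φ : ℝ) : Element where
  radius := ![ε, ε + τ, ε]
  angle := ![φ, φ, φ + Real.pi / N]

/-- Type D: the half of a type B triangle on the side of decreasing angle. -/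
def elementD (ε τ : ℝ) (N : ℕ) (φ : ℝ) : Element where
  radius := ![ε, ε, ε + τ]
  angle := ![φ, φ - Real.pi / N, φ]

/-- A standard layer: `N` elements of type A and `N` of type B, alternating around the ring; `ψ` is
the polar angle of one of the inner vertices. -/
def standardLayer (ε τ : ℝ) (N : ℕ) (ψ : ℝ) : Set Element :=
  {T | ∃ j < N, T = elementA ε τ N (ψ + 2 * Real.pi * j / N) ∨
    T = elementB ε τ N (ψ + Real.pi / N + 2 * Real.pi * j / N)}

/-- A conforming layer: a standard layer with each element of type B cut along the radial direction
into an element of type C and one of type D; it has `N` vertices on the outer circle and `2 N` on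
the inner circle. -/
def conformingLayer (ε τ : ℝ) (N : ℕ) (ψ : ℝ) : Set Element :=
  {T | ∃ j < N, T = elementA ε τ N (ψ + 2 * Real.pi * j / N) ∨
    T = elementC ε τ N (ψ + Real.pi / N + 2 * Real.pi * j / N) ∨
    T = elementD ε τ N (ψ + Real.pi / N + 2 * Real.pi * j / N)}

/-! ### The meshing strategy -/

/-- `d(x, h) = (x^(2-p) + C h)^(1/(2-p)) - x`. -/
def thicknessBound (p C x h : ℝ) : ℝ := (x ^ (2 - p) + C * h) ^ (1 / (2 - p)) - x

/-- `N` is admissible for the layer `(ε, τ)`: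
`N⁻¹ ≤ min {C₂ (ε τ)^(1/4), (C² τ h²)^(1/4)}`. -/
def Admissible (C C₂ h ε τ : ℝ) (N : ℕ) : Prop :=
  0 < N ∧ (N : ℝ)⁻¹ ≤ min (C₂ * (ε * τ) ^ (1 / 4 : ℝ)) ((C ^ 2 * τ * h ^ 2) ^ (1 / 4 : ℝ))

/-- The meshes produced by the meshing strategy with parameters `p, C, C₁, C₂, A₁, A₂`, reference
mesh size `h` and inner radius `ε₀`.  Only the layers `i = 0, …, m` are meaningful. -/
structure StrategyMesh (p C C₁ C₂ A₁ A₂ h ε₀ : ℝ) where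
  /-- the index of the last layer -/
  m : ℕ
  /-- the radii -/
  ε : ℕ → ℝ
  /-- the thicknesses -/
  τ : ℕ → ℝ
  /-- the numbers of nodes -/
  N : ℕ → ℕ
  /-- the number of halvings up to layer `i` -/
  κ : ℕ → ℕ
  /-- the largest possible number of halvings -/
  k : ℕ
  /-- the least number of nodes that is aimed at -/
  Ntil : ℕ
  /-- the least admissible number of nodes for layer `0` -/
  Nbar : ℕ
  /-- the angular positions of the layers -/
  ψ : ℕ → ℝ
  ε_zero : ε 0 = ε₀
  ε_succ : ∀ i ≤ m, ε (i + 1) = ε i + τ i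
  ε_lt : ∀ i ≤ m, ε i < ε (i + 1)
  ε_last : ε (m + 1) = 1
  τ_zero : τ 0 = min (C₁ * √ε₀) (thicknessBound p C ε₀ h)
  τ_eq : ∀ i, 1 ≤ i → i ≤ m →
    τ i = min (1 - ε i) (min (C₁ * √(ε i)) (thicknessBound p C (ε i) h))
  Ntil_pos : 0 < Ntil
  Ntil_mem : (Ntil : ℝ) ∈ Icc (A₂ * h)⁻¹ (A₁ * h)⁻¹
  Nbar_least : IsLeast {n : ℕ | Admissible C C₂ h ε₀ (τ 0) n} Nbar
  k_least : IsLeast {j : ℕ | Nbar ≤ 2 ^ j * Ntil} k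
  N_zero : N 0 = 2 ^ k * Ntil
  κ_zero : κ 0 = 0
  /-- the number of nodes is halved when this is still allowed and admissible -/
  halve : ∀ i < m, κ i < k → Admissible C C₂ h (ε (i + 1)) (τ (i + 1)) (N i / 2) →
    κ (i + 1) = κ i + 1 ∧ N (i + 1) = N i / 2
  /-- otherwise it is kept -/
  keep : ∀ i < m, ¬ (κ i < k ∧ Admissible C C₂ h (ε (i + 1)) (τ (i + 1)) (N i / 2)) →
    κ (i + 1) = κ i ∧ N (i + 1) = N i
  /-- on a circle between two layers, the outer vertices of the inner layer are inner vertices of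
  the outer layer -/
  ψ_succ : ∀ i < m, ∃ q : ℤ, ψ (i + 1) = ψ i + Real.pi / N i + 2 * Real.pi * q / N i

namespace StrategyMesh

variable {p C C₁ C₂ A₁ A₂ h ε₀ : ℝ}

/-- The elements of layer `i`.  A layer whose inner neighbour has twice as many nodes is a conforming
layer; all others are standard. -/
def layer (J : StrategyMesh p C C₁ C₂ A₁ A₂ h ε₀) (i : ℕ) : Set Element :=
  if 1 ≤ i ∧ J.N (i - 1) = 2 * J.N i then conformingLayer (J.ε i) (J.τ i) (J.N i) (J.ψ i)
  else standardLayer (J.ε i) (J.τ i) (J.N i) (J.ψ i)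

/-- All elements of the mesh. -/
def elements (J : StrategyMesh p C C₁ C₂ A₁ A₂ h ε₀) : Set Element :=
  {T | ∃ i ≤ J.m, T ∈ J.layer i}

/-- The interpolant `Π v` on the mesh. -/
def interp (J : StrategyMesh p C C₁ C₂ A₁ A₂ h ε₀) (v : Plane → Plane) : Plane → Plane :=
  interpolant J.elements v

end StrategyMesh

end Cavity

end

noncomputable section

namespace Cavity

/-! ### Quadratic interpolants in the frame of an element -/

/-! Half of each element of type A or B, or a whole element of type C or D, is parametrised by one
triangle `0 ≤ t ≤ s ≤ 1` in a frame whose first axis is a ray; `s` is the radial and `t` the angular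
parameter. For a radial map with profile `f`, the nodal interpolant in this frame is an explicit
quadratic pair `(X, Y)`. Its coefficients involve only `f` at three radii and `k = 1 - cos (η / 2)`,
`σ = sin (η / 2)`, where `η = π / N`. The element map is the case `f = id`, so the interpolant is `U
∘ F⁻¹` with `U` and `F` of the same form, and everything reduces to explicit algebra in `(s, t)`.

Geometry. The element maps must glue to a map that is injective off the edges. On a piece, the exact
midpoint formula for quadratics shows that the polar angle increases in `t` at fixed `s`, and that
along a fixed ray the curves `s = const` are strictly ordered by radius (`ang_lt`, `rad_lt`). The
intermediate value theorem carries this order across the common edge of two pieces (`sector_lt`). It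
then extends around a layer (`layer_order`) and, since the outer curve of a layer is the inner curve
of the next, through all layers (`order_of_lt`). Hence two representations of a point carry the same
interpolated value (`pt_congr`), the interpolant is well defined, and energies add over disjoint
open cells.

Estimates. After division by `2 σ τ'`, the Jacobian of `F` is close to `ρ`, that of `U` to `R R'`,
and the squared Frobenius norm of `DU adj(DF)` to `R² + ρ² R'²`, where `R = r ρ` and `R' = r' ρ`.
The errors are governed by `k`, `τ²` and `k² / τ`. The danger is the normalised derivative `Y_s`,
which contains `k / τ`. In the determinants it is multiplied by `X_t = O(k)`, and in the one
remaining matrix entry where it occurs it cancels (`cross_entry_sq_le`). The strategy makes the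
three quantities `O(h²)`: `k` because `N ≥ (A₂ h)⁻¹`, `k² / τ` by the second bound in admissibility,
and `τ` by the thickness bound (`sizes_le`). Smallness of `C₁` and `C₂` serves another purpose: it
makes the errors in the Jacobians small relative to the radius, which gives positive determinants
and keeps the argument of `g` in a compact set.

Energy. The radial energy weight, density times `ρ`, is at least a constant times `ρ ^ (1 - p)`,
which turns absolute errors into relative ones. The pointwise error has the factor `(ρ + f1) ρ ^
(-p)`, with `f1` the radius at `s = 1`. On inner pieces `f1 / ρ` is not bounded, because `τ` may be
much larger than `ε`; but the slice of the parameter triangle at `s` has length `s`, and `s (ρ + f1)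
≤ 2 ρ`. An inner piece then reproduces the integral of the weight with density `s`, an outer piece
with density `1 - s`, and the two add up to the full layer integral. Summing over the layers gives
the theorem. -/

def shapeM (κ : Bool) (s t : ℝ) : ℝ := if κ then (1 - s) * t else s - s ^ 2
-- The flag `κ` is `false` for half of a symmetric element (types A and B) and `true` for an element
-- of type C or D. The suffixes `s` and `t` denote partial derivatives.
def shapeMs (κ : Bool) (s t : ℝ) : ℝ := if κ then -t else 1 - 2 * s
def shapeMt (κ : Bool) (s : ℝ) : ℝ := if κ then 1 - s else 0
def shapeN (κ : Bool) (s t : ℝ) : ℝ := if κ then t - 2 * t ^ 2 else s - s ^ 2 - t ^ 2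
def shapeNs (κ : Bool) (s : ℝ) : ℝ := if κ then 0 else 1 - 2 * s
def shapeNt (κ : Bool) (t : ℝ) : ℝ := if κ then 1 - 4 * t else -2 * t
def shapeZ (κ : Bool) (s t : ℝ) : ℝ := if κ then 1 - 2 * t else 1 - 2 * s
def shapeZs (κ : Bool) : ℝ := if κ then 0 else -2
/-- The derivative of `t * shapeZ κ s t` in `t`. -/
def shapeZt (κ : Bool) (s t : ℝ) : ℝ := if κ then 1 - 4 * t else 1 - 2 * s

/-- The first coordinate of the quadratic interpolant with nodal radii `g0`, `gh`, `g1`, in the frame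
of the element; here `k = 1 - cos (η / 2)`. -/
def quadX (κ : Bool) (k g0 gh g1 s t : ℝ) : ℝ :=
  g0 + (4 * gh - 3 * g0 - g1) * s + (2 * g0 + 2 * g1 - 4 * gh) * s ^ 2
    + 4 * k * (g1 - gh) * shapeM κ s t - 2 * k ^ 2 * g1 * shapeN κ s t - 4 * k * g1 * t ^ 2

/-- The second coordinate of the quadratic interpolant; here `σ = sin (η / 2)`. -/
def quadY (κ : Bool) (k σ gh g1 s t : ℝ) : ℝ :=
  2 * σ * t * (g1 + 2 * (1 - s) * (gh - g1) + k * g1 * shapeZ κ s t)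

def quadXs (κ : Bool) (k g0 gh g1 s t : ℝ) : ℝ :=
  (4 * gh - 3 * g0 - g1) + 2 * (2 * g0 + 2 * g1 - 4 * gh) * s
    + 4 * k * (g1 - gh) * shapeMs κ s t - 2 * k ^ 2 * g1 * shapeNs κ s

def quadXt (κ : Bool) (k gh g1 s t : ℝ) : ℝ :=
  4 * k * (g1 - gh) * shapeMt κ s - 2 * k ^ 2 * g1 * shapeNt κ t - 8 * k * g1 * t

def quadYs (κ : Bool) (k σ gh g1 t : ℝ) : ℝ :=
  2 * σ * t * (2 * (g1 - gh) + k * g1 * shapeZs κ)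

def quadYt (κ : Bool) (k σ gh g1 s t : ℝ) : ℝ :=
  2 * σ * (g1 + 2 * (1 - s) * (gh - g1) + k * g1 * shapeZt κ s t)

/-- The increment of a quadratic polynomial is its differential at the midpoint applied to the
displacement. This exact formula gives both the strict derivatives and the monotonicity along
chords. -/
theorem quadX_sub (κ : Bool) (k g0 gh g1 s t s' t' : ℝ) :
    quadX κ k g0 gh g1 s' t' - quadX κ k g0 gh g1 s t =
      quadXs κ k g0 gh g1 ((s + s') / 2) ((t + t') / 2) * (s' - s)
        + quadXt κ k gh g1 ((s + s') / 2) ((t + t') / 2) * (t' - t) := by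
  cases κ <;>
    simp only [quadX, quadXs, quadXt, shapeM, shapeMs, shapeMt, shapeN, shapeNs, shapeNt,
      Bool.false_eq_true, if_true, if_false] <;> ring

theorem quadY_sub (κ : Bool) (k σ gh g1 s t s' t' : ℝ) :
    quadY κ k σ gh g1 s' t' - quadY κ k σ gh g1 s t =
      quadYs κ k σ gh g1 ((t + t') / 2) * (s' - s)
        + quadYt κ k σ gh g1 ((s + s') / 2) ((t + t') / 2) * (t' - t) := by
  cases κ <;>
    simp only [quadY, quadYs, quadYt, shapeZ, shapeZs, shapeZt,
      Bool.false_eq_true, if_true, if_false] <;> ring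

/-! ### Normalised derivatives and their sizes -/

theorem abs_mul_le_mul' {a b A B : ℝ} (ha : |a| ≤ A) (hb : |b| ≤ B) : |a * b| ≤ A * B := by
  rw [abs_mul]; exact mul_le_mul ha hb (abs_nonneg _) ((abs_nonneg _).trans ha)

theorem abs_add_le_add' {a b A B : ℝ} (ha : |a| ≤ A) (hb : |b| ≤ B) : |a + b| ≤ A + B :=
  (abs_add_le a b).trans (add_le_add ha hb)

theorem abs_sub_le_add' {a b A B : ℝ} (ha : |a| ≤ A) (hb : |b| ≤ B) : |a - b| ≤ A + B :=
  (abs_sub a b).trans (add_le_add ha hb)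

/-- The derivatives of the interpolant with their natural sizes removed: `X_s / τ'`, `X_t`, `Y_s /
(2 σ τ')` and `Y_t / (2 σ)`. A Jacobian is then `2 σ τ'` times a quantity free of `σ`. -/
def nXs (qs k d ms g1 τ' ns : ℝ) : ℝ := qs + 4 * k * d * ms - 2 * k ^ 2 * (g1 / τ') * ns
def nXt (k τ' d mt g1 nt t : ℝ) : ℝ := 4 * k * (τ' * d) * mt - 2 * k ^ 2 * g1 * nt - 8 * k * g1 * t
def nYs (t d k g1 τ' zs : ℝ) : ℝ := t * (2 * d + k * (g1 / τ') * zs)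
def nYt (ℓ k g1 z : ℝ) : ℝ := ℓ + k * g1 * z

/-- Bounds for the auxiliary numbers that enter the normalised derivatives. -/
structure ShapeBounds (k τ τ' t ms mt ns nt z zs : ℝ) : Prop where
  k_pos : 0 < k
  k_le : k ≤ 1
  τ_pos : 0 < τ
  τ_le : τ ≤ 1
  abs_τ : |τ'| = τ
  t_nonneg : 0 ≤ t
  t_le : t ≤ 1
  ms_le : |ms| ≤ 1
  mt_le : |mt| ≤ 1
  ns_le : |ns| ≤ 1
  nt_le : |nt| ≤ 3
  z_le : |z| ≤ 3
  zs_le : |zs| ≤ 2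

namespace ShapeBounds

variable {k τ τ' t ms mt ns nt z zs : ℝ}

theorem abs_nXs_sub (h : ShapeBounds k τ τ' t ms mt ns nt z zs) {qs d g1 δ G : ℝ} (hd : |d| ≤ δ)
    (hG : |g1| ≤ G) : |nXs qs k d ms g1 τ' ns - qs| ≤ 4 * k * δ + 2 * (k ^ 2 / τ) * G := by
  have e : nXs qs k d ms g1 τ' ns - qs
      = 4 * k * d * ms - 2 * k ^ 2 * (g1 / τ') * ns := by simp only [nXs]; ring
  have hk : |4 * k| ≤ 4 * k := by rw [abs_of_pos (by linarith [h.k_pos])]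
  have hk2 : |2 * k ^ 2| ≤ 2 * k ^ 2 := by rw [abs_of_nonneg (by positivity)]
  have hg : |g1 / τ'| ≤ G / τ := by
    rw [abs_div, h.abs_τ]; exact div_le_div_of_nonneg_right hG h.τ_pos.le
  rw [e]
  refine (abs_sub_le_add' (abs_mul_le_mul' (abs_mul_le_mul' hk hd) h.ms_le)
    (abs_mul_le_mul' (abs_mul_le_mul' hk2 hg) h.ns_le)).trans (le_of_eq ?_)
  ring

/-- Every term of `X_t` carries a factor `k`. The bound `T` is a parameter because the element map
needs `τ |mt|` bounded by the radius, while for the deformed element the bound `1` is enough. -/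
theorem abs_nXt (h : ShapeBounds k τ τ' t ms mt ns nt z zs) {d g1 δ G T : ℝ} (hd : |d| ≤ δ)
    (hG : |g1| ≤ G) (hT : τ * |mt| ≤ T) :
    |nXt k τ' d mt g1 nt t| ≤ 4 * k * δ * T + 14 * k * G := by
  have hk : |4 * k| ≤ 4 * k := by rw [abs_of_pos (by linarith [h.k_pos])]
  have hk8 : |8 * k| ≤ 8 * k := by rw [abs_of_pos (by linarith [h.k_pos])]
  have hk2 : |2 * k ^ 2| ≤ 2 * k := by
    rw [abs_of_nonneg (by positivity)]; nlinarith [h.k_pos, h.k_le]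
  have ht : |t| ≤ 1 := abs_le.2 ⟨by linarith [h.t_nonneg], h.t_le⟩
  have hT' : |τ' * mt| ≤ T := by rw [abs_mul, h.abs_τ]; exact hT
  have e : nXt k τ' d mt g1 nt t
      = 4 * k * d * (τ' * mt) - 2 * k ^ 2 * g1 * nt - 8 * k * g1 * t := by
    simp only [nXt]; ring
  rw [e]
  refine (abs_sub_le_add' (abs_sub_le_add' (abs_mul_le_mul' (abs_mul_le_mul' hk hd) hT')
    (abs_mul_le_mul' (abs_mul_le_mul' hk2 hG) h.nt_le))
    (abs_mul_le_mul' (abs_mul_le_mul' hk8 hG) ht)).trans (le_of_eq ?_)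
  ring

theorem abs_nYs (h : ShapeBounds k τ τ' t ms mt ns nt z zs) {d g1 δ G : ℝ} (hd : |d| ≤ δ)
    (hG : |g1| ≤ G) : |nYs t d k g1 τ' zs| ≤ 2 * δ + 2 * (k / τ) * G := by
  have hk : |k| ≤ k := by rw [abs_of_pos h.k_pos]
  have hg : |g1 / τ'| ≤ G / τ := by
    rw [abs_div, h.abs_τ]; exact div_le_div_of_nonneg_right hG h.τ_pos.le
  have ht : |t| ≤ 1 := abs_le.2 ⟨by linarith [h.t_nonneg], h.t_le⟩
  have h2 : |(2 : ℝ)| ≤ 2 := by norm_num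
  refine (abs_mul_le_mul' ht (abs_add_le_add' (abs_mul_le_mul' h2 hd)
    (abs_mul_le_mul' (abs_mul_le_mul' hk hg) h.zs_le))).trans (le_of_eq ?_)
  ring

theorem abs_nYt_sub (h : ShapeBounds k τ τ' t ms mt ns nt z zs) {ℓ g1 G : ℝ}
    (hG : |g1| ≤ G) : |nYt ℓ k g1 z - ℓ| ≤ 3 * k * G := by
  have hk : |k| ≤ k := by rw [abs_of_pos h.k_pos]
  have e : nYt ℓ k g1 z - ℓ = k * g1 * z := by simp only [nYt]; ring
  rw [e]
  refine (abs_mul_le_mul' (abs_mul_le_mul' hk hG) h.z_le).trans (le_of_eq ?_)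
  ring

/-- The crucial product: the unbounded quotient `k / τ` is compensated by a factor `k`. -/
theorem abs_nXt_mul_nYs (h : ShapeBounds k τ τ' t ms mt ns nt z zs) {d g1 d' g1' δ G T δ' G' : ℝ}
    (hd : |d| ≤ δ) (hG : |g1| ≤ G) (hT : τ * |mt| ≤ T) (hd' : |d'| ≤ δ') (hG' : |g1'| ≤ G') :
    |nXt k τ' d mt g1 nt t * nYs t d' k g1' τ' zs| ≤
      (4 * δ * T + 14 * G) * (2 * k * δ' + 2 * (k ^ 2 / τ) * G') := by
  refine (abs_mul_le_mul' (h.abs_nXt hd hG hT) (h.abs_nYs hd' hG')).trans (le_of_eq ?_)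
  ring

/-- The Jacobian of the element map, divided by `2 σ τ'`, is close to the radius. -/
theorem abs_jac_sub (h : ShapeBounds k τ τ' t ms mt ns nt z zs) {ρ f1 : ℝ} (hρ : 0 < ρ)
    (hf1 : 0 < f1) (hf1' : f1 ≤ 1) (hT : τ * |mt| ≤ ρ) :
    |nXs 1 k (1 / 2) ms f1 τ' ns * nYt ρ k f1 z
        - nXt k τ' (1 / 2) mt f1 nt t * nYs t (1 / 2) k f1 τ' zs - ρ| ≤
      50 * (k + k ^ 2 / τ) * (ρ + f1) := by
  have hk := h.k_pos
  have hk1 := h.k_le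
  have hd : |(1 / 2 : ℝ)| ≤ 1 / 2 := by rw [abs_of_pos (by norm_num)]
  have hG : |f1| ≤ f1 := by rw [abs_of_pos hf1]
  have h1 := h.abs_nXs_sub (qs := 1) hd hG
  have h2 := h.abs_nYt_sub (ℓ := ρ) hG
  have h3 := h.abs_nXt_mul_nYs hd hG hT hd hG
  set w := k ^ 2 / τ with hw
  have hw0 : 0 < w := div_pos (by positivity) h.τ_pos
  set a := nXs 1 k (1 / 2) ms f1 τ' ns
  set b := nYt ρ k f1 z
  set P := nXt k τ' (1 / 2) mt f1 nt t * nYs t (1 / 2) k f1 τ' zs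
  have e : a * b - P - ρ = (a - 1) * (b - ρ) + (a - 1) * ρ + (b - ρ) - P := by ring
  have hρ' : |ρ| ≤ ρ := by rw [abs_of_pos hρ]
  have key := abs_sub_le_add' (abs_add_le_add' (abs_add_le_add' (abs_mul_le_mul' h1 h2)
    (abs_mul_le_mul' h1 hρ')) h2) h3
  rw [e]
  refine key.trans ?_
  have a1 : 4 * k * (1 / 2) + 2 * w * f1 ≤ 2 * (k + w) := by nlinarith
  have a2 : 3 * k * f1 ≤ 3 * (k + w) * f1 := by nlinarith
  have a3 : 2 * k * (1 / 2) + 2 * w * f1 ≤ 2 * (k + w) := by nlinarith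
  have a4 : (4 * k * (1 / 2) + 2 * w * f1) * (3 * k * f1) ≤ (2 * (k + w)) * (3 * f1) :=
    mul_le_mul a1 (by nlinarith) (by positivity) (by positivity)
  have a5 : (4 * k * (1 / 2) + 2 * w * f1) * ρ ≤ 2 * (k + w) * ρ :=
    mul_le_mul_of_nonneg_right a1 hρ.le
  have a6 : (4 * (1 / 2) * ρ + 14 * f1) * (2 * k * (1 / 2) + 2 * w * f1) ≤
      (2 * ρ + 14 * f1) * (2 * (k + w)) :=
    mul_le_mul (by linarith) a3 (by positivity) (by positivity)
  have a7 : 0 ≤ (k + w) * ρ := by positivity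
  have a8 : 0 ≤ (k + w) * f1 := by positivity
  nlinarith

end ShapeBounds

/-- Data of the deformed element at a point: `u1` is the value of the profile at `s = 1`, `d` its
slope there, `qs` and `ℓ` the normalised derivatives of its interpolant, `R` and `R'` the values of
the profile and of its derivative. -/
structure ProfileBounds (M τ fb u1 d qs ℓ R R' : ℝ) : Prop where
  one_le : 1 ≤ M
  fb_pos : 0 < fb
  fb_le : fb ≤ 1
  u1_le : |u1| ≤ M
  d_le : |d| ≤ M * fb
  R_le : |R| ≤ M
  R'_le : |R'| ≤ M * fb
  qs_sub : |qs - R'| ≤ M * τ ^ 2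
  ℓ_sub : |ℓ - R| ≤ M * τ ^ 2

namespace ShapeBounds

variable {k τ τ' t ms mt ns nt z zs : ℝ}

/-- The terms of first order in `k` are multiplied by `R'` or by the slope `d`, both at most `M *
fb`. The resulting `k * fb`, instead of `k`, is what makes the error small relative to the radius,
and so the determinant positive, near the cavity. -/
theorem abs_det_sub (h : ShapeBounds k τ τ' t ms mt ns nt z zs)
    {M fb u1 d qs ℓ R R' : ℝ} (hp : ProfileBounds M τ fb u1 d qs ℓ R R') :
    |nXs qs k d ms u1 τ' ns * nYt ℓ k u1 z
        - nXt k τ' d mt u1 nt t * nYs t d k u1 τ' zs - R * R'| ≤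
      100 * M ^ 2 * (τ ^ 2 + k * fb + k ^ 2 / τ) := by
  have hk := h.k_pos
  have hk1 := h.k_le
  have hτ := h.τ_pos
  have hτ1 := h.τ_le
  have hfb := hp.fb_pos
  have hfb1 := hp.fb_le
  have hM := hp.one_le
  have hT : τ * |mt| ≤ 1 := by nlinarith [h.mt_le, abs_nonneg mt]
  have h1 := h.abs_nXs_sub (qs := qs) hp.d_le hp.u1_le
  have h2 := h.abs_nYt_sub (ℓ := ℓ) hp.u1_le
  have h3 := h.abs_nXt_mul_nYs hp.d_le hp.u1_le hT hp.d_le hp.u1_le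
  set w := k ^ 2 / τ with hw
  have hw0 : 0 < w := div_pos (by positivity) h.τ_pos
  set a := nXs qs k d ms u1 τ' ns
  set b := nYt ℓ k u1 z
  set P := nXt k τ' d mt u1 nt t * nYs t d k u1 τ' zs
  set Q := τ ^ 2 + k * fb + w with hQ
  have hτ2 : τ ^ 2 ≤ 1 := by nlinarith
  have hkfb : 0 < k * fb := by positivity
  have ha : |a - R'| ≤ 5 * M * Q := by
    have : a - R' = (a - qs) + (qs - R') := by ring
    rw [this]
    refine (abs_add_le_add' h1 hp.qs_sub).trans ?_
    have : 0 < M := by linarith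
    nlinarith [mul_pos this hw0, mul_pos this hkfb, mul_pos this (pow_pos hτ 2)]
  have hb : |b - R| ≤ M * τ ^ 2 + 3 * k * M := by
    have : b - R = (b - ℓ) + (ℓ - R) := by ring
    rw [this]
    refine (abs_add_le_add' h2 hp.ℓ_sub).trans (by linarith)
  have hb' : |b - R| ≤ 4 * M := hb.trans (by nlinarith)
  have e : a * b - P - R * R' = (a - R') * (b - R) + (a - R') * R + R' * (b - R) - P := by ring
  rw [e]
  refine (abs_sub_le_add' (abs_add_le_add' (abs_add_le_add' (abs_mul_le_mul' ha hb')
    (abs_mul_le_mul' ha hp.R_le)) (abs_mul_le_mul' hp.R'_le hb)) h3).trans ?_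
  have hM2 : 0 < M ^ 2 := by positivity
  have b1 : M * fb * (M * τ ^ 2 + 3 * k * M) ≤ 4 * (M ^ 2 * Q) := by
    have : M * fb * (M * τ ^ 2 + 3 * k * M) = M ^ 2 * (fb * τ ^ 2 + 3 * (k * fb)) := by ring
    rw [this]
    have : fb * τ ^ 2 + 3 * (k * fb) ≤ 4 * Q := by nlinarith [pow_pos hτ 2]
    nlinarith
  have b2 : 4 * (M * fb) * 1 + 14 * M ≤ 18 * M := by nlinarith
  have b3 : 2 * k * (M * fb) + 2 * w * M ≤ 2 * M * Q := by
    have : 2 * k * (M * fb) + 2 * w * M = 2 * M * (k * fb + w) := by ring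
    rw [this]
    have : k * fb + w ≤ Q := by nlinarith [pow_pos hτ 2]
    nlinarith
  have b4 : (4 * (M * fb) * 1 + 14 * M) * (2 * k * (M * fb) + 2 * w * M) ≤ 18 * M * (2 * M * Q) :=
    mul_le_mul b2 b3 (by positivity) (by positivity)
  have hMQ : 0 < M ^ 2 * Q := by positivity
  nlinarith

/-- The sum of the squares of the entries of `DU · adj(DF)`, divided by `(2 σ τ')²`. -/
def frobNum (σ xU tU sU yU xF tF sF yF : ℝ) : ℝ :=
  (xU * yF - tU * sF) ^ 2 + (yU * xF - sU * tF) ^ 2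
    + ((tU * xF - xU * tF) / (2 * σ)) ^ 2 + (2 * σ * (sU * yF - yU * sF)) ^ 2

theorem abs_sq_sub_sq_le {x y A E : ℝ} (hx : |x - y| ≤ E) (hy : |y| ≤ A) (hE : E ≤ A) :
    |x ^ 2 - y ^ 2| ≤ 3 * A * E := by
  have : x ^ 2 - y ^ 2 = (x - y) * ((x - y) + 2 * y) := by ring
  rw [this]
  have h2 : |2 * y| ≤ 2 * A := by rw [abs_mul, abs_two]; linarith
  refine (abs_mul_le_mul' hx (abs_add_le_add' hx h2)).trans ?_
  have : 0 ≤ E := (abs_nonneg _).trans hx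
  nlinarith

/-- The entry that is divided by `σ`: its numerator is `O(k)` because both `X_t` are, and `σ² ≥ k`,
so the square is `O(k² / k)`. -/
theorem abs_sub_div_two_mul_le {T1 T2 x1 x2 σ A : ℝ} (hσ : 0 < σ) (hσk : σ ^ 2 = 2 * k - k ^ 2)
    (hk : 0 < k) (hk1 : k ≤ 1) (hT1 : |T1| ≤ A * k) (hT2 : |T2| ≤ A * k) (hx1 : |x1| ≤ A)
    (hx2 : |x2| ≤ A) : ((T1 * x2 - x1 * T2) / (2 * σ)) ^ 2 ≤ A ^ 4 * k := by
  have h1 : |T1 * x2 - x1 * T2| ≤ 2 * A ^ 2 * k :=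
    (abs_sub_le_add' (abs_mul_le_mul' hT1 hx2) (abs_mul_le_mul' hx1 hT2)).trans (by nlinarith)
  have h2 : (T1 * x2 - x1 * T2) ^ 2 ≤ (2 * A ^ 2 * k) ^ 2 := sq_le_sq' (abs_le.1 h1).1 (abs_le.1 h1).2
  rw [div_pow, div_le_iff₀ (by positivity)]
  refine h2.trans ?_
  have h3 : k ≤ σ ^ 2 := by nlinarith
  have : 0 ≤ A ^ 4 * k := by positivity
  nlinarith

/-- Here `k / τ'` occurs with no compensating factor `k`, so the two products cannot be estimated
separately. The singular parts cancel because `ρ` and `ℓ` are affine in the same variable `v`, which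
is `1 - s` in the application. -/
theorem cross_entry_sq_le (h : ShapeBounds k τ τ' t ms mt ns nt z zs) {M d u1 ℓ ρ f1 σ v : ℝ}
    (hM : 1 ≤ M) (hd : |d| ≤ M) (hu : |u1| ≤ M) (hσk : σ ^ 2 = 2 * k - k ^ 2) (hf1 : |f1| ≤ 1)
    (hρv : ρ = f1 - v * τ') (hv : |v| ≤ 1) (hℓv : ℓ = u1 - 2 * v * (τ' * d)) :
    (2 * σ * (nYs t d k u1 τ' zs * nYt ρ k f1 z
      - nYt ℓ k u1 z * nYs t (1 / 2) k f1 τ' zs)) ^ 2 ≤ 2592 * M ^ 2 * k := by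
  have hk := h.k_pos
  have hk1 := h.k_le
  have hτ'0 : τ' ≠ 0 := by
    intro h0; have := h.abs_τ; rw [h0, abs_zero] at this; linarith [h.τ_pos]
  -- The difference has the factor `2 d f1 - u1` and no quotient by `τ'` is left.
  have q21 : nYs t d k u1 τ' zs * nYt ρ k f1 z - nYt ℓ k u1 z * nYs t (1 / 2) k f1 τ' zs
      = t * ((2 * d * f1 - u1) * (1 + k * (zs * v) + k * z)) := by
    simp only [nYs, nYt, hρv, hℓv]; field_simp; ring
  have ht : |t| ≤ 1 := abs_le.2 ⟨by linarith [h.t_nonneg], h.t_le⟩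
  have hka : |k| ≤ 1 := by rw [abs_of_pos hk]; exact hk1
  have h2 : |(2 : ℝ)| ≤ 2 := by norm_num
  have hb : |t * ((2 * d * f1 - u1) * (1 + k * (zs * v) + k * z))| ≤ 18 * M := by
    refine (abs_mul_le_mul' ht (abs_mul_le_mul' (abs_sub_le_add'
      (abs_mul_le_mul' (abs_mul_le_mul' h2 hd) hf1) hu) (abs_add_le_add' (abs_add_le_add'
      (by simp : |(1 : ℝ)| ≤ 1) (abs_mul_le_mul' hka (abs_mul_le_mul' h.zs_le hv)))
      (abs_mul_le_mul' hka h.z_le)))).trans ?_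
    linarith
  have hb2 := sq_le_sq' (abs_le.1 hb).1 (abs_le.1 hb).2
  rw [q21, mul_pow, mul_pow, hσk]
  have : 0 ≤ (18 * M) ^ 2 := by positivity
  have h4 : 2 ^ 2 * (2 * k - k ^ 2) ≤ 8 * k := by nlinarith
  have h5 : 0 ≤ 8 * k := by linarith
  calc _ ≤ 8 * k * (18 * M) ^ 2 := mul_le_mul h4 hb2 (by positivity) h5
    _ = _ := by ring

theorem diag_entries_sub (h : ShapeBounds k τ τ' t ms mt ns nt z zs)
    {M fb u1 d qs ℓ R R' ρ f1 m : ℝ} (hp : ProfileBounds M τ fb u1 d qs ℓ R R')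
    (hf1 : |f1| ≤ 1) (hρ : |ρ| ≤ 1) (hkm : k ≤ m) (hwm : k ^ 2 / τ ≤ m) (hτm : τ ^ 2 ≤ m)
    (hm1 : m ≤ 1) :
    |(nXs qs k d ms u1 τ' ns * nYt ρ k f1 z - nXt k τ' d mt u1 nt t * nYs t (1 / 2) k f1 τ' zs)
      - ρ * R'| ≤ 200 * M * m ∧
    |(nYt ℓ k u1 z * nXs 1 k (1 / 2) ms f1 τ' ns
      - nYs t d k u1 τ' zs * nXt k τ' (1 / 2) mt f1 nt t) - R| ≤ 200 * M * m ∧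
    |nXs qs k d ms u1 τ' ns| ≤ 18 * M ∧ |nXs 1 k (1 / 2) ms f1 τ' ns| ≤ 18 * M ∧
    |nXt k τ' d mt u1 nt t| ≤ 18 * M * k ∧ |nXt k τ' (1 / 2) mt f1 nt t| ≤ 18 * M * k := by
  have hk := h.k_pos
  have hM := hp.one_le
  have hM0 : 0 < M := by linarith
  have hm0 : 0 < m := by linarith
  have hfb1 := hp.fb_le
  have hT : τ * |mt| ≤ 1 := by nlinarith [h.mt_le, abs_nonneg mt, h.τ_le, h.τ_pos]
  have hd : |d| ≤ M := hp.d_le.trans (by nlinarith)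
  have hR' : |R'| ≤ M := hp.R'_le.trans (by nlinarith)
  have hdF : |(1 / 2 : ℝ)| ≤ 1 := by rw [abs_of_pos (by norm_num)]; norm_num
  have x1 := h.abs_nXs_sub (qs := qs) hd hp.u1_le
  have y1 := h.abs_nYt_sub (ℓ := ℓ) hp.u1_le
  have x2 := h.abs_nXs_sub (qs := 1) hdF hf1
  have y2 := h.abs_nYt_sub (ℓ := ρ) hf1
  have p12 := h.abs_nXt_mul_nYs hd hp.u1_le hT hdF hf1
  have p21 := h.abs_nXt_mul_nYs hdF hf1 hT hd hp.u1_le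
  have t1 := h.abs_nXt hd hp.u1_le hT
  have t2 := h.abs_nXt hdF hf1 hT
  set w := k ^ 2 / τ with hw
  have hw0 : 0 < w := div_pos (by positivity) h.τ_pos
  generalize nXs qs k d ms u1 τ' ns = a at *
  generalize nYt ℓ k u1 z = b at *
  generalize nXs 1 k (1 / 2) ms f1 τ' ns = a' at *
  generalize nYt ρ k f1 z = b' at *
  generalize nXt k τ' d mt u1 nt t = T1 at *
  generalize nXt k τ' (1 / 2) mt f1 nt t = T2 at *
  generalize nYs t d k u1 τ' zs = S1 at *
  generalize nYs t (1 / 2) k f1 τ' zs = S2 at *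
  have Mk : M * k ≤ M * m := mul_le_mul_of_nonneg_left hkm hM0.le
  have Mw : M * w ≤ M * m := mul_le_mul_of_nonneg_left hwm hM0.le
  have Mτ : M * τ ^ 2 ≤ M * m := mul_le_mul_of_nonneg_left hτm hM0.le
  have Mm : m ≤ M * m := by nlinarith
  have MM : M * m ≤ M := by nlinarith
  have Mmm : M * m * m ≤ M * m := by nlinarith [mul_pos hM0 hm0]
  have ha : |a - R'| ≤ 7 * M * m := by
    have : a - R' = (a - qs) + (qs - R') := by ring
    rw [this]
    exact (abs_add_le_add' x1 hp.qs_sub).trans (by linarith)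
  have hb : |b - R| ≤ 4 * M * m := by
    have : b - R = (b - ℓ) + (ℓ - R) := by ring
    rw [this]
    exact (abs_add_le_add' y1 hp.ℓ_sub).trans (by linarith)
  have ha' : |a' - 1| ≤ 6 * m := x2.trans (by linarith)
  have hb' : |b' - ρ| ≤ 3 * m := y2.trans (by linarith)
  have P12 : |T1 * S2| ≤ 72 * M * m := p12.trans (by linarith)
  have P21 : |T2 * S1| ≤ 72 * M * m := by
    refine p21.trans (by linarith)
  have h1a : |(1 : ℝ)| ≤ 1 := by simp
  refine ⟨?_, ?_, ?_, ?_, t1.trans (by linarith), t2.trans (by nlinarith)⟩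
  · have e : (a * b' - T1 * S2) - ρ * R'
        = (a - R') * (b' - ρ) + (a - R') * ρ + R' * (b' - ρ) - T1 * S2 := by ring
    rw [e]
    refine (abs_sub_le_add' (abs_add_le_add' (abs_add_le_add' (abs_mul_le_mul' ha hb')
      (abs_mul_le_mul' ha hρ)) (abs_mul_le_mul' hR' hb')) P12).trans ?_
    linarith [Mmm]
  · have e : (b * a' - S1 * T2) - R
        = (b - R) * (a' - 1) + (b - R) * 1 + R * (a' - 1) - T2 * S1 := by ring
    rw [e]
    refine (abs_sub_le_add' (abs_add_le_add' (abs_add_le_add' (abs_mul_le_mul' hb ha')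
      (abs_mul_le_mul' hb h1a)) (abs_mul_le_mul' hp.R_le ha')) P21).trans ?_
    linarith [Mmm]
  · have e : a = (a - R') + R' := by ring
    rw [e]; exact (abs_add_le_add' ha hR').trans (by linarith)
  · have e : a' = (a' - 1) + 1 := by ring
    rw [e]; exact (abs_add_le_add' ha' h1a).trans (by linarith)

theorem abs_frobNum_sub_le {σ xU tU sU yU xF tF sF yF M k ρ R R' H m : ℝ} (hM : 1 ≤ M)
    (hkH : k ≤ H) (hm : 0 ≤ m) (hmH : m ≤ H) (hm1 : m ≤ 1) (hρR' : |ρ * R'| ≤ M)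
    (hR : |R| ≤ M)
    (E11 : |(xU * yF - tU * sF) - ρ * R'| ≤ 200 * M * m)
    (E22 : |(yU * xF - sU * tF) - R| ≤ 200 * M * m)
    (E12 : ((tU * xF - xU * tF) / (2 * σ)) ^ 2 ≤ (18 * M) ^ 4 * k)
    (E21 : (2 * σ * (sU * yF - yU * sF)) ^ 2 ≤ 2592 * M ^ 2 * k) :
    |frobNum σ xU tU sU yU xF tF sF yF - (R ^ 2 + ρ ^ 2 * R' ^ 2)| ≤ 400000 * M ^ 4 * H := by
  have hM0 : 0 < M := by linarith
  have hE : 200 * M * m ≤ 200 * M := mul_le_of_le_one_right (by positivity) hm1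
  have F11 := abs_sq_sub_sq_le (A := 200 * M) E11 (hρR'.trans (by linarith)) hE
  have F22 := abs_sq_sub_sq_le (A := 200 * M) E22 (hR.trans (by linarith)) hE
  unfold frobNum
  generalize xU * yF - tU * sF = e11 at *
  generalize yU * xF - sU * tF = e22 at *
  generalize (tU * xF - xU * tF) / (2 * σ) = e12 at *
  generalize 2 * σ * (sU * yF - yU * sF) = e21 at *
  have M24 : M ^ 2 * H ≤ M ^ 4 * H :=
    mul_le_mul_of_nonneg_right (pow_le_pow_right₀ hM (by norm_num)) (hm.trans hmH)
  have e : e11 ^ 2 + e22 ^ 2 + e12 ^ 2 + e21 ^ 2 - (R ^ 2 + ρ ^ 2 * R' ^ 2)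
      = (e11 ^ 2 - (ρ * R') ^ 2) + (e22 ^ 2 - R ^ 2) + e12 ^ 2 + e21 ^ 2 := by ring
  rw [e]
  refine (abs_add_le_add' (abs_add_le_add' (abs_add_le_add' F11 F22)
    ((abs_of_nonneg (sq_nonneg _)).le.trans E12))
    ((abs_of_nonneg (sq_nonneg _)).le.trans E21)).trans ?_
  have g1 : M ^ 4 * k ≤ M ^ 4 * H := mul_le_mul_of_nonneg_left hkH (by positivity)
  have g2 : M ^ 2 * k ≤ M ^ 2 * H := mul_le_mul_of_nonneg_left hkH (by positivity)
  have g3 : M ^ 2 * m ≤ M ^ 2 * H := mul_le_mul_of_nonneg_left hmH (by positivity)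
  have e1 : (18 * M) ^ 4 * k = 104976 * (M ^ 4 * k) := by ring
  have e2 : 3 * (200 * M) * (200 * M * m) = 120000 * (M ^ 2 * m) := by ring
  rw [e1, e2]
  have : 0 ≤ M ^ 4 * H := by have := hm.trans hmH; positivity
  linarith

/-- Since `H` may exceed `1`, the diagonal entries are estimated with `min H 1`, which allows
products of errors to be absorbed. The off-diagonal entries enter only through their squares, which
are `O(k)`. -/
theorem abs_frobNum_sub (h : ShapeBounds k τ τ' t ms mt ns nt z zs)
    {M fb u1 d qs ℓ R R' ρ f1 σ H v : ℝ} (hp : ProfileBounds M τ fb u1 d qs ℓ R R')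
    (hσ : 0 < σ) (hσk : σ ^ 2 = 2 * k - k ^ 2) (hf1 : |f1| ≤ 1) (hρ : |ρ| ≤ 1)
    (hkH : k ≤ H) (hwH : k ^ 2 / τ ≤ H) (hτH : τ ^ 2 ≤ H) (hw1 : k ^ 2 / τ ≤ 1)
    (hρv : ρ = f1 - v * τ') (hv : |v| ≤ 1) (hℓv : ℓ = u1 - 2 * v * (τ' * d)) :
    |frobNum σ (nXs qs k d ms u1 τ' ns) (nXt k τ' d mt u1 nt t) (nYs t d k u1 τ' zs)
        (nYt ℓ k u1 z) (nXs 1 k (1 / 2) ms f1 τ' ns) (nXt k τ' (1 / 2) mt f1 nt t)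
        (nYs t (1 / 2) k f1 τ' zs) (nYt ρ k f1 z) - (R ^ 2 + ρ ^ 2 * R' ^ 2)| ≤
      400000 * M ^ 4 * H := by
  have hM := hp.one_le
  have hM0 : 0 < M := by linarith
  have hfb1 := hp.fb_le
  have hd : |d| ≤ M := hp.d_le.trans (by nlinarith)
  have hR' : |R'| ≤ M := hp.R'_le.trans (by nlinarith)
  have hτ2 : τ ^ 2 ≤ 1 := by nlinarith [h.τ_pos, h.τ_le]
  obtain ⟨E11, E22, hx1, hx2, hT1, hT2⟩ := h.diag_entries_sub hp hf1 hρ (le_min hkH h.k_le)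
    (le_min hwH hw1) (le_min hτH hτ2) (min_le_right H 1)
  have hH : 0 < H := h.k_pos.trans_le hkH
  exact abs_frobNum_sub_le hM hkH (le_min hH.le zero_le_one) (min_le_left _ _)
    (min_le_right _ _) ((abs_mul_le_mul' hρ hR').trans (by linarith)) hp.R_le E11 E22
    (abs_sub_div_two_mul_le hσ hσk h.k_pos h.k_le hT1 hT2 hx1 hx2)
    (h.cross_entry_sq_le hM hd hp.u1_le hσk hf1 hρv hv hℓv)

end ShapeBounds

/-! ### Comparison of energy densities -/

/-- By homogeneity this is `|u ^ α - 1| ≤ |u - 1|` for `u = x / y`. Unlike the mean value theorem it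
needs no positive lower bound for `x`. -/
theorem abs_rpow_sub_rpow_le {α x y : ℝ} (h0 : 0 < α) (h1 : α ≤ 1) (hx : 0 ≤ x) (hy : 0 < y) :
    |x ^ α - y ^ α| ≤ |x - y| * y ^ (α - 1) := by
  have hz : y ^ α = y * y ^ (α - 1) := by
    rw [← Real.rpow_one_add' hy.le (by linarith)]; congr 1; ring
  set u := x / y with hu
  have hu0 : 0 ≤ u := div_nonneg hx hy.le
  have hxu : x = u * y := by rw [hu]; field_simp
  have hxa : x ^ α = u ^ α * y ^ α := by rw [hxu, Real.mul_rpow hu0 hy.le]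
  have hyα : 0 < y ^ α := Real.rpow_pos_of_pos hy _
  have key : |u ^ α - 1| ≤ |u - 1| := by
    rcases le_total u 1 with h | h
    · have h2 : u ≤ u ^ α := by
        rcases hu0.eq_or_lt with h' | h'
        · rw [← h', Real.zero_rpow h0.ne']
        · calc u = u ^ (1 : ℝ) := (Real.rpow_one u).symm
            _ ≤ u ^ α := Real.rpow_le_rpow_of_exponent_ge h' h h1
      have h3 : u ^ α ≤ 1 := Real.rpow_le_one hu0 h h0.le
      rw [abs_of_nonpos (by linarith), abs_of_nonpos (by linarith)]; linarith
    · have h2 : u ^ α ≤ u := by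
        calc u ^ α ≤ u ^ (1 : ℝ) := Real.rpow_le_rpow_of_exponent_le h h1
          _ = u := Real.rpow_one u
      have h3 : 1 ≤ u ^ α := Real.one_le_rpow h h0.le
      rw [abs_of_nonneg (by linarith), abs_of_nonneg (by linarith)]; linarith
  calc |x ^ α - y ^ α| = |u ^ α - 1| * y ^ α := by
        rw [hxa, ← sub_one_mul, abs_mul, abs_of_pos hyα]
    _ ≤ |u - 1| * y ^ α := by gcongr
    _ = |x - y| * y ^ (α - 1) := by
        rw [hz, hxu, ← sub_one_mul, abs_mul, abs_of_pos hy]; ring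

/-- The energy density of a radial map with radial stretch `R'` and tangential stretch `R / ρ`. -/
def radialDensity (ω p : ℝ) (g : ℝ → ℝ) (R' R ρ : ℝ) : ℝ :=
  ω * √(R' ^ 2 + (R / ρ) ^ 2) ^ p + g (R' * R / ρ)

theorem radialDensity_mul {ω p : ℝ} {g : ℝ → ℝ} {R' R ρ : ℝ} (hρ : 0 < ρ) :
    radialDensity ω p g R' R ρ * ρ =
      ω * (R ^ 2 + ρ ^ 2 * R' ^ 2) ^ (p / 2) * ρ ^ (1 - p) + g (R' * R / ρ) * ρ := by
  have e : R' ^ 2 + (R / ρ) ^ 2 = (R ^ 2 + ρ ^ 2 * R' ^ 2) / ρ ^ 2 := by field_simp; ring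
  have e2 : √(R' ^ 2 + (R / ρ) ^ 2) ^ p = (R ^ 2 + ρ ^ 2 * R' ^ 2) ^ (p / 2) * ρ ^ (-p) := by
    rw [e, Real.sqrt_eq_rpow, ← Real.rpow_mul (by positivity), Real.div_rpow (by positivity)
      (by positivity), ← Real.rpow_natCast ρ 2, ← Real.rpow_mul hρ.le, Real.rpow_neg hρ.le,
      div_eq_mul_inv]
    congr 2
    · ring
    · congr 1; push_cast; ring
  rw [radialDensity, e2, show (1 : ℝ) - p = -p + 1 by ring, Real.rpow_add hρ, Real.rpow_one]
  ring

theorem sqrt_div_rpow_mul {p x j : ℝ} (hx : 0 ≤ x) (hj : 0 < j) :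
    (√x / j) ^ p * j = x ^ (p / 2) * j ^ (1 - p) := by
  rw [Real.div_rpow (Real.sqrt_nonneg _) hj.le, Real.sqrt_eq_rpow, ← Real.rpow_mul hx,
    Real.rpow_sub hj, Real.rpow_one]
  have : j ^ p ≠ 0 := (Real.rpow_pos_of_pos hj _).ne'
  rw [show 1 / 2 * p = p / 2 by ring]
  field_simp

theorem IsVolumetricEnergy.exists_bounds {g : ℝ → ℝ} (hg : IsVolumetricEnergy g) {x y : ℝ}
    (hx : 0 < x) : ∃ G L : ℝ, 0 ≤ G ∧ 0 ≤ L ∧ (∀ d ∈ Icc x y, |g d| ≤ G) ∧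
      ∀ d ∈ Icc x y, ∀ d' ∈ Icc x y, |g d - g d'| ≤ L * |d - d'| := by
  have hs : Icc x y ⊆ Ioi 0 := fun d hd => hx.trans_le hd.1
  obtain ⟨L, hL⟩ := (hg.contDiffOn.mono hs).exists_lipschitzOnWith one_ne_zero (convex_Icc x y)
    isCompact_Icc
  obtain ⟨G, hG⟩ := isCompact_Icc.exists_bound_of_continuousOn (hg.contDiffOn.mono hs).continuousOn
  refine ⟨max G 0, L, le_max_right _ _, L.2, fun d hd => (hG d hd).trans (le_max_left _ _),
    fun d hd d' hd' => ?_⟩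
  have := hL.dist_le_mul d hd d' hd'
  rwa [Real.dist_eq, Real.dist_eq] at this

/-- The tangential stretch `R / ρ ≥ c / ρ` dominates near the cavity and gives the weight the size
`ρ ^ (1 - p)`. The lower bound is what converts error bounds into relative ones. -/
theorem radialDensity_bounds {ω p c a M : ℝ} {g : ℝ → ℝ} (hp : 1 < p) (hp2 : p < 2) (hω : 0 < ω)
    (hg : IsVolumetricEnergy g) (hc : 0 < c) (ha : 0 < a) (hM : 1 ≤ M) :
    ∃ K : ℝ, 0 ≤ K ∧ ∀ ρ R R' : ℝ, 0 < ρ → ρ ≤ 1 → c ≤ R → R ≤ M → a * ρ ≤ R' → R' ≤ M * ρ →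
      ω * c ^ p * ρ ^ (1 - p) ≤ radialDensity ω p g R' R ρ * ρ ∧
      radialDensity ω p g R' R ρ * ρ ≤ K * ρ ^ (1 - p) := by
  obtain ⟨G, L, hG0, -, hG, -⟩ := hg.exists_bounds (x := a * c) (y := M ^ 2) (by positivity)
  refine ⟨ω * (2 * M ^ 2) ^ (p / 2) + G, by positivity, fun ρ R R' hρ hρ1 hcR hRM haR hRb => ?_⟩
  have hR' : 0 < R' := (by positivity : 0 < a * ρ).trans_le haR
  have hR : 0 < R := hc.trans_le hcR
  have hρR' : ρ * R' ≤ M := by nlinarith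
  have hy1 : c ^ 2 ≤ R ^ 2 + ρ ^ 2 * R' ^ 2 := by nlinarith [sq_nonneg (ρ * R')]
  have hy2 : R ^ 2 + ρ ^ 2 * R' ^ 2 ≤ 2 * M ^ 2 := by nlinarith [mul_pos hρ hR']
  have h1 : c ^ p ≤ (R ^ 2 + ρ ^ 2 * R' ^ 2) ^ (p / 2) := by
    have : c ^ p = (c ^ 2) ^ (p / 2) := by
      rw [← Real.rpow_natCast c 2, ← Real.rpow_mul hc.le]; congr 1; push_cast; ring
    rw [this]; exact Real.rpow_le_rpow (by positivity) hy1 (by linarith)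
  have h2 : (R ^ 2 + ρ ^ 2 * R' ^ 2) ^ (p / 2) ≤ (2 * M ^ 2) ^ (p / 2) :=
    Real.rpow_le_rpow (by positivity) hy2 (by linarith)
  have hd : R' * R / ρ ∈ Icc (a * c) (M ^ 2) := by
    constructor
    · rw [le_div_iff₀ hρ]; nlinarith [mul_pos ha hρ]
    · rw [div_le_iff₀ hρ]; nlinarith
  have h3 := le_of_abs_le (hG _ hd)
  have h4 := hg.pos _ ((by positivity : 0 < a * c).trans_le hd.1)
  have h5 : 1 ≤ ρ ^ (1 - p) := Real.one_le_rpow_of_pos_of_le_one_of_nonpos hρ hρ1 (by linarith)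
  rw [radialDensity_mul hρ]
  constructor
  · have : ω * c ^ p * ρ ^ (1 - p) ≤ ω * (R ^ 2 + ρ ^ 2 * R' ^ 2) ^ (p / 2) * ρ ^ (1 - p) := by
      gcongr
    nlinarith [mul_pos h4 hρ]
  · rw [add_mul]
    refine add_le_add (by gcongr) ?_
    calc g (R' * R / ρ) * ρ ≤ G * 1 := mul_le_mul h3 hρ1 hρ.le hG0
      _ ≤ G * ρ ^ (1 - p) := by gcongr

theorem rpow_one_sub_le {p ρ j : ℝ} (hp : 1 < p) (hp2 : p < 2) (hρ : 0 < ρ)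
    (hj1 : ρ / 2 ≤ j) : j ^ (1 - p) ≤ 2 * ρ ^ (1 - p) := by
  have h1 : j ^ (1 - p) ≤ (ρ / 2) ^ (1 - p) :=
    Real.rpow_le_rpow_of_nonpos (by positivity) hj1 (by linarith)
  have h2 : (ρ / 2) ^ (1 - p) = ρ ^ (1 - p) * 2 ^ (p - 1) := by
    rw [Real.div_rpow hρ.le zero_le_two, div_eq_mul_inv, ← Real.rpow_neg zero_le_two]
    congr 2; ring
  have h3 : (2 : ℝ) ^ (p - 1) ≤ 2 := by
    calc (2 : ℝ) ^ (p - 1) ≤ 2 ^ (1 : ℝ) :=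
          Real.rpow_le_rpow_of_exponent_le one_le_two (by linarith)
      _ = 2 := Real.rpow_one _
  rw [h2] at h1
  calc j ^ (1 - p) ≤ ρ ^ (1 - p) * 2 ^ (p - 1) := h1
    _ ≤ ρ ^ (1 - p) * 2 := by gcongr
    _ = _ := by ring

/-- The reciprocals have the exponent `p - 1` in `(0, 1)`, so `abs_rpow_sub_rpow_le` applies to
them; `j ≥ ρ / 2` is used to invert. -/
theorem abs_rpow_one_sub_sub_le {p ρ j : ℝ} (hp : 1 < p) (hp2 : p < 2) (hρ : 0 < ρ)
    (hj1 : ρ / 2 ≤ j) : |j ^ (1 - p) - ρ ^ (1 - p)| ≤ 2 * ρ ^ (-p) * |j - ρ| := by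
  have hj0 : 0 < j := (by positivity : 0 < ρ / 2).trans_le hj1
  have hb := abs_rpow_sub_rpow_le (α := p - 1) (by linarith) (by linarith) hj0.le hρ
  have e1 : j ^ (1 - p) = (j ^ (p - 1))⁻¹ := by rw [← Real.rpow_neg hj0.le]; congr 1; ring
  have e2 : ρ ^ (1 - p) = (ρ ^ (p - 1))⁻¹ := by rw [← Real.rpow_neg hρ.le]; congr 1; ring
  have q1 : 0 < j ^ (p - 1) := Real.rpow_pos_of_pos hj0 _
  have q2 : 0 < ρ ^ (p - 1) := Real.rpow_pos_of_pos hρ _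
  have e3 : ρ ^ (p - 1 - 1) = ρ ^ (p - 1) / ρ := by rw [Real.rpow_sub hρ (p - 1) 1, Real.rpow_one]
  have e4 : ρ ^ (-p) = (ρ ^ (p - 1) * ρ)⁻¹ := by
    rw [← Real.rpow_add_one hρ.ne', ← Real.rpow_neg hρ.le]; congr 1; ring
  have h3 : ρ ^ (p - 1) ≤ 2 * j ^ (p - 1) := by
    have : ρ ^ (p - 1) ≤ (2 * j) ^ (p - 1) :=
      Real.rpow_le_rpow hρ.le (by linarith) (by linarith)
    rw [Real.mul_rpow zero_le_two hj0.le] at this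
    have h3 : (2 : ℝ) ^ (p - 1) ≤ 2 := by
      calc (2 : ℝ) ^ (p - 1) ≤ 2 ^ (1 : ℝ) :=
            Real.rpow_le_rpow_of_exponent_le one_le_two (by linarith)
        _ = 2 := Real.rpow_one _
    exact this.trans (by gcongr)
  have e5 : (j ^ (p - 1))⁻¹ - (ρ ^ (p - 1))⁻¹
      = -((j ^ (p - 1) - ρ ^ (p - 1)) / (j ^ (p - 1) * ρ ^ (p - 1))) := by field_simp; ring
  rw [e1, e2, e5, abs_neg, abs_div, abs_of_pos (mul_pos q1 q2), div_le_iff₀ (mul_pos q1 q2)]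
  refine hb.trans ?_
  rw [e3, e4]
  have : 2 * (ρ ^ (p - 1) * ρ)⁻¹ * |j - ρ| * (j ^ (p - 1) * ρ ^ (p - 1))
      = |j - ρ| * (2 * j ^ (p - 1) / ρ) := by field_simp
  rw [this]
  gcongr

/-- The pointwise comparison with `x`, `v`, `j` standing for the Frobenius numerator, the Jacobian
of the deformed element and that of the element map. The length `l ≥ ρ` is kept separate because the
error of `j` is not bounded by a multiple of `H ρ` on inner pieces. -/
theorem exists_density_diff_le {ω p c a M K₁ : ℝ} {g : ℝ → ℝ} (hp : 1 < p) (hp2 : p < 2)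
    (hω : 0 < ω) (hg : IsVolumetricEnergy g) (hc : 0 < c) (ha : 0 < a) (hM : 1 ≤ M) (hK₁ : 0 ≤ K₁) :
    ∃ K : ℝ, 0 ≤ K ∧ ∀ H l ρ j v x R R' : ℝ, 0 ≤ H → 0 < ρ → ρ ≤ 1 → ρ ≤ l → c ≤ R → R ≤ M →
      a * ρ ≤ R' → R' ≤ M * ρ → |j - ρ| ≤ K₁ * H * l → ρ / 2 ≤ j → j ≤ 2 * ρ →
      |v - R * R'| ≤ K₁ * H → a * c * ρ / 2 ≤ v → v ≤ 2 * M ^ 2 * ρ → 0 ≤ x →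
      |x - (R ^ 2 + ρ ^ 2 * R' ^ 2)| ≤ K₁ * H →
      |(ω * (√x / j) ^ p + g (v / j)) * j - radialDensity ω p g R' R ρ * ρ| ≤
        K * H * (l * ρ ^ (-p)) := by
  -- Both volume ratios stay in this interval: `v` lies between `a c ρ / 2` and `2 M² ρ`, and `j`
  -- between `ρ / 2` and `2 ρ`.
  obtain ⟨G, L, hG0, hL0, hG, hL⟩ := hg.exists_bounds (x := a * c / 4) (y := 4 * M ^ 2)
    (by positivity)
  set Kc : ℝ := (c ^ 2) ^ (p / 2 - 1) with hKc
  have hKc0 : 0 ≤ Kc := by positivity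
  refine ⟨ω * (2 * K₁ * Kc + (2 * M ^ 2) ^ (p / 2) * (2 * K₁)) + (G * K₁ + L * (4 * M ^ 2 * K₁ + K₁)),
    by positivity, fun H l ρ j v x R R' hH hρ hρ1 hρl hcR hRM haR hRb hj hj1 hj2 hv hv1 hv2 hx hxy
    => ?_⟩
  have hR' : 0 < R' := (by positivity : 0 < a * ρ).trans_le haR
  have hR : 0 < R := hc.trans_le hcR
  have hl : 0 < l := hρ.trans_le hρl
  have hj0 : 0 < j := (by positivity : 0 < ρ / 2).trans_le hj1
  have hρR' : ρ * R' ≤ M := by nlinarith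
  set y := R ^ 2 + ρ ^ 2 * R' ^ 2 with hy
  have hy1 : c ^ 2 ≤ y := by nlinarith [sq_nonneg (ρ * R')]
  have hy2 : y ≤ 2 * M ^ 2 := by nlinarith [mul_pos hρ hR']
  have hy0 : 0 < y := (by positivity : 0 < c ^ 2).trans_le hy1
  have hρp : 0 < ρ ^ (-p) := Real.rpow_pos_of_pos hρ _
  have hρp1 : 1 ≤ ρ ^ (-p) := Real.one_le_rpow_of_pos_of_le_one_of_nonpos hρ hρ1 (by linarith)
  have hρ1p : ρ ^ (1 - p) = ρ * ρ ^ (-p) := by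
    rw [show (1 : ℝ) - p = 1 + -p by ring, Real.rpow_add hρ, Real.rpow_one]
  have hρ1p1 : 1 ≤ ρ ^ (1 - p) := Real.one_le_rpow_of_pos_of_le_one_of_nonpos hρ hρ1 (by linarith)
  have hlp : 1 ≤ l * ρ ^ (-p) := by
    calc 1 ≤ ρ * ρ ^ (-p) := hρ1p ▸ hρ1p1
      _ ≤ l * ρ ^ (-p) := by gcongr
  have hj1p : j ^ (1 - p) ≤ 2 * (l * ρ ^ (-p)) := by
    have := rpow_one_sub_le hp hp2 hρ hj1
    rw [hρ1p] at this
    exact this.trans (by gcongr)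
  have hjρ := abs_rpow_one_sub_sub_le hp hp2 hρ hj1
  have hxα : |x ^ (p / 2) - y ^ (p / 2)| ≤ K₁ * H * Kc := by
    refine (abs_rpow_sub_rpow_le (by linarith) (by linarith) hx hy0).trans ?_
    exact mul_le_mul hxy (Real.rpow_le_rpow_of_nonpos (by positivity) hy1 (by linarith))
      (by positivity) (by positivity)
  have hyα : y ^ (p / 2) ≤ (2 * M ^ 2) ^ (p / 2) := Real.rpow_le_rpow hy0.le hy2 (by linarith)
  have A1 : |x ^ (p / 2) * j ^ (1 - p) - y ^ (p / 2) * ρ ^ (1 - p)| ≤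
      (2 * K₁ * Kc + (2 * M ^ 2) ^ (p / 2) * (2 * K₁)) * H * (l * ρ ^ (-p)) := by
    have e : x ^ (p / 2) * j ^ (1 - p) - y ^ (p / 2) * ρ ^ (1 - p)
        = (x ^ (p / 2) - y ^ (p / 2)) * j ^ (1 - p) + y ^ (p / 2) * (j ^ (1 - p) - ρ ^ (1 - p)) := by
      ring
    have h1 : |j ^ (1 - p)| ≤ 2 * (l * ρ ^ (-p)) := by
      rw [abs_of_pos (Real.rpow_pos_of_pos hj0 _)]; exact hj1p
    have h2 : |y ^ (p / 2)| ≤ (2 * M ^ 2) ^ (p / 2) := by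
      rw [abs_of_pos (Real.rpow_pos_of_pos hy0 _)]; exact hyα
    have h3 : |j ^ (1 - p) - ρ ^ (1 - p)| ≤ 2 * ρ ^ (-p) * (K₁ * H * l) :=
      hjρ.trans (by gcongr)
    rw [e]
    refine (abs_add_le_add' (abs_mul_le_mul' hxα h1) (abs_mul_le_mul' h2 h3)).trans (le_of_eq ?_)
    ring
  -- the volumetric part
  have hD : v / j ∈ Icc (a * c / 4) (4 * M ^ 2) := by
    have hac : 0 < a * c := by positivity
    constructor
    · rw [le_div_iff₀ hj0]
      calc a * c / 4 * j ≤ a * c / 4 * (2 * ρ) := by gcongr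
        _ = a * c * ρ / 2 := by ring
        _ ≤ v := hv1
    · rw [div_le_iff₀ hj0]
      calc v ≤ 2 * M ^ 2 * ρ := hv2
        _ = 4 * M ^ 2 * (ρ / 2) := by ring
        _ ≤ 4 * M ^ 2 * j := by gcongr
  have hd : R' * R / ρ ∈ Icc (a * c / 4) (4 * M ^ 2) := by
    have hac : 0 < a * c * ρ := by positivity
    have hM2 : 0 < M ^ 2 * ρ := by positivity
    have h1 : a * ρ * c ≤ R' * R := mul_le_mul haR hcR hc.le hR'.le
    have h2 : R' * R ≤ M * ρ * M := mul_le_mul hRb hRM hR.le (by positivity)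
    constructor
    · rw [le_div_iff₀ hρ]; linarith
    · rw [div_le_iff₀ hρ]; linarith
  have A2 : |g (v / j) * j - g (R' * R / ρ) * ρ| ≤
      (G * K₁ + L * (4 * M ^ 2 * K₁ + K₁)) * H * (l * ρ ^ (-p)) := by
    have e : g (v / j) * j - g (R' * R / ρ) * ρ
        = g (v / j) * (j - ρ) + (g (v / j) - g (R' * R / ρ)) * ρ := by ring
    have h1 : |(g (v / j) - g (R' * R / ρ)) * ρ| ≤ L * (4 * M ^ 2 * (K₁ * H * l) + K₁ * H) := by
      rw [abs_mul, abs_of_pos hρ]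
      have e2 : |v / j - R' * R / ρ| * ρ ≤ 4 * M ^ 2 * (K₁ * H * l) + K₁ * H := by
        have : |v / j - R' * R / ρ| * ρ = |-(v / j * (j - ρ)) + (v - R * R')| := by
          rw [← abs_of_pos hρ, ← abs_mul, abs_of_pos hρ]; congr 1; field_simp; ring
        rw [this]
        refine abs_add_le_add' ?_ hv
        rw [abs_neg]
        refine abs_mul_le_mul' ?_ hj
        rw [abs_of_nonneg ((by positivity : 0 ≤ a * c / 4).trans hD.1)]
        exact hD.2
      calc _ ≤ L * |v / j - R' * R / ρ| * ρ := by gcongr; exact hL _ hD _ hd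
        _ = L * (|v / j - R' * R / ρ| * ρ) := by ring
        _ ≤ _ := by gcongr
    rw [e]
    refine (abs_add_le_add' (abs_mul_le_mul' (hG _ hD) hj) h1).trans ?_
    have k1 : K₁ * H * l ≤ K₁ * H * (l * ρ ^ (-p)) := by
      gcongr; exact le_mul_of_one_le_right hl.le hρp1
    have k2 : K₁ * H ≤ K₁ * H * (l * ρ ^ (-p)) := le_mul_of_one_le_right (by positivity) hlp
    calc G * (K₁ * H * l) + L * (4 * M ^ 2 * (K₁ * H * l) + K₁ * H)
        ≤ G * (K₁ * H * (l * ρ ^ (-p))) + L * (4 * M ^ 2 * (K₁ * H * (l * ρ ^ (-p)))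
          + K₁ * H * (l * ρ ^ (-p))) := by gcongr
      _ = _ := by ring
  have e : (ω * (√x / j) ^ p + g (v / j)) * j - radialDensity ω p g R' R ρ * ρ
      = ω * (x ^ (p / 2) * j ^ (1 - p) - y ^ (p / 2) * ρ ^ (1 - p))
        + (g (v / j) * j - g (R' * R / ρ) * ρ) := by
    rw [radialDensity_mul hρ, add_mul, mul_assoc, sqrt_div_rpow_mul hx hj0]; ring
  rw [e]
  refine (abs_add_le_add' (abs_mul_le_mul' (abs_of_pos hω).le A1) A2).trans (le_of_eq ?_)
  ring

/-! ### Cavity profiles and their interpolants -/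

/-- The regularity and the bounds of a cavity profile, with `r1` its derivative, in the form in
which they are used. -/
structure ProfileData (c M a : ℝ) (r r1 r2 r3 : ℝ → ℝ) : Prop where
  cont : ContinuousOn r (Ioc 0 1)
  cont1 : ContinuousOn r1 (Ioc 0 1)
  cont2 : ContinuousOn r2 (Ioc 0 1)
  hasDeriv : ∀ x ∈ Ioo (0 : ℝ) 1, HasDerivAt r (r1 x) x
  hasDeriv1 : ∀ x ∈ Ioo (0 : ℝ) 1, HasDerivAt r1 (r2 x) x
  hasDeriv2 : ∀ x ∈ Ioo (0 : ℝ) 1, HasDerivAt r2 (r3 x) x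
  le_M : ∀ x ∈ Ioc (0 : ℝ) 1, r x ≤ M
  abs2_le : ∀ x ∈ Ioc (0 : ℝ) 1, |r2 x| ≤ M
  abs3_le : ∀ x ∈ Ioc (0 : ℝ) 1, |r3 x| ≤ M
  lower : ∀ x ∈ Ioc (0 : ℝ) 1, c ≤ r x
  deriv_lower : ∀ x ∈ Ioc (0 : ℝ) 1, a * x ≤ r1 x
  deriv_upper : ∀ x ∈ Ioc (0 : ℝ) 1, r1 x ≤ M * x

theorem IsCavityProfile.exists_data {c B a b M : ℝ} {r : ℝ → ℝ} (h : IsCavityProfile c B a b r)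
    (hB : B ≤ M) (hb : b ≤ M) : ∃ r1 r2 r3, ProfileData c M a r r1 r2 r3 := by
  have hu : UniqueDiffOn ℝ (Ioc (0 : ℝ) 1) := uniqueDiffOn_Ioc 0 1
  set D : ℕ → ℝ → ℝ := fun j => iteratedDerivWithin j r (Ioc 0 1) with hD
  have hcont : ∀ j, ContinuousOn (D j) (Ioc 0 1) := fun j =>
    h.smooth.continuousOn_iteratedDerivWithin (by exact_mod_cast le_top) hu
  have hder : ∀ j, ∀ x ∈ Ioo (0 : ℝ) 1, HasDerivAt (D j) (D (j + 1) x) x := by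
    intro j x hx
    have hd : DifferentiableOn ℝ (D j) (Ioc 0 1) :=
      h.smooth.differentiableOn_iteratedDerivWithin (by exact_mod_cast WithTop.coe_lt_top _) hu
    have hm : Ioc (0 : ℝ) 1 ∈ 𝓝 x := Ioc_mem_nhds hx.1 hx.2
    have h1 : D (j + 1) x = derivWithin (D j) (Ioc 0 1) x := by
      simp only [hD, iteratedDerivWithin_succ]
    rw [h1]
    exact ((hd x (Ioo_subset_Ioc_self hx)).hasDerivWithinAt).hasDerivAt hm
  have h0 : D 0 = r := iteratedDerivWithin_zero
  have h1 : D 1 = derivWithin r (Ioc 0 1) := by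
    simp only [hD, iteratedDerivWithin_one]
  refine ⟨D 1, D 2, D 3, ?_⟩
  exact
    { cont := h0 ▸ hcont 0
      cont1 := hcont 1
      cont2 := hcont 2
      hasDeriv := h0 ▸ hder 0
      hasDeriv1 := hder 1
      hasDeriv2 := hder 2
      le_M := fun x hx => by
        have := h.bounded 0 (by norm_num) x hx
        rw [iteratedDerivWithin_zero] at this
        exact (le_abs_self _).trans (this.trans hB)
      abs2_le := fun x hx => (h.bounded 2 (by norm_num) x hx).trans hB
      abs3_le := fun x hx => (h.bounded 3 (by norm_num) x hx).trans hB
      lower := h.lower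
      deriv_lower := fun x hx => by rw [h1]; exact h.deriv_lower x hx
      deriv_upper := fun x hx => by
        rw [h1]; exact (h.deriv_upper x hx).trans (mul_le_mul_of_nonneg_right hb hx.1.le) }

/-- By Rolle's theorem `e1` vanishes between the two zeros of `e`; the mean value theorem from that
point bounds `e1`, and from a zero of `e` bounds `e`. -/
theorem abs_le_of_zeros {M : ℝ} {e e1 e2 : ℝ → ℝ} (he : ContinuousOn e (Icc 0 1))
    (h1 : ∀ s ∈ Ioo (0 : ℝ) 1, HasDerivAt e (e1 s) s) (he1 : ContinuousOn e1 (Icc 0 1))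
    (h2 : ∀ s ∈ Ioo (0 : ℝ) 1, HasDerivAt e1 (e2 s) s) (hM : ∀ s ∈ Ioo (0 : ℝ) 1, |e2 s| ≤ M)
    {x y : ℝ} (hx : 0 ≤ x) (hxy : x < y) (hy : y ≤ 1) (hex : e x = 0) (hey : e y = 0) :
    ∀ s ∈ Icc (0 : ℝ) 1, |e1 s| ≤ M ∧ |e s| ≤ M := by
  have hsub : Icc x y ⊆ Icc 0 1 := Icc_subset_Icc hx hy
  obtain ⟨ξ, hξ, hξ0⟩ := exists_hasDerivAt_eq_zero hxy (he.mono hsub) (hex.trans hey.symm)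
    (fun s hs => h1 s ⟨hx.trans_lt hs.1, hs.2.trans_le hy⟩)
  have hξ' : ξ ∈ Icc (0 : ℝ) 1 := hsub (Ioo_subset_Icc_self hξ)
  have lip : ∀ {f f' : ℝ → ℝ} {z : ℝ}, ContinuousOn f (Icc 0 1) →
      (∀ s ∈ Ioo (0 : ℝ) 1, HasDerivAt f (f' s) s) → (∀ s ∈ Ioo (0 : ℝ) 1, |f' s| ≤ M) →
      z ∈ Icc (0 : ℝ) 1 → f z = 0 → ∀ s ∈ Icc (0 : ℝ) 1, |f s| ≤ M := by
    intro f f' z hf hf' hb hz hfz s hs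
    have hM0 : 0 ≤ M := (abs_nonneg _).trans (hb (1 / 2) (by norm_num))
    have aux : ∀ u v, u ∈ Icc (0 : ℝ) 1 → v ∈ Icc (0 : ℝ) 1 → u < v → |f v - f u| ≤ M := by
      intro u v hu hv huv
      obtain ⟨c, hc, hc'⟩ := exists_hasDerivAt_eq_slope f f' huv
        (hf.mono (Icc_subset_Icc hu.1 hv.2))
        (fun s hs => hf' s ⟨hu.1.trans_lt hs.1, hs.2.trans_le hv.2⟩)
      have : f v - f u = f' c * (v - u) := by rw [hc']; field_simp [(sub_pos.2 huv).ne']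
      rw [this]
      calc _ ≤ M * 1 := abs_mul_le_mul' (hb c ⟨hu.1.trans_lt hc.1, hc.2.trans_le hv.2⟩)
            (by rw [abs_of_pos (sub_pos.2 huv)]; linarith [hu.1, hv.2])
        _ = M := mul_one M
    rcases lt_trichotomy s z with h | h | h
    · have := aux s z hs hz h; rwa [hfz, zero_sub, abs_neg] at this
    · rw [h, hfz, abs_zero]; exact hM0
    · have := aux z s hz hs h; rwa [hfz, sub_zero] at this
  have hb1 : ∀ s ∈ Icc (0 : ℝ) 1, |e1 s| ≤ M := lip he1 h2 hM hξ' hξ0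
  exact fun s hs => ⟨hb1 s hs, lip he h1 (fun s hs => hb1 s (Ioo_subset_Icc_self hs))
    ⟨hx, hxy.le.trans hy⟩ hex s hs⟩

namespace ProfileData

variable {c M a : ℝ} {r r1 r2 r3 : ℝ → ℝ}

/-- Two one-dimensional interpolations occur: `X` uses the derivative of the quadratic interpolant
at `s = 0, 1/2, 1`, while `Y_t` uses the linear interpolant at `s = 1/2, 1`, the levels of the
off-axis nodes. Both are accurate to order `τ²`. -/
theorem profileBounds (h : ProfileData c M a r r1 r2 r3) (hM : 1 ≤ M) (hc : 0 < c) (ha : 0 < a)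
    {ρ0 τ' τ fb : ℝ} (hτ : 0 < τ) (hτ' : |τ'| = τ) (hfb : fb ≤ 1)
    (hmem : ∀ s ∈ Icc (0 : ℝ) 1, 0 < ρ0 + τ' * s ∧ ρ0 + τ' * s ≤ fb) {s : ℝ} (hs : s ∈ Icc (0 : ℝ) 1) :
    ProfileBounds M τ fb (r (ρ0 + τ')) ((r (ρ0 + τ') - r (ρ0 + τ' / 2)) / τ')
      (((4 * r (ρ0 + τ' / 2) - 3 * r ρ0 - r (ρ0 + τ'))
        + 2 * (2 * r ρ0 + 2 * r (ρ0 + τ') - 4 * r (ρ0 + τ' / 2)) * s) / τ')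
      (r (ρ0 + τ') + 2 * (1 - s) * (r (ρ0 + τ' / 2) - r (ρ0 + τ')))
      (r (ρ0 + τ' * s)) (r1 (ρ0 + τ' * s)) ∧
    0 ≤ (r (ρ0 + τ') - r (ρ0 + τ' / 2)) / τ' := by
  have hτ0 : τ' ≠ 0 := by intro h0; rw [h0, abs_zero] at hτ'; linarith
  have hI : ∀ s ∈ Icc (0 : ℝ) 1, ρ0 + τ' * s ∈ Ioc (0 : ℝ) 1 := fun s hs =>
    ⟨(hmem s hs).1, (hmem s hs).2.trans hfb⟩
  have hO : ∀ s ∈ Ioo (0 : ℝ) 1, ρ0 + τ' * s ∈ Ioo (0 : ℝ) 1 := by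
    intro s hs
    have h0 := hI 0 ⟨le_rfl, zero_le_one⟩
    have h1 := hI 1 ⟨zero_le_one, le_rfl⟩
    refine ⟨(hI s (Ioo_subset_Icc_self hs)).1, ?_⟩
    rcases lt_or_gt_of_ne hτ0 with h | h
    · nlinarith [hs.1, hs.2, h0.2, h1.2]
    · nlinarith [hs.1, hs.2, h0.2, h1.2]
  have hline : ∀ s, HasDerivAt (fun s : ℝ => ρ0 + τ' * s) τ' s := fun s => by
    simpa using ((hasDerivAt_id s).const_mul τ').const_add ρ0
  have hcl : ∀ {f : ℝ → ℝ}, ContinuousOn f (Ioc 0 1) →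
      ContinuousOn (fun s => f (ρ0 + τ' * s)) (Icc 0 1) := fun {f} hf =>
    hf.comp (by fun_prop) hI
  have hdc : ∀ {f f' : ℝ → ℝ}, (∀ x ∈ Ioo (0 : ℝ) 1, HasDerivAt f (f' x) x) → ∀ s ∈ Ioo (0 : ℝ) 1,
      HasDerivAt (fun s => f (ρ0 + τ' * s)) (τ' * f' (ρ0 + τ' * s)) s := fun {f f'} hf s hs => by
    have := (hf _ (hO s hs)).comp s (hline s)
    rwa [mul_comm] at this
  set g0 := r ρ0 with hg0
  set gh := r (ρ0 + τ' / 2) with hgh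
  set g1 := r (ρ0 + τ') with hg1
  have v0 : r (ρ0 + τ' * 0) = g0 := by rw [hg0]; congr 1; ring
  have vh : r (ρ0 + τ' * (1 / 2)) = gh := by rw [hgh]; congr 1; ring
  have v1 : r (ρ0 + τ' * 1) = g1 := by rw [hg1]; congr 1; ring
  -- the quadratic interpolant
  set A := 4 * gh - 3 * g0 - g1 with hA
  set D := 2 * g0 + 2 * g1 - 4 * gh with hD
  -- The error vanishes at three nodes, so its derivative vanishes at two points and
  -- `abs_le_of_zeros` applies to that derivative. Its second derivative has size `M τ³`; division
  -- by `τ'` will leave `M τ²`.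
  have hq : |τ' * r1 (ρ0 + τ' * s) - (A + 2 * D * s)| ≤ M * τ ^ 3 := by
    set e : ℝ → ℝ := fun s => r (ρ0 + τ' * s) - (g0 + A * s + D * s ^ 2) with he
    set e1 : ℝ → ℝ := fun s => τ' * r1 (ρ0 + τ' * s) - (A + 2 * D * s) with he1
    set e2 : ℝ → ℝ := fun s => τ' * (τ' * r2 (ρ0 + τ' * s)) - 2 * D with he2
    have hce : ContinuousOn e (Icc 0 1) := (hcl h.cont).sub (by fun_prop)
    have hce1 : ContinuousOn e1 (Icc 0 1) := ((hcl h.cont1).const_smul τ').sub (by fun_prop)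
    have hce2 : ContinuousOn e2 (Icc 0 1) :=
      (((hcl h.cont2).const_smul τ').const_smul τ').sub continuousOn_const
    have d0 : ∀ s ∈ Ioo (0 : ℝ) 1, HasDerivAt e (e1 s) s := fun s hs => by
      refine (hdc h.hasDeriv s hs).sub ?_
      have := ((((hasDerivAt_id s).const_mul A).const_add g0).add
        ((hasDerivAt_pow 2 s).const_mul D))
      exact this.congr_deriv (by push_cast; ring)
    have d1 : ∀ s ∈ Ioo (0 : ℝ) 1, HasDerivAt e1 (e2 s) s := fun s hs => by
      refine ((hdc h.hasDeriv1 s hs).const_mul τ').sub ?_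
      simpa using ((hasDerivAt_id s).const_mul (2 * D)).const_add A
    have d2 : ∀ s ∈ Ioo (0 : ℝ) 1,
        HasDerivAt e2 (τ' * (τ' * (τ' * r3 (ρ0 + τ' * s)))) s := fun s hs => by
      have := (((hdc h.hasDeriv2 s hs).const_mul τ').const_mul τ').sub_const (2 * D)
      exact this
    have z0 : e 0 = 0 := by simp only [he, v0]; ring
    have zh : e (1 / 2) = 0 := by simp only [he, vh, hA, hD]; ring
    have z1 : e 1 = 0 := by simp only [he, v1, hA, hD]; ring
    obtain ⟨ξ, hξ, hξ0⟩ := exists_hasDerivAt_eq_zero (by norm_num : (0 : ℝ) < 1 / 2)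
      (hce.mono (Icc_subset_Icc le_rfl (by norm_num))) (z0.trans zh.symm)
      (fun s hs => d0 s ⟨hs.1, hs.2.trans (by norm_num)⟩)
    obtain ⟨ζ, hζ, hζ0⟩ := exists_hasDerivAt_eq_zero (by norm_num : (1 / 2 : ℝ) < 1)
      (hce.mono (Icc_subset_Icc (by norm_num) le_rfl)) (zh.trans z1.symm)
      (fun s hs => d0 s ⟨lt_trans (by norm_num) hs.1, hs.2⟩)
    refine (abs_le_of_zeros hce1 d1 hce2 d2 (fun s hs => ?_) hξ.1.le (hξ.2.trans hζ.1) hζ.2.le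
      hξ0 hζ0 s hs).2
    have h3 := h.abs3_le _ (hI s (Ioo_subset_Icc_self hs))
    calc _ ≤ τ * (τ * (τ * M)) :=
          abs_mul_le_mul' hτ'.le (abs_mul_le_mul' hτ'.le (abs_mul_le_mul' hτ'.le h3))
      _ = M * τ ^ 3 := by ring
  -- the linear interpolant
  have hl : |r (ρ0 + τ' * s) - (g1 + 2 * (1 - s) * (gh - g1))| ≤ M * τ ^ 2 := by
    set e : ℝ → ℝ := fun s => r (ρ0 + τ' * s) - (g1 + 2 * (1 - s) * (gh - g1)) with he
    set e1 : ℝ → ℝ := fun s => τ' * r1 (ρ0 + τ' * s) - 2 * (g1 - gh) with he1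
    have hce : ContinuousOn e (Icc 0 1) := (hcl h.cont).sub (by fun_prop)
    have hce1 : ContinuousOn e1 (Icc 0 1) :=
      ((hcl h.cont1).const_smul τ').sub continuousOn_const
    have d0 : ∀ s ∈ Ioo (0 : ℝ) 1, HasDerivAt e (e1 s) s := fun s hs => by
      refine (hdc h.hasDeriv s hs).sub ?_
      have := ((((hasDerivAt_id s).const_sub 1).const_mul 2).mul_const (gh - g1)).const_add g1
      exact this.congr_deriv (by ring)
    have d1 : ∀ s ∈ Ioo (0 : ℝ) 1, HasDerivAt e1 (τ' * (τ' * r2 (ρ0 + τ' * s))) s := fun s hs =>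
      ((hdc h.hasDeriv1 s hs).const_mul τ').sub_const _
    have zh : e (1 / 2) = 0 := by simp only [he, vh]; ring
    have z1 : e 1 = 0 := by simp only [he, v1]; ring
    refine (abs_le_of_zeros hce d0 hce1 d1 (fun s hs => ?_) (by norm_num) (by norm_num) le_rfl
      zh z1 s hs).2
    have h3 := h.abs2_le _ (hI s (Ioo_subset_Icc_self hs))
    calc _ ≤ τ * (τ * M) := abs_mul_le_mul' hτ'.le (abs_mul_le_mul' hτ'.le h3)
      _ = M * τ ^ 2 := by ring
  -- By the mean value theorem the slope is half of `r'` at an intermediate radius; the half comes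
  -- from the node distance `τ' / 2`.
  have hd : 0 ≤ (g1 - gh) / τ' ∧ (g1 - gh) / τ' ≤ M * fb := by
    obtain ⟨ξ, hξ, hξ0⟩ := exists_hasDerivAt_eq_slope (fun s => r (ρ0 + τ' * s))
      (fun s => τ' * r1 (ρ0 + τ' * s)) (by norm_num : (1 / 2 : ℝ) < 1)
      ((hcl h.cont).mono (Icc_subset_Icc (by norm_num) le_rfl))
      (fun s hs => hdc h.hasDeriv s ⟨lt_trans (by norm_num) hs.1, hs.2⟩)
    have hξI : ξ ∈ Icc (0 : ℝ) 1 := ⟨le_trans (by norm_num) hξ.1.le, hξ.2.le⟩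
    have e : (g1 - gh) / τ' = r1 (ρ0 + τ' * ξ) / 2 := by
      simp only [vh, v1] at hξ0
      field_simp at hξ0 ⊢
      linarith
    have l1 := h.deriv_lower _ (hI ξ hξI)
    have l2 := h.deriv_upper _ (hI ξ hξI)
    have l3 := hmem ξ hξI
    rw [e]
    have : 0 < a * (ρ0 + τ' * ξ) := mul_pos ha l3.1
    constructor
    · linarith
    · have : M * (ρ0 + τ' * ξ) ≤ M * fb := by gcongr; exact l3.2
      linarith
  have hfb0 : 0 < fb := (hmem s hs).1.trans_le (hmem s hs).2
  have abs_r : ∀ x ∈ Ioc (0 : ℝ) 1, |r x| ≤ M := fun x hx => by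
    rw [abs_of_pos (hc.trans_le (h.lower x hx))]; exact h.le_M x hx
  refine ⟨⟨hM, hfb0, hfb, ?_, ?_, abs_r _ (hI s hs), ?_, ?_, ?_⟩, hd.1⟩
  · rw [← v1]; exact abs_r _ (hI 1 ⟨zero_le_one, le_rfl⟩)
  · rw [abs_of_nonneg hd.1]; exact hd.2
  · have l1 := h.deriv_lower _ (hI s hs)
    have : 0 < a * (ρ0 + τ' * s) := mul_pos ha (hI s hs).1
    rw [abs_of_nonneg (this.le.trans l1)]
    exact (h.deriv_upper _ (hI s hs)).trans
      (mul_le_mul_of_nonneg_left (hmem s hs).2 (by linarith))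
  · have e : (A + 2 * D * s) / τ' - r1 (ρ0 + τ' * s)
        = -((τ' * r1 (ρ0 + τ' * s) - (A + 2 * D * s)) / τ') := by field_simp; ring
    rw [e, abs_neg, abs_div, hτ', div_le_iff₀ hτ]
    calc _ ≤ M * τ ^ 3 := hq
      _ = M * τ ^ 2 * τ := by ring
  · rw [abs_sub_comm]; exact hl

end ProfileData

/-! ### Pieces of a layer -/

/-- Half angles appear because edge nodes sit at half the angular step; with them every nodal sine
and cosine is a polynomial in `vers η` and `halfSin η`. -/
def vers (η : ℝ) : ℝ := 1 - Real.cos (η / 2)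
def halfSin (η : ℝ) : ℝ := Real.sin (η / 2)

theorem halfSin_sq (η : ℝ) : halfSin η ^ 2 = 2 * vers η - vers η ^ 2 := by
  unfold halfSin vers; nlinarith [Real.sin_sq_add_cos_sq (η / 2)]

theorem cos_eq_vers (η : ℝ) : Real.cos η = 1 - 4 * vers η + 2 * vers η ^ 2 := by
  have : Real.cos η = Real.cos (2 * (η / 2)) := by congr 1; ring
  rw [this, Real.cos_two_mul]; unfold vers; ring

theorem sin_eq_vers (η : ℝ) : Real.sin η = 2 * halfSin η * (1 - vers η) := by
  have : Real.sin η = Real.sin (2 * (η / 2)) := by congr 1; ring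
  rw [this, Real.sin_two_mul]; unfold vers halfSin; ring

/-- A layer of inner radius `ε` and thickness `τ` with angular half-width `η` is thin and finely
divided, with tolerance `μ`. -/
structure SmallLayer (μ ε τ η : ℝ) : Prop where
  ε_pos : 0 < ε
  τ_pos : 0 < τ
  le_one : ε + τ ≤ 1
  η_pos : 0 < η
  η_le : η ≤ 1
  vers_le : vers η ≤ μ
  vers_sq_le : vers η ^ 2 ≤ μ * ε * τ
  vers_mul_le : vers η * τ ≤ μ * ε
  τ_sq_le : τ ^ 2 ≤ μ * ε

namespace SmallLayer

variable {μ ε τ η : ℝ}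

theorem η_lt (h : SmallLayer μ ε τ η) : η < Real.pi / 2 := by
  have := Real.pi_gt_three; linarith [h.η_le]

theorem halfSin_pos (h : SmallLayer μ ε τ η) : 0 < halfSin η :=
  Real.sin_pos_of_pos_of_lt_pi (by linarith [h.η_pos]) (by linarith [h.η_lt, h.η_pos, Real.pi_pos])

theorem vers_pos (h : SmallLayer μ ε τ η) : 0 < vers η := by
  have h1 : Real.cos (η / 2) < Real.cos 0 :=
    Real.cos_lt_cos_of_nonneg_of_le_pi le_rfl (by linarith [h.η_lt, h.η_pos, Real.pi_pos])
      (by linarith [h.η_pos])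
  rw [Real.cos_zero] at h1
  unfold vers; linarith

end SmallLayer

/-- The two ways in which the interpolants in the frame of an element occur: elements of type A
start at the inner radius, the others at the outer radius. -/
def IsPiece (ε τ : ℝ) (κ : Bool) (ρ0 τ' : ℝ) : Prop :=
  (ρ0 = ε ∧ τ' = τ ∧ κ = false) ∨ (ρ0 = ε + τ ∧ τ' = -τ)

def pieceX (κ : Bool) (η : ℝ) (f : ℝ → ℝ) (ρ0 τ' s t : ℝ) : ℝ :=
  quadX κ (vers η) (f ρ0) (f (ρ0 + τ' / 2)) (f (ρ0 + τ')) s t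

def pieceY (κ : Bool) (η : ℝ) (f : ℝ → ℝ) (ρ0 τ' s t : ℝ) : ℝ :=
  quadY κ (vers η) (halfSin η) (f (ρ0 + τ' / 2)) (f (ρ0 + τ')) s t

def pieceXs (κ : Bool) (η : ℝ) (f : ℝ → ℝ) (ρ0 τ' s t : ℝ) : ℝ :=
  quadXs κ (vers η) (f ρ0) (f (ρ0 + τ' / 2)) (f (ρ0 + τ')) s t

def pieceXt (κ : Bool) (η : ℝ) (f : ℝ → ℝ) (ρ0 τ' s t : ℝ) : ℝ :=
  quadXt κ (vers η) (f (ρ0 + τ' / 2)) (f (ρ0 + τ')) s t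

def pieceYs (κ : Bool) (η : ℝ) (f : ℝ → ℝ) (ρ0 τ' t : ℝ) : ℝ :=
  quadYs κ (vers η) (halfSin η) (f (ρ0 + τ' / 2)) (f (ρ0 + τ')) t

def pieceYt (κ : Bool) (η : ℝ) (f : ℝ → ℝ) (ρ0 τ' s t : ℝ) : ℝ :=
  quadYt κ (vers η) (halfSin η) (f (ρ0 + τ' / 2)) (f (ρ0 + τ')) s t

/-- The parameter triangle of a piece. -/
def InTri (s t : ℝ) : Prop := 0 ≤ t ∧ t ≤ s ∧ s ≤ 1

theorem InTri.mid {s t s' t' : ℝ} (h : InTri s t) (h' : InTri s' t') :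
    InTri ((s + s') / 2) ((t + t') / 2) :=
  ⟨by linarith [h.1, h'.1], by linarith [h.2.1, h'.2.1], by linarith [h.2.2, h'.2.2]⟩

theorem quadXs_eq {κ : Bool} {k g0 gh g1 s t τ' : ℝ} (hτ' : τ' ≠ 0) :
    quadXs κ k g0 gh g1 s t =
      τ' * nXs (((4 * gh - 3 * g0 - g1) + 2 * (2 * g0 + 2 * g1 - 4 * gh) * s) / τ') k
        ((g1 - gh) / τ') (shapeMs κ s t) g1 τ' (shapeNs κ s) := by
  simp only [quadXs, nXs]; field_simp

theorem quadXt_eq {κ : Bool} {k gh g1 s t τ' : ℝ} (hτ' : τ' ≠ 0) :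
    quadXt κ k gh g1 s t =
      nXt k τ' ((g1 - gh) / τ') (shapeMt κ s) g1 (shapeNt κ t) t := by
  simp only [quadXt, nXt]; field_simp

theorem quadYs_eq {κ : Bool} {k σ gh g1 t τ' : ℝ} (hτ' : τ' ≠ 0) :
    quadYs κ k σ gh g1 t =
      2 * σ * τ' * nYs t ((g1 - gh) / τ') k g1 τ' (shapeZs κ) := by
  simp only [quadYs, nYs]; field_simp

theorem quadYt_eq {κ : Bool} {k σ gh g1 s t : ℝ} :
    quadYt κ k σ gh g1 s t =
      2 * σ * nYt (g1 + 2 * (1 - s) * (gh - g1)) k g1 (shapeZt κ s t) := by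
  simp only [quadYt, nYt]

theorem InTri.shapeBounds {k τ τ' s t : ℝ} (κ : Bool) (h : InTri s t) (hk : 0 < k) (hk1 : k ≤ 1)
    (hτ : 0 < τ) (hτ1 : τ ≤ 1) (hτ' : |τ'| = τ) :
    ShapeBounds k τ τ' t (shapeMs κ s t) (shapeMt κ s) (shapeNs κ s) (shapeNt κ t)
      (shapeZt κ s t) (shapeZs κ) := by
  obtain ⟨h1, h2, h3⟩ := h
  refine ⟨hk, hk1, hτ, hτ1, hτ', h1, h2.trans h3, ?_, ?_, ?_, ?_, ?_, ?_⟩ <;> cases κ <;>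
    simp only [shapeMs, shapeMt, shapeNs, shapeNt, shapeZt, shapeZs, Bool.false_eq_true, if_true,
      if_false] <;> rw [abs_le] <;> constructor <;> linarith

namespace IsPiece

variable {μ ε τ η : ℝ} {κ : Bool} {ρ0 τ' s t : ℝ}

theorem abs_eq (h : IsPiece ε τ κ ρ0 τ') (hτ : 0 < τ) : |τ'| = τ := by
  rcases h with ⟨-, h, -⟩ | ⟨-, h⟩ <;> simp [h, abs_of_pos hτ]

theorem ne_zero (h : IsPiece ε τ κ ρ0 τ') (hτ : 0 < τ) : τ' ≠ 0 := by
  rcases h with ⟨-, h, -⟩ | ⟨-, h⟩ <;> rw [h]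
  · exact hτ.ne'
  · exact neg_ne_zero.2 hτ.ne'

theorem radius_mem (h : IsPiece ε τ κ ρ0 τ') (hτ : 0 < τ) (hs : s ∈ Icc (0 : ℝ) 1) :
    ε ≤ ρ0 + τ' * s ∧ ρ0 + τ' * s ≤ ε + τ := by
  obtain ⟨h0, h1⟩ := hs
  rcases h with ⟨h, h', -⟩ | ⟨h, h'⟩ <;> rw [h, h'] <;> constructor <;> nlinarith

theorem radius_one_mem (h : IsPiece ε τ κ ρ0 τ') (hτ : 0 < τ) :
    ε ≤ ρ0 + τ' ∧ ρ0 + τ' ≤ ε + τ := by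
  simpa using h.radius_mem hτ (s := 1) ⟨zero_le_one, le_rfl⟩

/-- For `κ = true` the piece starts at the outer radius, so `τ (1 - s) ≤ ε + τ (1 - s) = ρ`. This
supplies the bound `T = ρ` that makes the error of the Jacobian proportional to radii. -/
theorem shapeMt_le (h : IsPiece ε τ κ ρ0 τ') (hε : 0 < ε) (hτ : 0 < τ) (hs : s ∈ Icc (0 : ℝ) 1) :
    τ * |shapeMt κ s| ≤ ρ0 + τ' * s := by
  have h1 := h.radius_mem hτ hs
  cases κ with
  | false => simp only [shapeMt, Bool.false_eq_true, if_false, abs_zero, mul_zero]; linarith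
  | true =>
    rcases h with ⟨-, -, h⟩ | ⟨h, h'⟩
    · simp at h
    · simp only [shapeMt, if_true, h, h']
      rw [abs_of_nonneg (by linarith [hs.2])]; nlinarith

/-- The normalised Jacobian of the element map. -/
def jac (κ : Bool) (η ρ0 τ' s t : ℝ) : ℝ :=
  nXs 1 (vers η) (1 / 2) (shapeMs κ s t) (ρ0 + τ') τ' (shapeNs κ s) *
      nYt (ρ0 + τ' * s) (vers η) (ρ0 + τ') (shapeZt κ s t)
    - nXt (vers η) τ' (1 / 2) (shapeMt κ s) (ρ0 + τ') (shapeNt κ t) t *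
      nYs t (1 / 2) (vers η) (ρ0 + τ') τ' (shapeZs κ)

theorem pieceXs_id (hτ' : τ' ≠ 0) : pieceXs κ η id ρ0 τ' s t =
    τ' * nXs 1 (vers η) (1 / 2) (shapeMs κ s t) (ρ0 + τ') τ' (shapeNs κ s) := by
  rw [pieceXs, quadXs_eq hτ']
  congr 2 <;> simp only [id] <;> field_simp <;> ring

theorem pieceXt_id (hτ' : τ' ≠ 0) : pieceXt κ η id ρ0 τ' s t =
    nXt (vers η) τ' (1 / 2) (shapeMt κ s) (ρ0 + τ') (shapeNt κ t) t := by
  rw [pieceXt, quadXt_eq hτ']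
  congr 1; simp only [id]; field_simp; ring

theorem pieceYs_id (hτ' : τ' ≠ 0) : pieceYs κ η id ρ0 τ' t =
    2 * halfSin η * τ' * nYs t (1 / 2) (vers η) (ρ0 + τ') τ' (shapeZs κ) := by
  rw [pieceYs, quadYs_eq hτ']
  congr 2; simp only [id]; field_simp; ring

theorem pieceYt_id : pieceYt κ η id ρ0 τ' s t =
    2 * halfSin η * nYt (ρ0 + τ' * s) (vers η) (ρ0 + τ') (shapeZt κ s t) := by
  rw [pieceYt, quadYt_eq]
  congr 2; simp only [id]; ring

theorem det_id (hτ' : τ' ≠ 0) :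
    pieceXs κ η id ρ0 τ' s t * pieceYt κ η id ρ0 τ' s t
      - pieceXt κ η id ρ0 τ' s t * pieceYs κ η id ρ0 τ' t = 2 * halfSin η * τ' * jac κ η ρ0 τ' s t := by
  rw [pieceXs_id hτ', pieceXt_id hτ', pieceYs_id hτ', pieceYt_id, jac]; ring

theorem abs_jac_sub (h : IsPiece ε τ κ ρ0 τ') (hl : SmallLayer μ ε τ η) (hμ : μ ≤ 1 / 400)
    (hst : InTri s t) : |jac κ η ρ0 τ' s t - (ρ0 + τ' * s)| ≤
      50 * (vers η + vers η ^ 2 / τ) * ((ρ0 + τ' * s) + (ρ0 + τ')) := by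
  have hs : s ∈ Icc (0 : ℝ) 1 := ⟨hst.1.trans hst.2.1, hst.2.2⟩
  have h1 := h.radius_mem hl.τ_pos hs
  have h2 := h.radius_one_mem hl.τ_pos
  have hε := hl.ε_pos
  exact (hst.shapeBounds κ hl.vers_pos (hl.vers_le.trans (by linarith)) hl.τ_pos
    (by linarith [hl.le_one]) (h.abs_eq hl.τ_pos)).abs_jac_sub (by linarith) (by linarith)
    (by linarith [hl.le_one]) (h.shapeMt_le hε hl.τ_pos hs)

theorem vers_sq_div_le (hl : SmallLayer μ ε τ η) : vers η ^ 2 / τ ≤ μ * ε := by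
  rw [div_le_iff₀ hl.τ_pos]; exact hl.vers_sq_le

/-- The error bound contains `f1`, which is at most `ρ + τ`. The condition `vers η * τ ≤ μ * ε`
handles the surplus `τ`, and `k² / τ ≤ μ ε` the other term. -/
theorem jac_mem (h : IsPiece ε τ κ ρ0 τ') (hl : SmallLayer μ ε τ η) (hμ : μ ≤ 1 / 1000)
    (hst : InTri s t) : (ρ0 + τ' * s) / 2 ≤ jac κ η ρ0 τ' s t ∧
      jac κ η ρ0 τ' s t ≤ 2 * (ρ0 + τ' * s) := by
  have hs : s ∈ Icc (0 : ℝ) 1 := ⟨hst.1.trans hst.2.1, hst.2.2⟩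
  have h1 := h.radius_mem hl.τ_pos hs
  have h2 := h.radius_one_mem hl.τ_pos
  have hε := hl.ε_pos
  have hk := hl.vers_pos
  have hle := hl.le_one
  have key := abs_le.1 (h.abs_jac_sub hl (by linarith) hst)
  have hw := vers_sq_div_le hl
  have hw0 : 0 ≤ vers η ^ 2 / τ := div_nonneg (sq_nonneg _) hl.τ_pos.le
  set ρ := ρ0 + τ' * s
  set f1 := ρ0 + τ'
  have b1 : vers η * (ρ + f1) ≤ 3 * μ * ρ := by
    have : vers η * (ρ + f1) ≤ vers η * (2 * ρ + τ) :=
      mul_le_mul_of_nonneg_left (by linarith) hk.le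
    have : vers η * ρ ≤ μ * ρ := mul_le_mul_of_nonneg_right hl.vers_le (by linarith)
    have : μ * ε ≤ μ * ρ := by
      gcongr
      · exact hk.le.trans hl.vers_le
      · exact h1.1
    nlinarith [hl.vers_mul_le]
  have b2 : vers η ^ 2 / τ * (ρ + f1) ≤ 2 * μ * ρ := by
    have hμ0 : 0 < μ := hk.trans_le hl.vers_le
    calc _ ≤ μ * ε * 2 := mul_le_mul hw (by linarith) (by linarith) (by positivity)
      _ ≤ μ * ρ * 2 := by gcongr; exact h1.1
      _ = _ := by ring
  have b3 : 50 * (vers η + vers η ^ 2 / τ) * (ρ + f1) ≤ ρ / 4 := by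
    have : μ * ρ ≤ 1 / 1000 * ρ := by gcongr; linarith
    nlinarith
  constructor <;> linarith [key.1, key.2]

/-- Together with `Y_t > 0`, `X > 0` and `Y ≥ 0` this forces the polar angle to increase with `t`.
-/
theorem pieceXt_nonpos (h : IsPiece ε τ κ ρ0 τ') (hl : SmallLayer μ ε τ η) (hμ : μ ≤ 1 / 1000)
    (hst : InTri s t) : pieceXt κ η id ρ0 τ' s t ≤ 0 := by
  have hk := hl.vers_pos
  have hk1 : vers η ≤ 1 := hl.vers_le.trans (by linarith)
  have hf := h.radius_one_mem hl.τ_pos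
  have hf0 : 0 < ρ0 + τ' := hl.ε_pos.trans_le hf.1
  rw [pieceXt_id (h.ne_zero hl.τ_pos)]
  have hkt : 0 ≤ vers η * (ρ0 + τ') * t := by have := hst.1; positivity
  cases κ with
  | false =>
    simp only [nXt, shapeMt, shapeNt, Bool.false_eq_true, if_false]
    nlinarith
  | true =>
    rcases h with ⟨-, -, h⟩ | ⟨h, h'⟩
    · simp at h
    simp only [nXt, shapeMt, shapeNt, if_true]
    have h1 : 0 ≤ vers η * τ * (1 - s) := by
      have := hl.τ_pos; have := hst.2.2; exact mul_nonneg (by positivity) (by linarith)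
    have h2 : 0 ≤ vers η ^ 2 * (ρ0 + τ') := by positivity
    rw [h'] at hkt h2 ⊢
    nlinarith

theorem pieceYt_pos (h : IsPiece ε τ κ ρ0 τ') (hl : SmallLayer μ ε τ η) (hμ : μ ≤ 1 / 1000)
    (hst : InTri s t) : 0 < pieceYt κ η id ρ0 τ' s t := by
  have hs : s ∈ Icc (0 : ℝ) 1 := ⟨hst.1.trans hst.2.1, hst.2.2⟩
  have hk := hl.vers_pos
  have h1 := h.radius_mem hl.τ_pos hs
  have hf := h.radius_one_mem hl.τ_pos
  have hε := hl.ε_pos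
  have hb := hst.shapeBounds κ hk (hl.vers_le.trans (by linarith)) hl.τ_pos
    (by linarith [hl.le_one]) (h.abs_eq hl.τ_pos)
  have := abs_le.1 (hb.abs_nYt_sub (ℓ := ρ0 + τ' * s) (abs_of_pos (by linarith : 0 < ρ0 + τ')).le)
  rw [pieceYt_id]
  refine mul_pos (by linarith [hl.halfSin_pos]) ?_
  have hkτ := hl.vers_mul_le
  have hkε : vers η * ε ≤ μ * ε := by gcongr; exact hl.vers_le
  have : vers η * (ρ0 + τ') ≤ vers η * (ε + τ) := mul_le_mul_of_nonneg_left hf.2 hk.le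
  nlinarith [this]

theorem pieceX_pos (h : IsPiece ε τ κ ρ0 τ') (hl : SmallLayer μ ε τ η) (hμ : μ ≤ 1 / 1000)
    (hst : InTri s t) : 0 < pieceX κ η id ρ0 τ' s t := by
  have hs : s ∈ Icc (0 : ℝ) 1 := ⟨hst.1.trans hst.2.1, hst.2.2⟩
  have hk := hl.vers_pos
  have h1 := h.radius_mem hl.τ_pos hs
  have hf := h.radius_one_mem hl.τ_pos
  have hε := hl.ε_pos
  have hτ := hl.τ_pos
  have hk1 : vers η ≤ 1 := hl.vers_le.trans (by linarith)
  obtain ⟨t0, ts, s1⟩ := hst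
  have hM : |shapeM κ s t| ≤ 1 := by
    cases κ <;> simp only [shapeM, Bool.false_eq_true, if_true, if_false] <;> rw [abs_le] <;>
      constructor <;> nlinarith
  have hN : |shapeN κ s t| ≤ 1 := by
    cases κ <;> simp only [shapeN, Bool.false_eq_true, if_true, if_false] <;> rw [abs_le] <;>
      constructor <;> nlinarith
  have e : pieceX κ η id ρ0 τ' s t = (ρ0 + τ' * s) + 2 * vers η * τ' * shapeM κ s t
      - 2 * vers η ^ 2 * (ρ0 + τ') * shapeN κ s t - 4 * vers η * (ρ0 + τ') * t ^ 2 := by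
    simp only [pieceX, quadX, id]; ring
  rw [e]
  have a1 : |2 * vers η * τ' * shapeM κ s t| ≤ 2 * vers η * τ * 1 := by
    refine abs_mul_le_mul' (abs_mul_le_mul' ?_ (h.abs_eq hτ).le) hM
    rw [abs_of_pos (by positivity)]
  have a2 : |2 * vers η ^ 2 * (ρ0 + τ') * shapeN κ s t| ≤ 2 * vers η * (ε + τ) * 1 := by
    refine abs_mul_le_mul' (abs_mul_le_mul' ?_ ?_) hN
    · rw [abs_of_pos (by positivity)]; nlinarith
    · rw [abs_of_pos (by linarith)]; exact hf.2
  have a3 : 4 * vers η * (ρ0 + τ') * t ^ 2 ≤ 4 * vers η * (ε + τ) := by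
    have : t ^ 2 ≤ 1 := by nlinarith
    calc _ ≤ 4 * vers η * (ε + τ) * 1 := by
          refine mul_le_mul (mul_le_mul_of_nonneg_left hf.2 (by positivity)) this (sq_nonneg _) (by positivity)
      _ = _ := mul_one _
  have hkτ := hl.vers_mul_le
  have hkε : vers η * ε ≤ μ * ε := by gcongr; exact hl.vers_le
  nlinarith [(abs_le.1 a1).1, (abs_le.1 a2).2]

theorem pieceY_nonneg (h : IsPiece ε τ κ ρ0 τ') (hl : SmallLayer μ ε τ η) (hμ : μ ≤ 1 / 1000)
    (hst : InTri s t) : 0 ≤ pieceY κ η id ρ0 τ' s t := by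
  have h0 : InTri s 0 := ⟨le_rfl, hst.1.trans hst.2.1, hst.2.2⟩
  have h1 := quadY_sub κ (vers η) (halfSin η) (id (ρ0 + τ' / 2)) (id (ρ0 + τ')) s 0 s t
  have h2 : quadY κ (vers η) (halfSin η) (id (ρ0 + τ' / 2)) (id (ρ0 + τ')) s 0 = 0 := by
    simp [quadY]
  have h3 := h.pieceYt_pos hl hμ (h0.mid hst)
  rw [h2, sub_self, mul_zero, zero_add, sub_zero, sub_zero] at h1
  rw [pieceY, h1]
  exact mul_nonneg h3.le hst.1

/-- A chord form of `X Y_t - Y X_t > 0`: the point is replaced by the sum of two points and the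
derivative is taken at a third, as the midpoint formula requires. -/
theorem cross_pos (h : IsPiece ε τ κ ρ0 τ') (hl : SmallLayer μ ε τ η) (hμ : μ ≤ 1 / 1000)
    {s' t' s'' t'' : ℝ} (hst : InTri s t) (hst' : InTri s' t') (hm : InTri s'' t'') :
    0 < (pieceX κ η id ρ0 τ' s t + pieceX κ η id ρ0 τ' s' t') * pieceYt κ η id ρ0 τ' s'' t''
      - (pieceY κ η id ρ0 τ' s t + pieceY κ η id ρ0 τ' s' t') * pieceXt κ η id ρ0 τ' s'' t'' := by
  have a1 := h.pieceX_pos hl hμ hst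
  have a2 := h.pieceX_pos hl hμ hst'
  have a3 := h.pieceY_nonneg hl hμ hst
  have a4 := h.pieceY_nonneg hl hμ hst'
  have a5 := h.pieceYt_pos hl hμ hm
  have a6 := h.pieceXt_nonpos hl hμ hm
  have := mul_pos (add_pos a1 a2) a5
  have := mul_nonneg (add_nonneg a3 a4) (neg_nonneg.2 a6)
  linarith

/-! ### Polar coordinates on a piece -/

def rad (κ : Bool) (η ρ0 τ' s t : ℝ) : ℝ :=
  √(pieceX κ η id ρ0 τ' s t ^ 2 + pieceY κ η id ρ0 τ' s t ^ 2)

def ang (κ : Bool) (η ρ0 τ' s t : ℝ) : ℝ :=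
  Real.arctan (pieceY κ η id ρ0 τ' s t / pieceX κ η id ρ0 τ' s t)

/-- For points `P`, `P'` on one ray the displacement is parallel to `P + P'`. Eliminating `dt` gives
`(|P'|² - |P|²) ((P + P') × ∂_t) = |P + P'|² det ds`, so the sign of the radial increment is that of
`det ds`. -/
theorem radial_lt {X Y X' Y' Xs Xt Ys Yt ds dt : ℝ} (hX : X' - X = Xs * ds + Xt * dt)
    (hY : Y' - Y = Ys * ds + Yt * dt) (hcross : X * Y' - X' * Y = 0) (hX0 : 0 < X)
    (hX'0 : 0 < X') (hcr : 0 < (X + X') * Yt - (Y + Y') * Xt)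
    (hdet : 0 < (Xs * Yt - Xt * Ys) * ds) : X ^ 2 + Y ^ 2 < X' ^ 2 + Y' ^ 2 := by
  have h1 : (X + X') * (Ys * ds + Yt * dt) - (Y + Y') * (Xs * ds + Xt * dt) = 0 := by
    rw [← hX, ← hY]; linear_combination 2 * hcross
  have h2 : (X' ^ 2 + Y' ^ 2 - (X ^ 2 + Y ^ 2)) * ((X + X') * Yt - (Y + Y') * Xt)
      = ((X + X') ^ 2 + (Y + Y') ^ 2) * ((Xs * Yt - Xt * Ys) * ds) := by
    have e : X' ^ 2 + Y' ^ 2 - (X ^ 2 + Y ^ 2)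
        = (X + X') * (Xs * ds + Xt * dt) + (Y + Y') * (Ys * ds + Yt * dt) := by
      rw [← hX, ← hY]; ring
    rw [e]
    linear_combination ((X + X') * Xt + (Y + Y') * Yt) * h1
  have h3 : 0 < ((X + X') ^ 2 + (Y + Y') ^ 2) * ((Xs * Yt - Xt * Ys) * ds) := by positivity
  rw [← h2] at h3
  have := pos_of_mul_pos_left h3 hcr.le
  linarith

theorem rad_pos (h : IsPiece ε τ κ ρ0 τ') (hl : SmallLayer μ ε τ η) (hμ : μ ≤ 1 / 1000)
    (hst : InTri s t) : 0 < rad κ η ρ0 τ' s t := by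
  have := h.pieceX_pos hl hμ hst
  exact Real.sqrt_pos.2 (by positivity)

theorem ang_mem (h : IsPiece ε τ κ ρ0 τ') (hl : SmallLayer μ ε τ η) (hμ : μ ≤ 1 / 1000)
    (hst : InTri s t) : 0 ≤ ang κ η ρ0 τ' s t ∧ ang κ η ρ0 τ' s t < Real.pi / 2 :=
  ⟨Real.arctan_nonneg.2 (div_nonneg (h.pieceY_nonneg hl hμ hst) (h.pieceX_pos hl hμ hst).le),
    Real.arctan_lt_pi_div_two _⟩

theorem ang_zero : ang κ η ρ0 τ' s 0 = 0 := by simp [ang, pieceY, quadY]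

theorem rad_mul_cos (h : IsPiece ε τ κ ρ0 τ') (hl : SmallLayer μ ε τ η) (hμ : μ ≤ 1 / 1000)
    (hst : InTri s t) :
    rad κ η ρ0 τ' s t * Real.cos (ang κ η ρ0 τ' s t) = pieceX κ η id ρ0 τ' s t ∧
    rad κ η ρ0 τ' s t * Real.sin (ang κ η ρ0 τ' s t) = pieceY κ η id ρ0 τ' s t := by
  have hX := h.pieceX_pos hl hμ hst
  unfold rad ang
  set X := pieceX κ η id ρ0 τ' s t
  set Y := pieceY κ η id ρ0 τ' s t
  have e : √(X ^ 2 + Y ^ 2) = X * √(1 + (Y / X) ^ 2) := by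
    rw [← Real.sqrt_sq hX.le, ← Real.sqrt_mul (by positivity), Real.sqrt_sq hX.le]
    congr 1; field_simp
  have h0 : √(1 + (Y / X) ^ 2) ≠ 0 := (Real.sqrt_pos.2 (by positivity)).ne'
  rw [Real.cos_arctan, Real.sin_arctan, e]
  constructor <;> field_simp

/-- The Jacobian has the sign of `τ'`, hence radius grows with `τ' s` along a ray. This compares
points that are far apart in the triangle, with no need to follow the ray between them. -/
theorem rad_lt (h : IsPiece ε τ κ ρ0 τ') (hl : SmallLayer μ ε τ η) (hμ : μ ≤ 1 / 1000) {s' t' : ℝ}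
    (hst : InTri s t) (hst' : InTri s' t') (hang : ang κ η ρ0 τ' s t = ang κ η ρ0 τ' s' t')
    (hs : 0 < τ' * (s' - s)) : rad κ η ρ0 τ' s t < rad κ η ρ0 τ' s' t' := by
  have hX := h.pieceX_pos hl hμ hst
  have hX' := h.pieceX_pos hl hμ hst'
  have hc := Real.arctan_injective hang
  rw [div_eq_div_iff hX.ne' hX'.ne'] at hc
  have hm := hst.mid hst'
  refine Real.sqrt_lt_sqrt (by positivity) (radial_lt (quadX_sub κ (vers η) (id ρ0)
    (id (ρ0 + τ' / 2)) (id (ρ0 + τ')) s t s' t') (quadY_sub κ (vers η) (halfSin η)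
    (id (ρ0 + τ' / 2)) (id (ρ0 + τ')) s t s' t') ?_ hX hX' (h.cross_pos hl hμ hst hst' hm) ?_)
  · linarith
  · have hdet := det_id (κ := κ) (η := η) (ρ0 := ρ0) (s := (s + s') / 2) (t := (t + t') / 2)
      (h.ne_zero hl.τ_pos)
    simp only [pieceXs, pieceXt, pieceYs, pieceYt] at hdet
    rw [hdet]
    have hj := (h.jac_mem hl hμ hm).1
    have hs' : (s + s') / 2 ∈ Icc (0 : ℝ) 1 := ⟨hm.1.trans hm.2.1, hm.2.2⟩
    have := (h.radius_mem hl.τ_pos hs').1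
    have hj0 : 0 < jac κ η ρ0 τ' ((s + s') / 2) ((t + t') / 2) := by linarith [hl.ε_pos]
    have := mul_pos (mul_pos hl.halfSin_pos hj0) hs
    nlinarith

theorem ang_lt (h : IsPiece ε τ κ ρ0 τ') (hl : SmallLayer μ ε τ η) (hμ : μ ≤ 1 / 1000) {t' : ℝ}
    (hst : InTri s t) (hst' : InTri s t') (ht : t < t') :
    ang κ η ρ0 τ' s t < ang κ η ρ0 τ' s t' := by
  have hX := h.pieceX_pos hl hμ hst
  have hX' := h.pieceX_pos hl hμ hst'
  have hm := hst.mid hst'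
  have h1 := quadX_sub κ (vers η) (id ρ0) (id (ρ0 + τ' / 2)) (id (ρ0 + τ')) s t s t'
  have h2 := quadY_sub κ (vers η) (halfSin η) (id (ρ0 + τ' / 2)) (id (ρ0 + τ')) s t s t'
  have h3 := mul_pos (h.cross_pos hl hμ hst hst' hm) (sub_pos.2 ht)
  refine Real.arctan_strictMono ?_
  rw [div_lt_div_iff₀ hX hX']
  simp only [pieceX, pieceY, pieceXt, pieceYt] at *
  rw [sub_self, mul_zero, zero_add] at h1 h2
  rw [show quadX κ (vers η) (id ρ0) (id (ρ0 + τ' / 2)) (id (ρ0 + τ')) s t' = 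
    quadX κ (vers η) (id ρ0) (id (ρ0 + τ' / 2)) (id (ρ0 + τ')) s t + _ from (sub_eq_iff_eq_add'.1 h1),
    show quadY κ (vers η) (halfSin η) (id (ρ0 + τ' / 2)) (id (ρ0 + τ')) s t' = 
    quadY κ (vers η) (halfSin η) (id (ρ0 + τ' / 2)) (id (ρ0 + τ')) s t + _ from
      (sub_eq_iff_eq_add'.1 h2)] at h3 ⊢
  nlinarith

theorem continuous_pieceX (κ : Bool) (η : ℝ) (f : ℝ → ℝ) (ρ0 τ' : ℝ) :
    Continuous fun x : ℝ × ℝ => pieceX κ η f ρ0 τ' x.1 x.2 := by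
  cases κ <;> simp only [pieceX, quadX, shapeM, shapeN, Bool.false_eq_true, if_true, if_false] <;>
    fun_prop

theorem continuous_pieceY (κ : Bool) (η : ℝ) (f : ℝ → ℝ) (ρ0 τ' : ℝ) :
    Continuous fun x : ℝ × ℝ => pieceY κ η f ρ0 τ' x.1 x.2 := by
  cases κ <;> simp only [pieceY, quadY, shapeZ, Bool.false_eq_true, if_true, if_false] <;> fun_prop

theorem continuousOn_ang (h : IsPiece ε τ κ ρ0 τ') (hl : SmallLayer μ ε τ η) (hμ : μ ≤ 1 / 1000) :
    ContinuousOn (fun x : ℝ × ℝ => ang κ η ρ0 τ' x.1 x.2) {x | InTri x.1 x.2} :=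
  Real.continuous_arctan.comp_continuousOn ((continuous_pieceY κ η id ρ0 τ').continuousOn.div
    (continuous_pieceX κ η id ρ0 τ').continuousOn fun _ hx => (h.pieceX_pos hl hμ hx).ne')

end IsPiece

/-! ### Sectors of a layer -/

/-- The point with coordinates `X`, `Y` in the frame that is rotated by `φ` and has orientation
`o = ± 1`. -/
def place (φ o X Y : ℝ) : Plane :=
  !₂[Real.cos φ * X - o * Real.sin φ * Y, Real.sin φ * X + o * Real.cos φ * Y]

theorem cos_add_mul {o : ℝ} (ho : o = 1 ∨ o = -1) (φ α : ℝ) :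
    Real.cos (φ + o * α) = Real.cos φ * Real.cos α - o * Real.sin φ * Real.sin α := by
  rcases ho with rfl | rfl <;> simp [Real.cos_add]

theorem sin_add_mul {o : ℝ} (ho : o = 1 ∨ o = -1) (φ α : ℝ) :
    Real.sin (φ + o * α) = Real.sin φ * Real.cos α + o * Real.cos φ * Real.sin α := by
  rcases ho with rfl | rfl <;> simp [Real.sin_add]

theorem place_mul_cos_sin {o : ℝ} (ho : o = 1 ∨ o = -1) (φ R α : ℝ) :
    place φ o (R * Real.cos α) (R * Real.sin α) = polarPoint R (φ + o * α) := by
  ext i; fin_cases i <;> simp [place, polarPoint, cos_add_mul ho, sin_add_mul ho] <;> ring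

theorem place_zero (φ o o' X : ℝ) : place φ o X 0 = place φ o' X 0 := by simp [place]

theorem place_add_int_mul_two_pi (φ o X Y : ℝ) (n : ℤ) :
    place (φ + n * (2 * Real.pi)) o X Y = place φ o X Y := by
  simp [place, Real.cos_add_int_mul_two_pi, Real.sin_add_int_mul_two_pi]

theorem norm_polarPoint {R : ℝ} (hR : 0 ≤ R) (θ : ℝ) : ‖polarPoint R θ‖ = R := by
  rw [EuclideanSpace.norm_eq, Fin.sum_univ_two]
  simp only [polarPoint, Real.norm_eq_abs, sq_abs]
  have : ((!₂[R * Real.cos θ, R * Real.sin θ] : Plane) 0) ^ 2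
      + ((!₂[R * Real.cos θ, R * Real.sin θ] : Plane) 1) ^ 2 = R ^ 2 := by
    simp; linear_combination R ^ 2 * Real.sin_sq_add_cos_sq θ
  rw [this, Real.sqrt_sq hR]

theorem polarPoint_inj {R R' θ θ' : ℝ} (hR : 0 < R) (hR' : 0 < R')
    (h : polarPoint R θ = polarPoint R' θ') :
    R = R' ∧ ∃ n : ℤ, θ - θ' = 2 * Real.pi * n := by
  have hRR : R = R' := by rw [← norm_polarPoint hR.le θ, h, norm_polarPoint hR'.le]
  subst hRR
  have h0 := congrArg (fun x : Plane => x 0) h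
  have h1 := congrArg (fun x : Plane => x 1) h
  simp only [polarPoint] at h0 h1
  refine ⟨rfl, Real.Angle.angle_eq_iff_two_pi_dvd_sub.1 (Real.Angle.cos_sin_inj ?_ ?_)⟩
  · exact mul_left_cancel₀ hR.ne' (by simpa using h0)
  · exact mul_left_cancel₀ hR.ne' (by simpa using h1)

def piecePt (κ : Bool) (η : ℝ) (f : ℝ → ℝ) (ρ0 τ' φ o s t : ℝ) : Plane :=
  place φ o (pieceX κ η f ρ0 τ' s t) (pieceY κ η f ρ0 τ' s t)

/-- The interpolant with nodal radii given by `f` on the sector that starts at the axis, of polar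
angle `φ`, of an element of type A, and extends by the angle `η` in the direction `o = ± 1`. -/
def secPt (κ : Bool) (f : ℝ → ℝ) (ε τ η φ o s t : ℝ) : Plane :=
  if t ≤ s then piecePt false η f ε τ φ o s t
  else piecePt κ η f (ε + τ) (-τ) (φ + o * η) (-o) (1 - s) (1 - t)

/-- Along the common edge of the two pieces both sides are quadratic in `s` with the same values at
the same three nodes. In the two frames this is a polynomial identity modulo `σ² = 2 k - k²` and `o²
= 1`. -/
theorem piecePt_diag (κ : Bool) (f : ℝ → ℝ) (ε τ η φ : ℝ) {o : ℝ} (ho : o = 1 ∨ o = -1) (s : ℝ) :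
    piecePt false η f ε τ φ o s s
      = piecePt κ η f (ε + τ) (-τ) (φ + o * η) (-o) (1 - s) (1 - s) := by
  have e1 : ε + τ + -τ = ε := by ring
  have e2 : ε + τ + -τ / 2 = ε + τ / 2 := by ring
  have ho2 : o ^ 2 = 1 := by rcases ho with rfl | rfl <;> norm_num
  simp only [piecePt, place, pieceX, pieceY, e1, e2, cos_add_mul ho, sin_add_mul ho, cos_eq_vers η,
    sin_eq_vers η]
  have hσ := halfSin_sq η
  generalize halfSin η = σ at *
  generalize vers η = k at *
  generalize f ε = g0
  generalize f (ε + τ / 2) = gh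
  generalize f (ε + τ) = g1
  generalize Real.cos φ = C
  generalize Real.sin φ = S
  -- The two coordinates are the cases `(cos φ, sin φ)` and `(sin φ, -cos φ)` of one identity.
  have key : ∀ a b : ℝ, a * quadX false k g0 gh g1 s s - o * b * quadY false k σ gh g1 s s =
      (a * (1 - 4 * k + 2 * k ^ 2) - o * b * (2 * σ * (1 - k))) * quadX κ k g1 gh g0 (1 - s) (1 - s)
      - -o * (b * (1 - 4 * k + 2 * k ^ 2) + o * a * (2 * σ * (1 - k))) *
        quadY κ k σ gh g0 (1 - s) (1 - s) := by
    intro a b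
    cases κ <;>
      simp only [quadX, quadY, shapeM, shapeN, shapeZ, Bool.false_eq_true, if_true, if_false]
    · linear_combination (-4 * a * (1 - k) * (1 - s) * (g0 + 2 * s * (gh - g0)
        + k * g0 * (1 - 2 * (1 - s))) * σ ^ 2) * ho2 - (4 * a * (1 - k) * (1 - s) * (g0 + 2 * s * (gh - g0)
        + k * g0 * (1 - 2 * (1 - s)))) * hσ
    · linear_combination (-4 * a * (1 - k) * (1 - s) * (g0 + 2 * s * (gh - g0)
        + k * g0 * (1 - 2 * (1 - s))) * σ ^ 2) * ho2 - (4 * a * (1 - k) * (1 - s) * (g0 + 2 * s * (gh - g0)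
        + k * g0 * (1 - 2 * (1 - s)))) * hσ
  have k1 := key C S
  have k2 := key S (-C)
  ext i
  fin_cases i
  · simpa using k1
  · simp only [Fin.mk_one, Fin.isValue, Matrix.cons_val_one, Matrix.cons_val_fin_one]
    linear_combination k2

/-! ### Order on a sector -/

/-- The order of level curves passes across the diagonal. If two points with equal angle lie in
different halves, the diagonal has a point with that angle at a parameter between `s` and `s'`, and
the comparison is chained through it. -/
theorem sector_lt {Rl Al Ru Au : ℝ → ℝ → ℝ}
    (diagR : ∀ s ∈ Icc (0 : ℝ) 1, Rl s s = Ru s s) (diagA : ∀ s ∈ Icc (0 : ℝ) 1, Al s s = Au s s)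
    (monoL : ∀ s t t', InTri s t → InTri s t' → t < t' → Al s t < Al s t')
    (monoU : ∀ s t t', InTri (1 - s) (1 - t) → InTri (1 - s) (1 - t') → t < t' → Au s t < Au s t')
    (levL : ∀ s t s' t', InTri s t → InTri s' t' → s < s' → Al s t = Al s' t' → Rl s t < Rl s' t')
    (levU : ∀ s t s' t', InTri (1 - s) (1 - t) → InTri (1 - s') (1 - t') → s < s' →
      Au s t = Au s' t' → Ru s t < Ru s' t')
    (cont : ContinuousOn (fun s => Al s s) (Icc 0 1)) {s t s' t' : ℝ}
    (hs : s ∈ Icc (0 : ℝ) 1) (ht : t ∈ Icc (0 : ℝ) 1) (hs' : s' ∈ Icc (0 : ℝ) 1)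
    (ht' : t' ∈ Icc (0 : ℝ) 1) (hss : s < s')
    (hA : (if t ≤ s then Al s t else Au s t) = if t' ≤ s' then Al s' t' else Au s' t') :
    (if t ≤ s then Rl s t else Ru s t) < if t' ≤ s' then Rl s' t' else Ru s' t' := by
  have hsub : uIcc s s' ⊆ Icc 0 1 := by
    rw [uIcc_of_le hss.le]; exact Icc_subset_Icc hs.1 hs'.2
  have triL : ∀ {x y}, 0 ≤ y → y ≤ x → x ≤ 1 → InTri x y := fun h1 h2 h3 => ⟨h1, h2, h3⟩
  have triU : ∀ {x y}, y ≤ 1 → x ≤ y → 0 ≤ x → InTri (1 - x) (1 - y) := fun h1 h2 h3 =>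
    ⟨by linarith, by linarith, by linarith⟩
  split_ifs at hA ⊢ with h1 h2 h2
  · exact levL _ _ _ _ (triL ht.1 h1 hs.2) (triL ht'.1 h2 hs'.2) hss hA
  · push Not at h2
    have a1 : Al s t ≤ Al s s := by
      rcases h1.eq_or_lt with h | h
      · rw [h]
      · exact (monoL _ _ _ (triL ht.1 h1 hs.2) (triL hs.1 le_rfl hs.2) h).le
    have a2 : Al s' s' < Al s t := by
      rw [hA, diagA s' hs']
      exact monoU _ _ _ (triU hs'.2 le_rfl hs'.1) (triU ht'.2 h2.le hs'.1) h2
    -- The common angle lies between the diagonal angles at `s'` and `s`; nothing is assumed about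
    -- monotonicity of the angle along the diagonal.
    obtain ⟨x, hx, hxe⟩ := intermediate_value_uIcc (cont.mono hsub) (mem_uIcc_of_ge a2.le a1)
    have hx01 := hsub hx
    rw [uIcc_of_le hss.le] at hx
    simp only at hxe
    have hxs' : x < s' := by
      rcases hx.2.eq_or_lt with h | h
      · rw [h] at hxe; linarith
      · exact h
    have b1 : Rl s t ≤ Rl x x := by
      rcases hx.1.eq_or_lt with h | h
      · rw [← h] at hxe ⊢
        have : t = s := by
          by_contra hne
          have := monoL _ _ _ (triL ht.1 h1 hs.2) (triL hs.1 le_rfl hs.2) (lt_of_le_of_ne h1 hne)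
          linarith
        rw [this]
      · exact (levL _ _ _ _ (triL ht.1 h1 hs.2) (triL hx01.1 le_rfl hx01.2) h hxe.symm).le
    rw [diagR x hx01] at b1
    refine b1.trans_lt (levU _ _ _ _ (triU hx01.2 le_rfl hx01.1) (triU ht'.2 h2.le hs'.1) hxs' ?_)
    rw [← diagA x hx01, hxe, hA]
  · push Not at h1
    have a1 : Al s s < Al s' t' := by
      rw [← hA, diagA s hs]
      exact monoU _ _ _ (triU hs.2 le_rfl hs.1) (triU ht.2 h1.le hs.1) h1
    have a2 : Al s' t' ≤ Al s' s' := by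
      rcases h2.eq_or_lt with h | h
      · rw [h]
      · exact (monoL _ _ _ (triL ht'.1 h2 hs'.2) (triL hs'.1 le_rfl hs'.2) h).le
    obtain ⟨x, hx, hxe⟩ := intermediate_value_uIcc (cont.mono hsub) (mem_uIcc_of_le a1.le a2)
    have hx01 := hsub hx
    rw [uIcc_of_le hss.le] at hx
    simp only at hxe
    have hxs : s < x := by
      rcases hx.1.eq_or_lt with h | h
      · rw [← h] at hxe; linarith
      · exact h
    have b1 : Rl x x ≤ Rl s' t' := by
      rcases hx.2.eq_or_lt with h | h
      · rw [h] at hxe ⊢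
        have : t' = s' := by
          by_contra hne
          have := monoL _ _ _ (triL ht'.1 h2 hs'.2) (triL hs'.1 le_rfl hs'.2) (lt_of_le_of_ne h2 hne)
          linarith
        rw [this]
      · exact (levL _ _ _ _ (triL hx01.1 le_rfl hx01.2) (triL ht'.1 h2 hs'.2) h hxe).le
    rw [diagR x hx01] at b1
    refine lt_of_lt_of_le (levU _ _ _ _ (triU ht.2 h1.le hs.1) (triU hx01.2 le_rfl hx01.1) hxs ?_) b1
    rw [← diagA x hx01, hxe, hA]
  · push Not at h1 h2
    exact levU _ _ _ _ (triU ht.2 h1.le hs.1) (triU ht'.2 h2.le hs'.1) hss hA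

def secRad (κ : Bool) (ε τ η s t : ℝ) : ℝ :=
  if t ≤ s then IsPiece.rad false η ε τ s t else IsPiece.rad κ η (ε + τ) (-τ) (1 - s) (1 - t)

def secAng (κ : Bool) (ε τ η s t : ℝ) : ℝ :=
  if t ≤ s then IsPiece.ang false η ε τ s t else η - IsPiece.ang κ η (ε + τ) (-τ) (1 - s) (1 - t)

theorem isPiece_lower (ε τ : ℝ) : IsPiece ε τ false ε τ := Or.inl ⟨rfl, rfl, rfl⟩

theorem isPiece_upper (ε τ : ℝ) (κ : Bool) : IsPiece ε τ κ (ε + τ) (-τ) := Or.inr ⟨rfl, rfl⟩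

theorem inTri_of_le {s t : ℝ} (hs : s ∈ Icc (0 : ℝ) 1) (ht : t ∈ Icc (0 : ℝ) 1) (h : t ≤ s) :
    InTri s t := ⟨ht.1, h, hs.2⟩

theorem inTri_of_ge {s t : ℝ} (hs : s ∈ Icc (0 : ℝ) 1) (ht : t ∈ Icc (0 : ℝ) 1) (h : s ≤ t) :
    InTri (1 - s) (1 - t) := ⟨by linarith [ht.2], by linarith, by linarith [hs.1]⟩

namespace SmallLayer

variable {μ ε τ η : ℝ} (κ : Bool)

theorem piecePt_id (hl : SmallLayer μ ε τ η) (hμ : μ ≤ 1 / 1000) {κ : Bool} {ρ0 τ' : ℝ}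
    (h : IsPiece ε τ κ ρ0 τ') {φ o s t : ℝ} (ho : o = 1 ∨ o = -1) (hst : InTri s t) :
    piecePt κ η id ρ0 τ' φ o s t =
      polarPoint (IsPiece.rad κ η ρ0 τ' s t) (φ + o * IsPiece.ang κ η ρ0 τ' s t) := by
  obtain ⟨h1, h2⟩ := h.rad_mul_cos hl hμ hst
  rw [← place_mul_cos_sin ho, h1, h2, piecePt]

theorem secPt_id (hl : SmallLayer μ ε τ η) (hμ : μ ≤ 1 / 1000) {φ o s t : ℝ}
    (ho : o = 1 ∨ o = -1) (hs : s ∈ Icc (0 : ℝ) 1) (ht : t ∈ Icc (0 : ℝ) 1) :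
    secPt κ id ε τ η φ o s t = polarPoint (secRad κ ε τ η s t) (φ + o * secAng κ ε τ η s t) := by
  unfold secPt secRad secAng
  split_ifs with h
  · exact hl.piecePt_id hμ (isPiece_lower ε τ) ho (inTri_of_le hs ht h)
  · rw [hl.piecePt_id hμ (isPiece_upper ε τ κ) (by rcases ho with rfl | rfl <;> simp)
      (inTri_of_ge hs ht (not_le.1 h).le)]
    congr 1; ring

/-- Equality of points gives equality of angles only modulo `2 π`; all angles involved lie in `[0, π
/ 2)`, which excludes a nonzero multiple. -/
theorem diag_eq (hl : SmallLayer μ ε τ η) (hμ : μ ≤ 1 / 1000) {s : ℝ} (hs : s ∈ Icc (0 : ℝ) 1) :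
    IsPiece.rad false η ε τ s s = IsPiece.rad κ η (ε + τ) (-τ) (1 - s) (1 - s) ∧
    IsPiece.ang false η ε τ s s = η - IsPiece.ang κ η (ε + τ) (-τ) (1 - s) (1 - s) := by
  have t1 := inTri_of_le hs hs le_rfl
  have t2 := inTri_of_ge hs hs le_rfl
  have p1 := isPiece_lower ε τ
  have p2 := isPiece_upper ε τ κ
  have h := piecePt_diag κ id ε τ η 0 (Or.inl rfl) s
  rw [hl.piecePt_id hμ p1 (Or.inl rfl) t1, hl.piecePt_id hμ p2 (Or.inr rfl) t2] at h
  obtain ⟨h1, n, hn⟩ := polarPoint_inj (p1.rad_pos hl hμ t1) (p2.rad_pos hl hμ t2) h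
  refine ⟨h1, ?_⟩
  have b1 := p1.ang_mem hl hμ t1
  have b2 := p2.ang_mem hl hμ t2
  have b3 := hl.η_pos
  have b4 := hl.η_lt
  have hπ := Real.pi_pos
  have n1 : (n : ℝ) < 1 := by nlinarith
  have n2 : (-1 : ℝ) < n := by nlinarith
  have : n = 0 := by
    have h1 : n < 1 := by exact_mod_cast n1
    have h2 : -1 < n := by exact_mod_cast n2
    omega
  rw [this] at hn
  push_cast at hn
  linarith

theorem secRad_pos (hl : SmallLayer μ ε τ η) (hμ : μ ≤ 1 / 1000) {s t : ℝ}
    (hs : s ∈ Icc (0 : ℝ) 1) (ht : t ∈ Icc (0 : ℝ) 1) : 0 < secRad κ ε τ η s t := by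
  unfold secRad
  split_ifs with h
  · exact (isPiece_lower ε τ).rad_pos hl hμ (inTri_of_le hs ht h)
  · exact (isPiece_upper ε τ κ).rad_pos hl hμ (inTri_of_ge hs ht (not_le.1 h).le)

theorem secAng_upper_lt (hl : SmallLayer μ ε τ η) (hμ : μ ≤ 1 / 1000) {s t t' : ℝ}
    (h : InTri (1 - s) (1 - t)) (h' : InTri (1 - s) (1 - t')) (ht : t < t') :
    η - IsPiece.ang κ η (ε + τ) (-τ) (1 - s) (1 - t)
      < η - IsPiece.ang κ η (ε + τ) (-τ) (1 - s) (1 - t') := by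
  have := (isPiece_upper ε τ κ).ang_lt hl hμ h' h (by linarith)
  linarith

theorem secRad_lt (hl : SmallLayer μ ε τ η) (hμ : μ ≤ 1 / 1000) {s t s' t' : ℝ}
    (hs : s ∈ Icc (0 : ℝ) 1) (ht : t ∈ Icc (0 : ℝ) 1) (hs' : s' ∈ Icc (0 : ℝ) 1)
    (ht' : t' ∈ Icc (0 : ℝ) 1) (hss : s < s') (hA : secAng κ ε τ η s t = secAng κ ε τ η s' t') :
    secRad κ ε τ η s t < secRad κ ε τ η s' t' := by
  have hτ := hl.τ_pos
  unfold secAng at hA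
  unfold secRad
  refine sector_lt (Rl := IsPiece.rad false η ε τ) (Al := IsPiece.ang false η ε τ)
    (Ru := fun s t => IsPiece.rad κ η (ε + τ) (-τ) (1 - s) (1 - t))
    (Au := fun s t => η - IsPiece.ang κ η (ε + τ) (-τ) (1 - s) (1 - t))
    (fun s hs => (hl.diag_eq κ hμ hs).1) (fun s hs => (hl.diag_eq κ hμ hs).2)
    (fun s t t' h h' ht => (isPiece_lower ε τ).ang_lt hl hμ h h' ht)
    (fun s t t' h h' ht => hl.secAng_upper_lt κ hμ h h' ht)
    (fun s t s' t' h h' hss hA => (isPiece_lower ε τ).rad_lt hl hμ h h' hA (by nlinarith))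
    (fun s t s' t' h h' hss hA => (isPiece_upper ε τ κ).rad_lt hl hμ h h' (by linarith)
      (by nlinarith)) ?_ hs ht hs' ht' hss hA
  exact ((isPiece_lower ε τ).continuousOn_ang hl hμ).comp (f := fun s : ℝ => (s, s)) (by fun_prop)
    (fun s hs => inTri_of_le hs hs le_rfl)

theorem secAng_lt (hl : SmallLayer μ ε τ η) (hμ : μ ≤ 1 / 1000) {s t t' : ℝ}
    (hs : s ∈ Icc (0 : ℝ) 1) (ht : t ∈ Icc (0 : ℝ) 1) (ht' : t' ∈ Icc (0 : ℝ) 1) (htt : t < t') :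
    secAng κ ε τ η s t < secAng κ ε τ η s t' := by
  unfold secAng
  split_ifs with h1 h2 h2
  · exact (isPiece_lower ε τ).ang_lt hl hμ (inTri_of_le hs ht h1) (inTri_of_le hs ht' h2) htt
  · push Not at h2
    have a1 : IsPiece.ang false η ε τ s t ≤ IsPiece.ang false η ε τ s s := by
      rcases h1.eq_or_lt with h | h
      · rw [h]
      · exact ((isPiece_lower ε τ).ang_lt hl hμ (inTri_of_le hs ht h1) (inTri_of_le hs hs le_rfl) h).le
    rw [(hl.diag_eq κ hμ hs).2] at a1
    exact a1.trans_lt (hl.secAng_upper_lt κ hμ (inTri_of_ge hs hs le_rfl) (inTri_of_ge hs ht' h2.le) h2)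
  · linarith
  · exact hl.secAng_upper_lt κ hμ (inTri_of_ge hs ht (not_le.1 h1).le)
      (inTri_of_ge hs ht' (not_le.1 h2).le) htt

theorem secAng_zero {s : ℝ} (hs : s ∈ Icc (0 : ℝ) 1) :
    secAng κ ε τ η s 0 = 0 := by
  rw [secAng, if_pos hs.1, IsPiece.ang_zero]

theorem secAng_one (hl : SmallLayer μ ε τ η) (hμ : μ ≤ 1 / 1000) {s : ℝ} (hs : s ∈ Icc (0 : ℝ) 1) :
    secAng κ ε τ η s 1 = η := by
  have e : η - IsPiece.ang κ η (ε + τ) (-τ) (1 - s) (1 - 1) = η := by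
    rw [sub_self, IsPiece.ang_zero, sub_zero]
  unfold secAng
  split_ifs with h
  · have h1 : s = 1 := le_antisymm hs.2 h
    rw [h1] at e ⊢
    rw [(hl.diag_eq κ hμ ⟨zero_le_one, le_rfl⟩).2, e]
  · exact e

theorem secAng_mem (hl : SmallLayer μ ε τ η) (hμ : μ ≤ 1 / 1000) {s t : ℝ}
    (hs : s ∈ Icc (0 : ℝ) 1) (ht : t ∈ Icc (0 : ℝ) 1) : secAng κ ε τ η s t ∈ Icc 0 η := by
  constructor
  · rcases ht.1.eq_or_lt with h | h
    · rw [← h, secAng_zero κ hs]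
    · rw [← secAng_zero κ hs]
      exact (hl.secAng_lt κ hμ hs ⟨le_rfl, zero_le_one⟩ ht h).le
  · rcases ht.2.eq_or_lt with h | h
    · rw [h, hl.secAng_one κ hμ hs]
    · exact (hl.secAng_lt κ hμ hs ht ⟨zero_le_one, le_rfl⟩ h).le.trans_eq (hl.secAng_one κ hμ hs)

/-- Each level curve crosses its sector from angle `0` to angle `η`. The intermediate value theorem
is used on the half that contains the wanted angle. -/
theorem exists_secAng_eq (hl : SmallLayer μ ε τ η) (hμ : μ ≤ 1 / 1000) {s α : ℝ}
    (hs : s ∈ Icc (0 : ℝ) 1) (hα : α ∈ Icc 0 η) :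
    ∃ t ∈ Icc (0 : ℝ) 1, secAng κ ε τ η s t = α := by
  rcases le_total α (IsPiece.ang false η ε τ s s) with h | h
  · have hc : ContinuousOn (fun t => IsPiece.ang false η ε τ s t) (Icc 0 s) :=
      ((isPiece_lower ε τ).continuousOn_ang hl hμ).comp (f := fun t : ℝ => (s, t)) (by fun_prop)
        (fun t ht => ⟨ht.1, ht.2, hs.2⟩)
    obtain ⟨t, ht, he⟩ := intermediate_value_Icc hs.1 hc
      ⟨by simpa only [IsPiece.ang_zero] using hα.1, h⟩
    exact ⟨t, ⟨ht.1, ht.2.trans hs.2⟩, by rw [secAng, if_pos ht.2]; exact he⟩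
  · have hc : ContinuousOn (fun t => η - IsPiece.ang κ η (ε + τ) (-τ) (1 - s) (1 - t)) (Icc s 1) :=
      continuousOn_const.sub
        (((isPiece_upper ε τ κ).continuousOn_ang hl hμ).comp (f := fun t : ℝ => (1 - s, 1 - t))
        (by fun_prop) (fun t ht => inTri_of_ge hs ⟨hs.1.trans ht.1, ht.2⟩ ht.1))
    rw [(hl.diag_eq κ hμ hs).2] at h
    obtain ⟨t, ht, he⟩ := intermediate_value_Icc hs.2 hc
      ⟨h, by simpa only [sub_self, IsPiece.ang_zero, sub_zero] using hα.2⟩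
    refine ⟨t, ⟨hs.1.trans ht.1, ht.2⟩, ?_⟩
    rcases ht.1.eq_or_lt with h' | h'
    · rw [secAng, if_pos h'.ge, ← he, ← h', (hl.diag_eq κ hμ hs).2]
    · rw [secAng, if_neg (not_le.2 h')]; exact he

end SmallLayer

/-! ### Elements and sectors -/

/-- Elements of types A and B are symmetric about their axis, so each is two mirror images of one
piece. -/
theorem piecePt_neg (η : ℝ) (f : ℝ → ℝ) (ρ0 τ' φ o s t : ℝ) :
    piecePt false η f ρ0 τ' φ o s (-t) = piecePt false η f ρ0 τ' φ (-o) s t := by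
  have e1 : pieceX false η f ρ0 τ' s (-t) = pieceX false η f ρ0 τ' s t := by
    simp only [pieceX, quadX, shapeM, shapeN, Bool.false_eq_true, if_false]; ring
  have e2 : pieceY false η f ρ0 τ' s (-t) = -pieceY false η f ρ0 τ' s t := by
    simp only [pieceY, quadY, shapeZ, Bool.false_eq_true, if_false]; ring
  rw [piecePt, piecePt, e1, e2]
  simp [place]

theorem piecePt_zero (κ : Bool) (η : ℝ) (f : ℝ → ℝ) (ρ0 τ' φ o s : ℝ) :
    piecePt κ η f ρ0 τ' φ o s 0 = place φ 1 (pieceX κ η f ρ0 τ' s 0) 0 := by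
  have : pieceY κ η f ρ0 τ' s 0 = 0 := by simp [pieceY, quadY]
  rw [piecePt, this, place_zero φ o 1]

theorem secPt_upper (κ : Bool) (f : ℝ → ℝ) (ε τ η φ : ℝ) {o s t : ℝ} (ho : o = 1 ∨ o = -1)
    (hst : s ≤ t) :
    secPt κ f ε τ η φ o s t = piecePt κ η f (ε + τ) (-τ) (φ + o * η) (-o) (1 - s) (1 - t) := by
  rcases hst.eq_or_lt with rfl | h
  · rw [secPt, if_pos le_rfl, piecePt_diag κ f ε τ η φ ho]
  · rw [secPt, if_neg (not_le.2 h)]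

theorem secPt_zero (κ : Bool) (f : ℝ → ℝ) (ε τ η φ o : ℝ) {s : ℝ} (hs : 0 ≤ s) :
    secPt κ f ε τ η φ o s 0 = place φ 1 (pieceX false η f ε τ s 0) 0 := by
  rw [secPt, if_pos hs, piecePt_zero]

theorem secPt_one (κ : Bool) (f : ℝ → ℝ) (ε τ η φ : ℝ) {o s : ℝ} (ho : o = 1 ∨ o = -1)
    (hs : s ≤ 1) : secPt κ f ε τ η φ o s 1
      = place (φ + o * η) 1 (pieceX κ η f (ε + τ) (-τ) (1 - s) 0) 0 := by
  rw [secPt_upper κ f ε τ η φ ho hs, sub_self, piecePt_zero]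

theorem secPt_add_int_mul_two_pi (κ : Bool) (f : ℝ → ℝ) (ε τ η φ o s t : ℝ) (n : ℤ) :
    secPt κ f ε τ η (φ + n * (2 * Real.pi)) o s t = secPt κ f ε τ η φ o s t := by
  simp only [secPt, piecePt, place_add_int_mul_two_pi]
  rw [show φ + n * (2 * Real.pi) + o * η = (φ + o * η) + n * (2 * Real.pi) by ring,
    place_add_int_mul_two_pi]

/-- `v` is radially symmetric, with profile `f`. -/
def IsRadial (v : Plane → Plane) (f : ℝ → ℝ) : Prop :=
  ∀ ρ θ : ℝ, 0 < ρ → v (polarPoint ρ θ) = f ρ • polarPoint 1 θ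

theorem isRadial_id : IsRadial id id := by
  intro ρ θ _; ext i; fin_cases i <;> simp [polarPoint]

theorem isRadial_radialMap (r : ℝ → ℝ) : IsRadial (radialMap r) r := by
  intro ρ θ hρ
  rw [radialMap, norm_polarPoint hρ.le]
  ext i; fin_cases i <;> simp [polarPoint] <;> field_simp

theorem nodalInterp_eq (T : Element) {v : Plane → Plane} {f : ℝ → ℝ} (hv : IsRadial v f)
    (hT : ∀ i, 0 < T.radius i) (x : ℝ × ℝ) :
    T.nodalInterp v x = vertexShape 0 x • f (T.radius 0) • polarPoint 1 (T.angle 0)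
      + vertexShape 1 x • f (T.radius 1) • polarPoint 1 (T.angle 1)
      + vertexShape 2 x • f (T.radius 2) • polarPoint 1 (T.angle 2)
      + (edgeShape 0 1 x • f ((T.radius 0 + T.radius 1) / 2) •
          polarPoint 1 ((T.angle 0 + T.angle 1) / 2)
        + edgeShape 0 2 x • f ((T.radius 0 + T.radius 2) / 2) •
          polarPoint 1 ((T.angle 0 + T.angle 2) / 2)
        + edgeShape 1 2 x • f ((T.radius 1 + T.radius 2) / 2) •
          polarPoint 1 ((T.angle 1 + T.angle 2) / 2)) := by
  have e0 : Finset.Ioi (0 : Fin 3) = {1, 2} := by decide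
  have e1 : Finset.Ioi (1 : Fin 3) = {2} := by decide
  have e2 : Finset.Ioi (2 : Fin 3) = ∅ := by decide
  have h0 := hT 0
  have h1 := hT 1
  have h2 := hT 2
  rw [Element.nodalInterp, Fin.sum_univ_three, Fin.sum_univ_three, e0, e1, e2,
    Finset.sum_pair (by decide), Finset.sum_singleton, Finset.sum_empty, add_zero]
  simp only [Element.vertex, Element.edgeNode]
  rw [hv _ _ h0, hv _ _ h1, hv _ _ h2, hv _ _ (by positivity), hv _ _ (by positivity),
    hv _ _ (by positivity)]

theorem cos_half_eq (η : ℝ) : Real.cos (η / 2) = 1 - vers η := by simp [vers]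

section Elements

variable {v : Plane → Plane} {f : ℝ → ℝ} {ε τ η φ : ℝ} {N : ℕ}

/-- The sum `x.1 + x.2` vanishes at the vertex on the axis, and `x.2 - x.1` is odd across the axis;
the half with `x.1 ≤ x.2` is therefore a piece. -/
theorem nodalInterp_elementA (hv : IsRadial v f) (hε : 0 < ε) (hτ : 0 < τ)
    (hη : Real.pi / N = η) (x : ℝ × ℝ) :
    (elementA ε τ N φ).nodalInterp v x = piecePt false η f ε τ φ 1 (x.1 + x.2) (x.2 - x.1) := by
  rw [nodalInterp_eq _ hv (by intro i; fin_cases i <;> simp [elementA] <;> positivity)]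
  simp only [elementA, hη, Matrix.cons_val_zero, Matrix.cons_val_one, Matrix.cons_val]
  rw [show (φ + (φ - η)) / 2 = φ - η / 2 by ring, show (φ + (φ + η)) / 2 = φ + η / 2 by ring,
    show (φ - η + (φ + η)) / 2 = φ by ring, show (ε + (ε + τ)) / 2 = ε + τ / 2 by ring,
    show (ε + τ + (ε + τ)) / 2 = ε + τ by ring]
  ext i
  fin_cases i <;>
  simp only [piecePt, place, polarPoint, pieceX, pieceY, quadX, quadY, shapeM, shapeN, shapeZ,
    Bool.false_eq_true, if_false, vertexShape, edgeShape, bary, Fin.zero_eta, Fin.mk_one,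
    Fin.isValue, PiLp.add_apply, PiLp.smul_apply, smul_eq_mul, Matrix.cons_val_zero,
    Matrix.cons_val_one, Matrix.cons_val, Real.cos_add, Real.cos_sub, Real.sin_add, Real.sin_sub,
    cos_eq_vers η, sin_eq_vers η, cos_half_eq, ← halfSin.eq_1 η] <;> ring

theorem nodalInterp_elementB (hv : IsRadial v f) (hε : 0 < ε) (hτ : 0 < τ)
    (hη : Real.pi / N = η) (x : ℝ × ℝ) :
    (elementB ε τ N φ).nodalInterp v x =
      piecePt false η f (ε + τ) (-τ) φ 1 (x.1 + x.2) (x.1 - x.2) := by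
  rw [nodalInterp_eq _ hv (by intro i; fin_cases i <;> simp [elementB] <;> positivity)]
  simp only [elementB, hη, Matrix.cons_val_zero, Matrix.cons_val_one, Matrix.cons_val]
  rw [show (φ + (φ - η)) / 2 = φ - η / 2 by ring, show (φ + (φ + η)) / 2 = φ + η / 2 by ring,
    show (φ + η + (φ - η)) / 2 = φ by ring, show (ε + τ + ε) / 2 = ε + τ / 2 by ring,
    show (ε + ε) / 2 = ε by ring]
  ext i
  fin_cases i <;>
  simp only [piecePt, place, polarPoint, pieceX, pieceY, quadX, quadY, shapeM, shapeN, shapeZ,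
    Bool.false_eq_true, if_false, vertexShape, edgeShape, bary, Fin.zero_eta, Fin.mk_one,
    Fin.isValue, PiLp.add_apply, PiLp.smul_apply, smul_eq_mul, Matrix.cons_val_zero,
    Matrix.cons_val_one, Matrix.cons_val, Real.cos_add, Real.cos_sub, Real.sin_add, Real.sin_sub,
    cos_eq_vers η, sin_eq_vers η, cos_half_eq, ← halfSin.eq_1 η,
    show ε + τ + -τ = ε by ring, show ε + τ + -τ / 2 = ε + τ / 2 by ring] <;> ring

theorem nodalInterp_elementC (hv : IsRadial v f) (hε : 0 < ε) (hτ : 0 < τ)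
    (hη : Real.pi / N = η) (x : ℝ × ℝ) :
    (elementC ε τ N φ).nodalInterp v x =
      piecePt true η f (ε + τ) (-τ) φ 1 (1 - x.1) x.2 := by
  rw [nodalInterp_eq _ hv (by intro i; fin_cases i <;> simp [elementC] <;> positivity)]
  simp only [elementC, hη, Matrix.cons_val_zero, Matrix.cons_val_one, Matrix.cons_val]
  rw [show (φ + (φ + η)) / 2 = φ + η / 2 by ring,
    show (φ + φ) / 2 = φ by ring, show (ε + (ε + τ)) / 2 = ε + τ / 2 by ring,
    show (ε + τ + ε) / 2 = ε + τ / 2 by ring, show (ε + ε) / 2 = ε by ring]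
  ext i
  fin_cases i <;>
  simp only [piecePt, place, polarPoint, pieceX, pieceY, quadX, quadY, shapeM, shapeN, shapeZ,
    if_true, vertexShape, edgeShape, bary, Fin.zero_eta, Fin.mk_one,
    Fin.isValue, PiLp.add_apply, PiLp.smul_apply, smul_eq_mul, Matrix.cons_val_zero,
    Matrix.cons_val_one, Matrix.cons_val, Real.cos_add, Real.sin_add,
    cos_eq_vers η, sin_eq_vers η, cos_half_eq, ← halfSin.eq_1 η,
    show ε + τ + -τ = ε by ring, show ε + τ + -τ / 2 = ε + τ / 2 by ring] <;> ring

theorem nodalInterp_elementD (hv : IsRadial v f) (hε : 0 < ε) (hτ : 0 < τ)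
    (hη : Real.pi / N = η) (x : ℝ × ℝ) :
    (elementD ε τ N φ).nodalInterp v x =
      piecePt true η f (ε + τ) (-τ) φ (-1) (1 - x.2) x.1 := by
  rw [nodalInterp_eq _ hv (by intro i; fin_cases i <;> simp [elementD] <;> positivity)]
  simp only [elementD, hη, Matrix.cons_val_zero, Matrix.cons_val_one, Matrix.cons_val]
  rw [show (φ + (φ - η)) / 2 = φ - η / 2 by ring, show (φ - η + φ) / 2 = φ - η / 2 by ring,
    show (φ + φ) / 2 = φ by ring, show (ε + (ε + τ)) / 2 = ε + τ / 2 by ring,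
    show (ε + ε) / 2 = ε by ring]
  ext i
  fin_cases i <;>
  simp only [piecePt, place, polarPoint, pieceX, pieceY, quadX, quadY, shapeM, shapeN, shapeZ,
    if_true, vertexShape, edgeShape, bary, Fin.zero_eta, Fin.mk_one,
    Fin.isValue, PiLp.add_apply, PiLp.smul_apply, smul_eq_mul, Matrix.cons_val_zero,
    Matrix.cons_val_one, Matrix.cons_val, Real.cos_sub, Real.sin_sub,
    cos_eq_vers η, sin_eq_vers η, cos_half_eq, ← halfSin.eq_1 η,
    show ε + τ + -τ = ε by ring, show ε + τ + -τ / 2 = ε + τ / 2 by ring] <;> ring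

end Elements

/-- The elements of a layer, standard (`κ = false`) or conforming (`κ = true`). -/
def layerElems (κ : Bool) (ε τ : ℝ) (N : ℕ) (ψ : ℝ) : Set Element :=
  if κ then conformingLayer ε τ N ψ else standardLayer ε τ N ψ

theorem exists_int_mod {N : ℕ} (hN : 0 < N) (j : ℤ) :
    ∃ j' < N, ∃ n : ℤ, j = (j' : ℤ) + n * N := by
  have hN' : (0 : ℤ) < N := by exact_mod_cast hN
  refine ⟨(j % N).toNat, ?_, j / N, ?_⟩
  · have := Int.emod_lt_of_pos j hN'
    have := Int.emod_nonneg j hN'.ne'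
    omega
  · rw [Int.toNat_of_nonneg (Int.emod_nonneg j hN'.ne')]
    have := Int.emod_add_mul_ediv j N
    linarith [mul_comm (j / (N : ℤ)) N]

section Layers

variable {κ : Bool} {ε τ η ψ : ℝ} {N : ℕ}

/-- The parameters are chosen before `v` and `f`, so the element map and the interpolant of the
deformation are evaluated at the same `(s, t)`. -/
theorem exists_secPt_of_elem (hε : 0 < ε) (hτ : 0 < τ) (hη : Real.pi / N = η)
    {T : Element} (hT : T ∈ layerElems κ ε τ N ψ) {x : ℝ × ℝ} (hx : x ∈ refTriangle) :
    ∃ (j : ℤ) (o s t : ℝ), (o = 1 ∨ o = -1) ∧ s ∈ Icc (0 : ℝ) 1 ∧ t ∈ Icc (0 : ℝ) 1 ∧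
      ∀ v f, IsRadial v f → T.nodalInterp v x = secPt κ f ε τ η (ψ + 2 * j * η) o s t := by
  obtain ⟨h1, h2, h3⟩ := hx
  have hA : ∀ j : ℕ, T = elementA ε τ N (ψ + 2 * Real.pi * j / N) →
      ∃ (j : ℤ) (o s t : ℝ), (o = 1 ∨ o = -1) ∧ s ∈ Icc (0 : ℝ) 1 ∧ t ∈ Icc (0 : ℝ) 1 ∧
      ∀ v f, IsRadial v f → T.nodalInterp v x = secPt κ f ε τ η (ψ + 2 * j * η) o s t := by
    rintro j rfl
    have ej : ψ + 2 * Real.pi * j / N = ψ + 2 * ((j : ℤ) : ℝ) * η := by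
      rw [← hη]; push_cast; ring
    rcases le_total x.1 x.2 with h | h
    · refine ⟨j, 1, x.1 + x.2, x.2 - x.1, Or.inl rfl, ⟨by linarith, h3⟩, ⟨by linarith, by linarith⟩,
        fun v f hv => ?_⟩
      rw [nodalInterp_elementA hv hε hτ hη, ej, secPt, if_pos (by linarith)]
    · refine ⟨j, -1, x.1 + x.2, x.1 - x.2, Or.inr rfl, ⟨by linarith, h3⟩, ⟨by linarith, by linarith⟩,
        fun v f hv => ?_⟩
      rw [nodalInterp_elementA hv hε hτ hη, ej, secPt, if_pos (by linarith), ← piecePt_neg, neg_sub]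
  -- The axis of an element of type B lies midway between the axes of two elements of type A. Its
  -- halves belong to the forward sector of the first and the backward sector of the second, whence
  -- the index `j + 1` with orientation `-1`.
  have ej : ∀ j : ℕ, ψ + Real.pi / N + 2 * Real.pi * j / N = ψ + 2 * (((j : ℤ) + 1 : ℤ) : ℝ) * η + -1 * η := by
    intro j; rw [← hη]; push_cast; ring
  have ej' : ∀ j : ℕ, ψ + Real.pi / N + 2 * Real.pi * j / N = ψ + 2 * ((j : ℤ) : ℝ) * η + 1 * η := by
    intro j; rw [← hη]; push_cast; ring
  cases κ with
  | false =>
    obtain ⟨j, -, hj | rfl⟩ := hT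
    · exact hA j hj
    rcases le_total x.2 x.1 with h | h
    · refine ⟨j + 1, -1, 1 - (x.1 + x.2), 1 - (x.1 - x.2), Or.inr rfl, ⟨by linarith, by linarith⟩,
        ⟨by linarith, by linarith⟩, fun v f hv => ?_⟩
      rw [nodalInterp_elementB hv hε hτ hη, ej, secPt_upper _ _ _ _ _ _ (Or.inr rfl) (by linarith)]
      simp
    · refine ⟨j, 1, 1 - (x.1 + x.2), 1 - (x.2 - x.1), Or.inl rfl, ⟨by linarith, by linarith⟩,
        ⟨by linarith, by linarith⟩, fun v f hv => ?_⟩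
      rw [nodalInterp_elementB hv hε hτ hη, ej', secPt_upper _ _ _ _ _ _ (Or.inl rfl) (by linarith),
        ← piecePt_neg]
      simp
  | true =>
    obtain ⟨j, -, hj | rfl | rfl⟩ := hT
    · exact hA j hj
    · refine ⟨j + 1, -1, x.1, 1 - x.2, Or.inr rfl, ⟨by linarith, by linarith⟩,
        ⟨by linarith, by linarith⟩, fun v f hv => ?_⟩
      rw [nodalInterp_elementC hv hε hτ hη, ej, secPt_upper _ _ _ _ _ _ (Or.inr rfl) (by linarith)]
      simp
    · refine ⟨j, 1, x.2, 1 - x.1, Or.inl rfl, ⟨by linarith, by linarith⟩,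
        ⟨by linarith, by linarith⟩, fun v f hv => ?_⟩
      rw [nodalInterp_elementD hv hε hτ hη, ej', secPt_upper _ _ _ _ _ _ (Or.inl rfl) (by linarith)]
      simp

theorem exists_elem_of_secPt (hε : 0 < ε) (hτ : 0 < τ) (hN : 0 < N) (hη : Real.pi / N = η)
    (j : ℤ) {o s t : ℝ} (ho : o = 1 ∨ o = -1) (hs : s ∈ Icc (0 : ℝ) 1) (ht : t ∈ Icc (0 : ℝ) 1) :
    ∃ T ∈ layerElems κ ε τ N ψ, ∃ x ∈ refTriangle,
      ∀ v f, IsRadial v f → T.nodalInterp v x = secPt κ f ε τ η (ψ + 2 * j * η) o s t := by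
  have hNη : (N : ℝ) * η = Real.pi := by
    rw [← hη]; field_simp
  rcases le_total t s with hst | hst
  · obtain ⟨j', hj', n, hn⟩ := exists_int_mod hN j
    have ej : ψ + 2 * j * η = ψ + 2 * Real.pi * j' / N + n * (2 * Real.pi) := by
      rw [hn, show 2 * Real.pi * j' / N = 2 * j' * (Real.pi / N) by ring, hη, ← hNη]
      push_cast; ring
    refine ⟨elementA ε τ N (ψ + 2 * Real.pi * j' / N), ?_, ((s - o * t) / 2, (s + o * t) / 2), ?_,
      fun v f hv => ?_⟩
    · cases κ
      · exact ⟨j', hj', Or.inl rfl⟩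
      · exact ⟨j', hj', Or.inl rfl⟩
    · rcases ho with rfl | rfl <;>
        exact ⟨by simp only; linarith [ht.1], by simp only; linarith [ht.1],
          by simp only; linarith [hs.2]⟩
    · rw [nodalInterp_elementA hv hε hτ hη, ej, secPt_add_int_mul_two_pi, secPt, if_pos hst]
      rcases ho with rfl | rfl
      · congr 1 <;> ring
      · rw [← piecePt_neg]; congr 1 <;> ring
  · obtain ⟨j'', hj''⟩ : ∃ j'' : ℤ, ψ + 2 * j * η + o * η = ψ + η + 2 * j'' * η := by
      rcases ho with rfl | rfl
      · exact ⟨j, by ring⟩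
      · exact ⟨j - 1, by push_cast; ring⟩
    obtain ⟨j', hj', n, hn⟩ := exists_int_mod hN j''
    have ej : ψ + 2 * j * η + o * η
        = ψ + Real.pi / N + 2 * Real.pi * j' / N + n * (2 * Real.pi) := by
      rw [hj'', hn, show 2 * Real.pi * j' / N = 2 * j' * (Real.pi / N) by ring, hη, ← hNη]
      push_cast; ring
    have key : ∀ f : ℝ → ℝ, secPt κ f ε τ η (ψ + 2 * j * η) o s t
        = piecePt κ η f (ε + τ) (-τ) (ψ + Real.pi / N + 2 * Real.pi * j' / N) (-o) (1 - s) (1 - t) := by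
      intro f
      rw [secPt_upper κ f ε τ η _ ho hst, ej, piecePt, place_add_int_mul_two_pi, piecePt]
    cases κ with
    | false =>
      refine ⟨elementB ε τ N (ψ + Real.pi / N + 2 * Real.pi * j' / N), ⟨j', hj', Or.inr rfl⟩,
        ((1 - s - o * (1 - t)) / 2, (1 - s + o * (1 - t)) / 2), ?_, fun v f hv => ?_⟩
      · rcases ho with rfl | rfl <;>
          exact ⟨by simp only; linarith [ht.2], by simp only; linarith [ht.2],
            by simp only; linarith [hs.1]⟩
      · rw [nodalInterp_elementB hv hε hτ hη, key]
        rcases ho with rfl | rfl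
        · rw [← piecePt_neg]; congr 1 <;> ring
        · rw [neg_neg]; congr 1 <;> ring
    | true =>
      rcases ho with rfl | rfl
      · refine ⟨elementD ε τ N (ψ + Real.pi / N + 2 * Real.pi * j' / N),
          ⟨j', hj', Or.inr (Or.inr rfl)⟩, (1 - t, s), ⟨by simp only; linarith [ht.2], hs.1,
          by simp only; linarith⟩, fun v f hv => ?_⟩
        rw [nodalInterp_elementD hv hε hτ hη, key]
      · refine ⟨elementC ε τ N (ψ + Real.pi / N + 2 * Real.pi * j' / N),
          ⟨j', hj', Or.inr (Or.inl rfl)⟩, (s, 1 - t), ⟨hs.1, by simp only; linarith [ht.2],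
          by simp only; linarith⟩, fun v f hv => ?_⟩
        rw [nodalInterp_elementC hv hε hτ hη, key, neg_neg]

/-! ### Order on a layer -/

/-- Points on one ray lie in the same sector, or at a shared boundary angle `0` or `η` of two mirror
sectors. In each case their sector angles agree, so the order inside one sector decides; on shared
boundaries the interpolants depend only on the nodes there. -/
theorem layer_order {μ : ℝ} (hl : SmallLayer μ ε τ η) (hμ : μ ≤ 1 / 1000) (hN : 0 < N)
    (hη : Real.pi / N = η) {j j' : ℤ} {o o' s t s' t' R R' θ : ℝ} (ho : o = 1 ∨ o = -1)
    (ho' : o' = 1 ∨ o' = -1) (hs : s ∈ Icc (0 : ℝ) 1) (ht : t ∈ Icc (0 : ℝ) 1)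
    (hs' : s' ∈ Icc (0 : ℝ) 1) (ht' : t' ∈ Icc (0 : ℝ) 1) (hR : 0 < R) (hR' : 0 < R')
    (h : secPt κ id ε τ η (ψ + 2 * j * η) o s t = polarPoint R θ)
    (h' : secPt κ id ε τ η (ψ + 2 * j' * η) o' s' t' = polarPoint R' θ) :
    (s < s' → R < R') ∧ (s = s' → R = R' ∧ t = t' ∧ (0 < t → t < 1 →
        o = o' ∧ ∃ n : ℤ, j - j' = n * N) ∧
      ∀ f, secPt κ f ε τ η (ψ + 2 * j * η) o s t = secPt κ f ε τ η (ψ + 2 * j' * η) o' s' t') := by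
  have hNη : (N : ℝ) * η = Real.pi := by rw [← hη]; field_simp
  rw [hl.secPt_id κ hμ ho hs ht] at h
  rw [hl.secPt_id κ hμ ho' hs' ht'] at h'
  obtain ⟨hRR, n, hn⟩ := polarPoint_inj (hl.secRad_pos κ hμ hs ht) hR h
  obtain ⟨hRR', n', hn'⟩ := polarPoint_inj (hl.secRad_pos κ hμ hs' ht') hR' h'
  have hα := hl.secAng_mem κ hμ hs ht
  have hα' := hl.secAng_mem κ hμ hs' ht'
  have hη0 := hl.η_pos
  set α := secAng κ ε τ η s t with hαd
  set α' := secAng κ ε τ η s' t' with hαd'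
  have heq : ψ + 2 * j * η + o * α = ψ + 2 * j' * η + o' * α' + ((n - n' : ℤ) : ℝ) * (2 * Real.pi) := by
    push_cast; linarith
  -- With `2 π = 2 N η` the congruence of angles becomes an equation for one integer `d`, and the
  -- right side is at most `2 η` in modulus. So `d = 0`, except when both sector angles are `η`.
  have hd : 2 * ((j - j' - N * (n - n') : ℤ) : ℝ) * η = o' * α' - o * α := by
    push_cast; rw [← hNη] at heq; push_cast at heq; linarith
  set d := j - j' - N * (n - n') with hdd
  have cases3 : (o = o' ∧ α = α' ∧ d = 0) ∨ (o ≠ o' ∧ α = 0 ∧ α' = 0 ∧ d = 0) ∨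
      (o ≠ o' ∧ α = η ∧ α' = η) := by
    have hdlt : ∀ x : ℝ, 2 * (d : ℝ) * η = x → -(2 * η) < x → x < 2 * η → d = 0 := by
      intro x hx h1 h2
      have h3 : (d : ℝ) < 1 := by nlinarith
      have h4 : (-1 : ℝ) < d := by nlinarith
      have h3' : d < 1 := by exact_mod_cast h3
      have h4' : -1 < d := by exact_mod_cast h4
      omega
    obtain ⟨a0, a1⟩ := hα
    obtain ⟨b0, b1⟩ := hα'
    have opp : ∀ x : ℝ, x = α + α' → (2 * (d : ℝ) * η = x ∨ 2 * (d : ℝ) * η = -x) →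
        (α = 0 ∧ α' = 0 ∧ d = 0) ∨ (α = η ∧ α' = η) := by
      intro x hx hdx
      rcases lt_or_ge x (2 * η) with h1 | h1
      · left
        have hd0 : d = 0 := by
          rcases hdx with h2 | h2 <;> exact hdlt _ h2 (by linarith) (by linarith)
        have : x = 0 := by rcases hdx with h2 | h2 <;> rw [hd0] at h2 <;> simp at h2 <;> linarith
        exact ⟨by linarith, by linarith, hd0⟩
      · right; constructor <;> linarith
    rcases ho with rfl | rfl <;> rcases ho' with rfl | rfl
    · left
      have hd0 := hdlt _ hd (by linarith) (by linarith)
      rw [hd0] at hd; simp at hd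
      exact ⟨rfl, by linarith, hd0⟩
    · right
      rcases opp _ rfl (Or.inr (by linarith)) with h | h
      · exact Or.inl ⟨by norm_num, h⟩
      · exact Or.inr ⟨by norm_num, h⟩
    · right
      rcases opp _ rfl (Or.inl (by linarith)) with h | h
      · exact Or.inl ⟨by norm_num, h⟩
      · exact Or.inr ⟨by norm_num, h⟩
    · left
      have hd0 := hdlt _ hd (by linarith) (by linarith)
      rw [hd0] at hd; simp at hd
      exact ⟨rfl, by linarith, hd0⟩
  have hαα : α = α' := by rcases cases3 with h | h | h <;> linarith [h.2.1, h.2.2]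
  rw [← hRR, ← hRR']
  refine ⟨fun hss => hl.secRad_lt κ hμ hs ht hs' ht' hss hαα, ?_⟩
  rintro rfl
  have inj : ∀ x y, x ∈ Icc (0 : ℝ) 1 → y ∈ Icc (0 : ℝ) 1 →
      secAng κ ε τ η s x = secAng κ ε τ η s y → x = y := by
    intro x y hx hy hxy
    rcases lt_trichotomy x y with h | h | h
    · exact absurd hxy (hl.secAng_lt κ hμ hs hx hy h).ne
    · exact h
    · exact absurd hxy (hl.secAng_lt κ hμ hs hy hx h).ne'
  have htt : t = t' := inj t t' ht ht' hαα
  have h01 : (0 : ℝ) ∈ Icc (0 : ℝ) 1 := ⟨le_rfl, zero_le_one⟩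
  have h11 : (1 : ℝ) ∈ Icc (0 : ℝ) 1 := ⟨zero_le_one, le_rfl⟩
  have t0 : α = 0 → t = 0 := fun h => inj t 0 ht h01 (by rw [SmallLayer.secAng_zero κ hs]; exact h)
  have t1 : α = η → t = 1 := fun h => inj t 1 ht h11 (by rw [hl.secAng_one κ hμ hs]; exact h)
  subst htt
  refine ⟨rfl, rfl, fun hp hp1 => ?_, fun f => ?_⟩
  · rcases cases3 with h | h | h
    · exact ⟨h.1, n - n', by have := h.2.2; rw [hdd] at this; linarith [mul_comm (N : ℤ) (n - n')]⟩
    · exact absurd (t0 h.2.1) hp.ne'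
    · exact absurd (t1 h.2.1) hp1.ne
  · rcases cases3 with h | h | h
    · obtain ⟨rfl, h2, -⟩ := h
      have : ψ + 2 * j * η = ψ + 2 * j' * η + ((n - n' : ℤ) : ℝ) * (2 * Real.pi) := by
        rw [h2] at heq; linarith
      rw [this, secPt_add_int_mul_two_pi]
    · have : ψ + 2 * j * η = ψ + 2 * j' * η + ((n - n' : ℤ) : ℝ) * (2 * Real.pi) := by
        rw [h.2.1, h.2.2.1] at heq; linarith
      rw [this, secPt_add_int_mul_two_pi, t0 h.2.1, secPt_zero _ _ _ _ _ _ _ hs.1,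
        secPt_zero _ _ _ _ _ _ _ hs.1]
    · rw [h.2.1, h.2.2] at heq
      rw [t1 h.2.1, secPt_one _ _ _ _ _ _ ho hs.2, secPt_one _ _ _ _ _ _ ho' hs.2, heq,
        place_add_int_mul_two_pi]

theorem layer_exists {μ : ℝ} (hl : SmallLayer μ ε τ η) (hμ : μ ≤ 1 / 1000) (κ : Bool) (ψ θ : ℝ)
    {s : ℝ} (hs : s ∈ Icc (0 : ℝ) 1) : ∃ (j : ℤ) (o t R : ℝ), (o = 1 ∨ o = -1) ∧
      t ∈ Icc (0 : ℝ) 1 ∧ 0 < R ∧ secPt κ id ε τ η (ψ + 2 * j * η) o s t = polarPoint R θ := by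
  have hη := hl.η_pos
  have fin : ∀ (j : ℤ) (o : ℝ), (o = 1 ∨ o = -1) → ∀ α ∈ Icc 0 η, ψ + 2 * j * η + o * α = θ →
      ∃ (j : ℤ) (o t R : ℝ), (o = 1 ∨ o = -1) ∧
      t ∈ Icc (0 : ℝ) 1 ∧ 0 < R ∧ secPt κ id ε τ η (ψ + 2 * j * η) o s t = polarPoint R θ := by
    intro j o ho α hα he
    obtain ⟨t, ht, hta⟩ := hl.exists_secAng_eq κ hμ hs hα
    exact ⟨j, o, t, _, ho, ht, hl.secRad_pos κ hμ hs ht, by rw [hl.secPt_id κ hμ ho hs ht, hta, he]⟩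
  have h1 := Int.floor_le ((θ - ψ) / η)
  have h2 := Int.lt_floor_add_one ((θ - ψ) / η)
  -- The parity of the number of half-widths below `θ` tells whether the ray is in a forward sector
  -- or in the backward sector of the next element.
  set n := ⌊(θ - ψ) / η⌋
  rw [le_div_iff₀ hη] at h1
  rw [div_lt_iff₀ hη] at h2
  rcases Int.even_or_odd' n with ⟨j, hj | hj⟩
  · refine fin j 1 (Or.inl rfl) (θ - ψ - 2 * j * η) ?_ (by ring)
    rw [hj] at h1 h2; push_cast at h1 h2
    constructor <;> linarith
  · refine fin (j + 1) (-1) (Or.inr rfl) (ψ + 2 * ((j + 1 : ℤ) : ℝ) * η - θ) ?_ (by ring)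
    rw [hj] at h1 h2; push_cast at h1 h2 ⊢
    constructor <;> linarith

end Layers

/-! ### Neighbouring layers -/

/-- The outer edge of an element of type A; `c` is the nodal radius. -/
def edgePt (η c φ o t : ℝ) : Plane :=
  place φ o (c * (1 - (4 * vers η - 2 * vers η ^ 2) * t ^ 2))
    (c * (2 * halfSin η * t * (1 - vers η)))

theorem secPt_at_one (κ : Bool) (f : ℝ → ℝ) (ε τ η φ o : ℝ) {t : ℝ} (ht : t ≤ 1) :
    secPt κ f ε τ η φ o 1 t = edgePt η (f (ε + τ)) φ o t := by
  rw [secPt, if_pos ht, piecePt, edgePt]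
  congr 1 <;>
    simp only [pieceX, pieceY, quadX, quadY, shapeM, shapeN, shapeZ, Bool.false_eq_true,
      if_false] <;> ring

theorem secPt_false_at_zero (f : ℝ → ℝ) (ε τ η φ : ℝ) {o t : ℝ} (ho : o = 1 ∨ o = -1)
    (ht : 0 ≤ t) :
    secPt false f ε τ η φ o 0 t = edgePt η (f ε) (φ + o * η) (-o) (1 - t) := by
  rw [secPt_upper _ _ _ _ _ _ ho ht, piecePt, edgePt]
  congr 1 <;>
    simp only [pieceX, pieceY, quadX, quadY, shapeM, shapeN, shapeZ, Bool.false_eq_true,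
      if_false, show ε + τ + -τ = ε by ring] <;> ring

/-- The inner edge of a half-triangle in a conforming layer of half-width `2 η` has its middle node
at angle `η` from its axis. It thus has the three nodes of an outer edge of a type A element of
half-width `η` below, and `(1 + o o' t) / 2` matches the two parametrisations. -/
theorem secPt_true_at_zero (f : ℝ → ℝ) (ε τ η φ : ℝ) {o o' t : ℝ} (ho : o = 1 ∨ o = -1)
    (ho' : o' = 1 ∨ o' = -1) (ht : 0 ≤ (1 + o * o' * t) / 2) :
    secPt true f ε τ (2 * η) φ o 0 ((1 + o * o' * t) / 2)
      = edgePt η (f ε) (φ + o * η) o' t := by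
  have ho2 : -o = 1 ∨ -o = -1 := by rcases ho with rfl | rfl <;> simp
  rw [secPt_upper _ _ _ _ _ _ ho ht, piecePt, edgePt,
    show φ + o * (2 * η) = (φ + o * η) + o * η by ring]
  obtain ⟨K, hK⟩ : ∃ K, K = vers (2 * η) := ⟨_, rfl⟩
  obtain ⟨S, hS⟩ : ∃ S, S = halfSin (2 * η) := ⟨_, rfl⟩
  have hSK : S ^ 2 = 2 * K - K ^ 2 := by rw [hK, hS, halfSin_sq]
  have c2 : Real.cos η = 1 - K := by rw [hK, vers, show 2 * η / 2 = η by ring]; ring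
  have s2 : Real.sin η = S := by rw [hS, halfSin, show 2 * η / 2 = η by ring]
  have vK : 4 * vers η - 2 * vers η ^ 2 = K := by linarith [cos_eq_vers η]
  have sS : 2 * halfSin η * t * (1 - vers η) = S * t := by rw [← s2, sin_eq_vers]; ring
  rw [vK, sS]
  simp only [place, pieceX, pieceY, quadX, quadY, shapeM, shapeN, shapeZ, if_true,
    show ε + τ + -τ = ε by ring, cos_add_mul ho (φ + o * η), sin_add_mul ho (φ + o * η), c2, s2,
    ← hK, ← hS]
  generalize f (ε + τ) = g0
  generalize f (ε + τ + -τ / 2) = gh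
  generalize f ε = g1
  generalize Real.cos (φ + o * η) = C
  generalize Real.sin (φ + o * η) = D
  clear hK hS c2 s2 vK sS ht ho2
  ext i
  fin_cases i
  · simp only [Fin.zero_eta, Fin.isValue, Matrix.cons_val_zero]
    rcases ho with rfl | rfl <;> rcases ho' with rfl | rfl <;> grind
  · simp only [Fin.mk_one, Fin.isValue, Matrix.cons_val_one, Matrix.cons_val_fin_one]
    rcases ho with rfl | rfl <;> rcases ho' with rfl | rfl <;> grind

/-- Layers of small elements, each of which fits its neighbours; layer `i` has the inner radius
`ε i`, the thickness `τ i` and the angular half-width `η i`, and is conforming if `κ i` holds. -/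
structure RingMesh (μ : ℝ) (m : ℕ) (ε τ η : ℕ → ℝ) (N : ℕ → ℕ) (κ : ℕ → Bool) (ψ : ℕ → ℝ) :
    Prop where
  μ_le : μ ≤ 1 / 1000
  small : ∀ i ≤ m, SmallLayer μ (ε i) (τ i) (η i)
  N_pos : ∀ i ≤ m, 0 < N i
  η_eq : ∀ i ≤ m, Real.pi / N i = η i
  ε_succ : ∀ i < m, ε (i + 1) = ε i + τ i
  join : ∀ i < m, ∃ q : ℤ, ψ (i + 1) = ψ i + η i + 2 * q * η i
  standard : ∀ i < m, κ (i + 1) = false → η (i + 1) = η i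
  conforming : ∀ i < m, κ (i + 1) = true → η (i + 1) = 2 * η i

namespace RingMesh

variable {μ : ℝ} {m : ℕ} {ε τ η : ℕ → ℝ} {N : ℕ → ℕ} {κ : ℕ → Bool} {ψ : ℕ → ℝ}

/-- The sector `j`, `o` of layer `i`. -/
def pt (ε τ η : ℕ → ℝ) (κ : ℕ → Bool) (ψ : ℕ → ℝ) (f : ℝ → ℝ) (i : ℕ) (j : ℤ) (o s t : ℝ) :
    Plane :=
  secPt (κ i) f (ε i) (τ i) (η i) (ψ i + 2 * j * η i) o s t

/-- The outer curve of a layer is the inner curve of its neighbour, for the interpolant of every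
profile: conformity of the mesh. -/
theorem exists_next (hM : RingMesh μ m ε τ η N κ ψ) {i : ℕ} (hi : i < m) (j : ℤ) {o t : ℝ}
    (ho : o = 1 ∨ o = -1) (ht : t ∈ Icc (0 : ℝ) 1) :
    ∃ (j' : ℤ) (o' t' : ℝ), (o' = 1 ∨ o' = -1) ∧ t' ∈ Icc (0 : ℝ) 1 ∧
      ∀ f, pt ε τ η κ ψ f i j o 1 t = pt ε τ η κ ψ f (i + 1) j' o' 0 t' := by
  obtain ⟨q, hq⟩ := hM.join i hi
  simp only [pt, secPt_at_one _ _ _ _ _ _ _ ht.2, hq, hM.ε_succ i hi]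
  cases hκ : κ (i + 1) with
  | false =>
    rw [hM.standard i hi hκ]
    rcases ho with rfl | rfl
    · refine ⟨j - q, -1, 1 - t, Or.inr rfl, ⟨by linarith [ht.2], by linarith [ht.1]⟩, fun f => ?_⟩
      rw [secPt_false_at_zero _ _ _ _ _ (Or.inr rfl) (by linarith [ht.2])]
      push_cast; congr 1 <;> ring
    · refine ⟨j - q - 1, 1, 1 - t, Or.inl rfl, ⟨by linarith [ht.2], by linarith [ht.1]⟩,
        fun f => ?_⟩
      rw [secPt_false_at_zero _ _ _ _ _ (Or.inl rfl) (by linarith [ht.2])]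
      push_cast; congr 1; ring; ring
  | true =>
    rw [hM.conforming i hi hκ]
    have key : ∀ (j' : ℤ) (o' : ℝ), (o' = 1 ∨ o' = -1) → ((j - q : ℤ) : ℝ) = 2 * j' + (1 + o') / 2 →
        ∃ (j' : ℤ) (o' t' : ℝ), (o' = 1 ∨ o' = -1) ∧ t' ∈ Icc (0 : ℝ) 1 ∧
        ∀ f : ℝ → ℝ, edgePt (η i) (f (ε i + τ i)) (ψ i + 2 * j * η i) o t
          = secPt true f (ε i + τ i) (τ (i + 1)) (2 * η i)
            (ψ i + η i + 2 * q * η i + 2 * j' * (2 * η i)) o' 0 t' := by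
      intro j' o' ho' h
      have hb : (1 + o' * o * t) / 2 ∈ Icc (0 : ℝ) 1 := by
        rcases ho with rfl | rfl <;> rcases ho' with rfl | rfl <;>
          constructor <;> linarith [ht.1, ht.2]
      refine ⟨j', o', (1 + o' * o * t) / 2, ho', hb, fun f => ?_⟩
      rw [secPt_true_at_zero _ _ _ _ _ ho' ho hb.1]
      congr 1
      push_cast at h
      linear_combination 2 * η i * h
    -- When the number of nodes is halved, two consecutive fine edges lie on the two sides of one
    -- coarse type A axis; the parity says on which.
    rcases Int.even_or_odd' (j - q) with ⟨n, hn | hn⟩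
    · exact key n (-1) (Or.inr rfl) (by rw [hn]; push_cast; ring)
    · exact key n 1 (Or.inl rfl) (by rw [hn]; push_cast; ring)

theorem exists_polar (hM : RingMesh μ m ε τ η N κ ψ) {i : ℕ} (hi : i ≤ m) (j : ℤ) {o s t : ℝ}
    (ho : o = 1 ∨ o = -1) (hs : s ∈ Icc (0 : ℝ) 1) (ht : t ∈ Icc (0 : ℝ) 1) :
    ∃ R θ, 0 < R ∧ pt ε τ η κ ψ id i j o s t = polarPoint R θ :=
  ⟨_, _, (hM.small i hi).secRad_pos (κ i) hM.μ_le hs ht,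
    (hM.small i hi).secPt_id (κ i) hM.μ_le ho hs ht⟩

/-- Points on a ray are compared through the point of that ray on the common curve of the two
layers. Equality of radii is possible only when both points are on this curve. -/
theorem order_next (hM : RingMesh μ m ε τ η N κ ψ) {i : ℕ} (hi : i < m) {j j' : ℤ}
    {o o' s t s' t' R R' θ : ℝ} (ho : o = 1 ∨ o = -1)
    (ho' : o' = 1 ∨ o' = -1) (hs : s ∈ Icc (0 : ℝ) 1) (ht : t ∈ Icc (0 : ℝ) 1)
    (hs' : s' ∈ Icc (0 : ℝ) 1) (ht' : t' ∈ Icc (0 : ℝ) 1) (hR : 0 < R) (hR' : 0 < R')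
    (h : pt ε τ η κ ψ id i j o s t = polarPoint R θ)
    (h' : pt ε τ η κ ψ id (i + 1) j' o' s' t' = polarPoint R' θ) :
    R < R' ∨ (s = 1 ∧ s' = 0 ∧ R = R' ∧
      ∀ f, pt ε τ η κ ψ f i j o s t = pt ε τ η κ ψ f (i + 1) j' o' s' t') := by
  have h01 : (0 : ℝ) ∈ Icc (0 : ℝ) 1 := ⟨le_rfl, zero_le_one⟩
  have h11 : (1 : ℝ) ∈ Icc (0 : ℝ) 1 := ⟨zero_le_one, le_rfl⟩
  have upper : ∀ (j : ℤ) (o t R : ℝ), (o = 1 ∨ o = -1) → t ∈ Icc (0 : ℝ) 1 → 0 < R →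
      pt ε τ η κ ψ id i j o 1 t = polarPoint R θ → R < R' ∨ (s' = 0 ∧ R = R' ∧
      ∀ f, pt ε τ η κ ψ f i j o 1 t = pt ε τ η κ ψ f (i + 1) j' o' s' t') := by
    intro j o t R ho ht hR h
    obtain ⟨j₁, o₁, t₁, ho₁, ht₁, h₁⟩ := hM.exists_next hi j ho ht
    have hl := hM.small (i + 1) hi
    rw [h₁ id] at h
    obtain ⟨a1, a2⟩ := layer_order hl hM.μ_le (hM.N_pos _ hi) (hM.η_eq _ hi) ho₁ ho' h01 ht₁ hs' ht'
      hR hR' h h'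
    rcases hs'.1.eq_or_lt with h0 | h0
    · obtain ⟨b1, -, -, b4⟩ := a2 h0
      exact Or.inr ⟨h0.symm, b1, fun f => (h₁ f).trans (b4 f)⟩
    · exact Or.inl (a1 h0)
  rcases hs.2.eq_or_lt with rfl | h0
  · rcases upper j o t R ho ht hR h with h2 | ⟨h2, h3, h4⟩
    · exact Or.inl h2
    · exact Or.inr ⟨rfl, h2, h3, h4⟩
  · have hl := hM.small i hi.le
    obtain ⟨j₁, o₁, t₁, R₁, ho₁, ht₁, hR₁, h₁⟩ := layer_exists hl hM.μ_le (κ i) (ψ i) θ h11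
    have := (layer_order hl hM.μ_le (hM.N_pos _ hi.le) (hM.η_eq _ hi.le) ho ho₁ hs ht h11 ht₁ hR hR₁
      h h₁).1 h0
    rcases upper j₁ o₁ t₁ R₁ ho₁ ht₁ hR₁ h₁ with h2 | ⟨-, h3, -⟩
    · exact Or.inl (this.trans h2)
    · exact Or.inl (h3 ▸ this)

/-- Induction on the distance of the layers, passing at each step through the outer curve of the
layer in between. That curve has `s = 1`, so equality cannot persist beyond adjacent layers. -/
theorem order_of_lt (hM : RingMesh μ m ε τ η N κ ψ) {i i' : ℕ} (hi : i < i') (hi' : i' ≤ m)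
    {j j' : ℤ} {o o' s t s' t' R R' θ : ℝ} (ho : o = 1 ∨ o = -1)
    (ho' : o' = 1 ∨ o' = -1) (hs : s ∈ Icc (0 : ℝ) 1) (ht : t ∈ Icc (0 : ℝ) 1)
    (hs' : s' ∈ Icc (0 : ℝ) 1) (ht' : t' ∈ Icc (0 : ℝ) 1) (hR : 0 < R) (hR' : 0 < R')
    (h : pt ε τ η κ ψ id i j o s t = polarPoint R θ)
    (h' : pt ε τ η κ ψ id i' j' o' s' t' = polarPoint R' θ) :
    R < R' ∨ (s = 1 ∧ s' = 0 ∧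
      ∀ f, pt ε τ η κ ψ f i j o s t = pt ε τ η κ ψ f i' j' o' s' t') := by
  have h11 : (1 : ℝ) ∈ Icc (0 : ℝ) 1 := ⟨zero_le_one, le_rfl⟩
  obtain ⟨n, rfl⟩ := Nat.exists_eq_add_of_lt hi
  induction n generalizing j' o' s' t' R' with
  | zero =>
    rcases hM.order_next (i := i) (by omega) ho ho' hs ht hs' ht' hR hR' h h' with h2 | ⟨h2, h3, -, h4⟩
    · exact Or.inl h2
    · exact Or.inr ⟨h2, h3, h4⟩
  | succ n ih =>
    obtain ⟨j₁, o₁, t₁, R₁, ho₁, ht₁, hR₁, h₁⟩ := layer_exists (hM.small (i + n + 1) (by omega))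
      hM.μ_le (κ (i + n + 1)) (ψ (i + n + 1)) θ h11
    have h2 : R < R₁ := by
      rcases ih ho₁ h11 ht₁ hR₁ (by omega) (by omega) h₁ with h2 | ⟨-, h2, -⟩
      · exact h2
      · norm_num at h2
    rcases hM.order_next (i := i + n + 1) (by omega) ho₁ ho' h11 ht₁ hs' ht' hR₁ hR' h₁ h' with
      h3 | ⟨-, -, h3, -⟩
    · exact Or.inl (h2.trans h3)
    · exact Or.inl (h3 ▸ h2)

/-- Where two sectors meet, the interpolants of a radial map agree. -/
theorem pt_congr (hM : RingMesh μ m ε τ η N κ ψ) {i i' : ℕ} (hi : i ≤ m) (hi' : i' ≤ m)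
    {j j' : ℤ} {o o' s t s' t' : ℝ} (ho : o = 1 ∨ o = -1)
    (ho' : o' = 1 ∨ o' = -1) (hs : s ∈ Icc (0 : ℝ) 1) (ht : t ∈ Icc (0 : ℝ) 1)
    (hs' : s' ∈ Icc (0 : ℝ) 1) (ht' : t' ∈ Icc (0 : ℝ) 1)
    (h : pt ε τ η κ ψ id i j o s t = pt ε τ η κ ψ id i' j' o' s' t') :
    (∀ f, pt ε τ η κ ψ f i j o s t = pt ε τ η κ ψ f i' j' o' s' t') ∧
      (0 < s → s < 1 → 0 < t → t < 1 →
        i = i' ∧ s = s' ∧ t = t' ∧ o = o' ∧ ∃ n : ℤ, j - j' = n * N i) := by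
  obtain ⟨R, θ, hR, h1⟩ := hM.exists_polar hi j ho hs ht
  have h2 := h1
  rw [h] at h2
  rcases lt_trichotomy i i' with hii | rfl | hii
  · rcases hM.order_of_lt hii hi' ho ho' hs ht hs' ht' hR hR h1 h2 with h3 | ⟨h3, h4, h5⟩
    · exact absurd h3 (lt_irrefl _)
    · exact ⟨h5, fun _ h6 => absurd h3 h6.ne⟩
  · have key := layer_order (hM.small i hi) hM.μ_le (hM.N_pos _ hi) (hM.η_eq _ hi) ho ho' hs ht hs'
      ht' hR hR h1 h2
    have key' := layer_order (hM.small i hi) hM.μ_le (hM.N_pos _ hi) (hM.η_eq _ hi) ho' ho hs' ht' hs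
      ht hR hR h2 h1
    rcases lt_trichotomy s s' with h3 | h3 | h3
    · exact absurd (key.1 h3) (lt_irrefl _)
    · obtain ⟨-, h4, h5, h6⟩ := key.2 h3
      exact ⟨h6, fun _ _ h7 h8 => ⟨rfl, h3, h4, h5 h7 h8⟩⟩
    · exact absurd (key'.1 h3) (lt_irrefl _)
  · rcases hM.order_of_lt hii hi ho' ho hs' ht' hs ht hR hR h2 h1 with h3 | ⟨h3, h4, h5⟩
    · exact absurd h3 (lt_irrefl _)
    · exact ⟨fun f => (h5 f).symm, fun h6 => absurd h4 h6.ne'⟩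

/-- The elements of the mesh. -/
def elems (m : ℕ) (ε τ : ℕ → ℝ) (N : ℕ → ℕ) (κ : ℕ → Bool) (ψ : ℕ → ℝ) : Set Element :=
  {T | ∃ i ≤ m, T ∈ layerElems (κ i) (ε i) (τ i) (N i) (ψ i)}

theorem exists_pt_of_elem (hM : RingMesh μ m ε τ η N κ ψ) {i : ℕ} (hi : i ≤ m) {T : Element}
    (hT : T ∈ layerElems (κ i) (ε i) (τ i) (N i) (ψ i)) {x : ℝ × ℝ} (hx : x ∈ refTriangle) :
    ∃ (j : ℤ) (o s t : ℝ), (o = 1 ∨ o = -1) ∧ s ∈ Icc (0 : ℝ) 1 ∧ t ∈ Icc (0 : ℝ) 1 ∧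
      ∀ v f, IsRadial v f → T.nodalInterp v x = pt ε τ η κ ψ f i j o s t :=
  exists_secPt_of_elem (hM.small i hi).ε_pos (hM.small i hi).τ_pos (hM.η_eq i hi) hT hx

theorem exists_elem_of_pt (hM : RingMesh μ m ε τ η N κ ψ) {i : ℕ} (hi : i ≤ m) (j : ℤ) {o s t : ℝ}
    (ho : o = 1 ∨ o = -1) (hs : s ∈ Icc (0 : ℝ) 1) (ht : t ∈ Icc (0 : ℝ) 1) :
    ∃ T ∈ layerElems (κ i) (ε i) (τ i) (N i) (ψ i), ∃ x ∈ refTriangle,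
      ∀ v f, IsRadial v f → T.nodalInterp v x = pt ε τ η κ ψ f i j o s t :=
  exists_elem_of_secPt (hM.small i hi).ε_pos (hM.small i hi).τ_pos (hM.N_pos i hi) (hM.η_eq i hi) j
    ho hs ht

/-- The definition picks an arbitrary preimage; by `pt_congr` every preimage yields the same value.
-/
theorem interpolant_map (hM : RingMesh μ m ε τ η N κ ψ) {v : Plane → Plane} {f : ℝ → ℝ}
    (hv : IsRadial v f) {T : Element} (hT : T ∈ elems m ε τ N κ ψ) {x : ℝ × ℝ}
    (hx : x ∈ refTriangle) :
    interpolant (elems m ε τ N κ ψ) v (T.map x) = T.nodalInterp v x := by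
  have hex : ∃ q : Element × (ℝ × ℝ), q.1 ∈ elems m ε τ N κ ψ ∧ q.2 ∈ refTriangle ∧
      q.1.map q.2 = T.map x := ⟨(T, x), hT, hx, rfl⟩
  rw [interpolant, dif_pos hex]
  obtain ⟨⟨i', hi', hT'⟩, hx', he⟩ := hex.choose_spec
  obtain ⟨i, hi, hT⟩ := hT
  obtain ⟨j, o, s, t, ho, hs, ht, h⟩ := hM.exists_pt_of_elem hi hT hx
  obtain ⟨j', o', s', t', ho', hs', ht', h'⟩ := hM.exists_pt_of_elem hi' hT' hx'
  change hex.choose.1.nodalInterp id _ = T.nodalInterp id x at he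
  rw [h' id id isRadial_id, h id id isRadial_id] at he
  rw [h' v f hv, h v f hv]
  exact (hM.pt_congr hi' hi ho' ho hs' ht' hs ht he).1 f

theorem interpolant_pt (hM : RingMesh μ m ε τ η N κ ψ) {v : Plane → Plane} {f : ℝ → ℝ}
    (hv : IsRadial v f) {i : ℕ} (hi : i ≤ m) (j : ℤ) {o s t : ℝ} (ho : o = 1 ∨ o = -1)
    (hs : s ∈ Icc (0 : ℝ) 1) (ht : t ∈ Icc (0 : ℝ) 1) :
    interpolant (elems m ε τ N κ ψ) v (pt ε τ η κ ψ id i j o s t) = pt ε τ η κ ψ f i j o s t := by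
  obtain ⟨T, hT, x, hx, h⟩ := hM.exists_elem_of_pt hi j ho hs ht
  rw [← h v f hv, ← h id id isRadial_id]
  exact hM.interpolant_map hv ⟨i, hi, hT⟩ hx

end RingMesh

/-! ### The energy density on a piece -/

namespace IsPiece

def normXs (κ : Bool) (η : ℝ) (f : ℝ → ℝ) (ρ0 τ' s t : ℝ) : ℝ := pieceXs κ η f ρ0 τ' s t / τ'

def normYs (κ : Bool) (η : ℝ) (f : ℝ → ℝ) (ρ0 τ' t : ℝ) : ℝ :=
  pieceYs κ η f ρ0 τ' t / (2 * halfSin η * τ')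

def normYt (κ : Bool) (η : ℝ) (f : ℝ → ℝ) (ρ0 τ' s t : ℝ) : ℝ :=
  pieceYt κ η f ρ0 τ' s t / (2 * halfSin η)

/-- The normalised Jacobian of the interpolant with nodal radii given by `f`. -/
def vol (κ : Bool) (η : ℝ) (f : ℝ → ℝ) (ρ0 τ' s t : ℝ) : ℝ :=
  normXs κ η f ρ0 τ' s t * normYt κ η f ρ0 τ' s t - pieceXt κ η f ρ0 τ' s t * normYs κ η f ρ0 τ' t

def frob (κ : Bool) (η : ℝ) (f : ℝ → ℝ) (ρ0 τ' s t : ℝ) : ℝ :=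
  ShapeBounds.frobNum (halfSin η) (normXs κ η f ρ0 τ' s t) (pieceXt κ η f ρ0 τ' s t)
    (normYs κ η f ρ0 τ' t) (normYt κ η f ρ0 τ' s t) (normXs κ η id ρ0 τ' s t)
    (pieceXt κ η id ρ0 τ' s t) (normYs κ η id ρ0 τ' t) (normYt κ η id ρ0 τ' s t)

/-- The energy density of the interpolant, times the normalised Jacobian of the element map. -/
def density (ω p : ℝ) (g : ℝ → ℝ) (κ : Bool) (η : ℝ) (f : ℝ → ℝ) (ρ0 τ' s t : ℝ) : ℝ :=
  (ω * (√(frob κ η f ρ0 τ' s t) / vol κ η id ρ0 τ' s t) ^ p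
    + g (vol κ η f ρ0 τ' s t / vol κ η id ρ0 τ' s t)) * vol κ η id ρ0 τ' s t

variable {μ ε τ η : ℝ} {κ : Bool} {ρ0 τ' s t : ℝ}

theorem frob_nonneg (f : ℝ → ℝ) : 0 ≤ frob κ η f ρ0 τ' s t := by
  unfold frob ShapeBounds.frobNum; positivity

theorem normXs_eq (f : ℝ → ℝ) (hτ' : τ' ≠ 0) : normXs κ η f ρ0 τ' s t =
    nXs (((4 * f (ρ0 + τ' / 2) - 3 * f ρ0 - f (ρ0 + τ'))
        + 2 * (2 * f ρ0 + 2 * f (ρ0 + τ') - 4 * f (ρ0 + τ' / 2)) * s) / τ') (vers η)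
      ((f (ρ0 + τ') - f (ρ0 + τ' / 2)) / τ') (shapeMs κ s t) (f (ρ0 + τ')) τ' (shapeNs κ s) := by
  rw [normXs, pieceXs, quadXs_eq hτ', mul_div_cancel_left₀ _ hτ']

theorem normYs_eq (f : ℝ → ℝ) (hτ' : τ' ≠ 0) (hσ : halfSin η ≠ 0) : normYs κ η f ρ0 τ' t =
    nYs t ((f (ρ0 + τ') - f (ρ0 + τ' / 2)) / τ') (vers η) (f (ρ0 + τ')) τ' (shapeZs κ) := by
  rw [normYs, pieceYs, quadYs_eq hτ',
    mul_div_cancel_left₀ _ (mul_ne_zero (mul_ne_zero two_ne_zero hσ) hτ')]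

theorem normYt_eq (f : ℝ → ℝ) (hσ : halfSin η ≠ 0) : normYt κ η f ρ0 τ' s t =
    nYt (f (ρ0 + τ') + 2 * (1 - s) * (f (ρ0 + τ' / 2) - f (ρ0 + τ'))) (vers η) (f (ρ0 + τ'))
      (shapeZt κ s t) := by
  rw [normYt, pieceYt, quadYt_eq, mul_div_cancel_left₀ _ (mul_ne_zero two_ne_zero hσ)]

theorem pieceXt_eq (f : ℝ → ℝ) (hτ' : τ' ≠ 0) : pieceXt κ η f ρ0 τ' s t =
    nXt (vers η) τ' ((f (ρ0 + τ') - f (ρ0 + τ' / 2)) / τ') (shapeMt κ s) (f (ρ0 + τ'))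
      (shapeNt κ t) t := by
  rw [pieceXt, quadXt_eq hτ']

theorem normXs_id (hτ' : τ' ≠ 0) : normXs κ η id ρ0 τ' s t =
    nXs 1 (vers η) (1 / 2) (shapeMs κ s t) (ρ0 + τ') τ' (shapeNs κ s) := by
  rw [normXs, pieceXs_id hτ', mul_div_cancel_left₀ _ hτ']

theorem normYs_id (hτ' : τ' ≠ 0) (hσ : halfSin η ≠ 0) : normYs κ η id ρ0 τ' t =
    nYs t (1 / 2) (vers η) (ρ0 + τ') τ' (shapeZs κ) := by
  rw [normYs, pieceYs_id hτ', mul_div_cancel_left₀ _ (mul_ne_zero (mul_ne_zero two_ne_zero hσ) hτ')]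

theorem normYt_id (hσ : halfSin η ≠ 0) : normYt κ η id ρ0 τ' s t =
    nYt (ρ0 + τ' * s) (vers η) (ρ0 + τ') (shapeZt κ s t) := by
  rw [normYt, pieceYt_id, mul_div_cancel_left₀ _ (mul_ne_zero two_ne_zero hσ)]

theorem vol_id (hτ' : τ' ≠ 0) (hσ : halfSin η ≠ 0) :
    vol κ η id ρ0 τ' s t = jac κ η ρ0 τ' s t := by
  rw [vol, normXs_id hτ', normYs_id hτ' hσ, normYt_id hσ, pieceXt_id hτ', jac]

theorem det_eq (f : ℝ → ℝ) (hτ' : τ' ≠ 0) (hσ : halfSin η ≠ 0) :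
    pieceXs κ η f ρ0 τ' s t * pieceYt κ η f ρ0 τ' s t
      - pieceXt κ η f ρ0 τ' s t * pieceYs κ η f ρ0 τ' t
      = 2 * halfSin η * τ' * vol κ η f ρ0 τ' s t := by
  rw [vol, normXs, normYs, normYt]; field_simp

/-- The left side is the squared Frobenius norm of `DU adj(DF)`, written with the Gram entries of
the columns, which rotation and reflection of the frame leave unchanged. -/
theorem frob_eq (f : ℝ → ℝ) (hτ' : τ' ≠ 0) (hσ : halfSin η ≠ 0) :
    (pieceXs κ η f ρ0 τ' s t ^ 2 + pieceYs κ η f ρ0 τ' t ^ 2) *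
        (pieceXt κ η id ρ0 τ' s t ^ 2 + pieceYt κ η id ρ0 τ' s t ^ 2)
      - 2 * (pieceXs κ η f ρ0 τ' s t * pieceXt κ η f ρ0 τ' s t
          + pieceYs κ η f ρ0 τ' t * pieceYt κ η f ρ0 τ' s t) *
        (pieceXs κ η id ρ0 τ' s t * pieceXt κ η id ρ0 τ' s t
          + pieceYs κ η id ρ0 τ' t * pieceYt κ η id ρ0 τ' s t)
      + (pieceXt κ η f ρ0 τ' s t ^ 2 + pieceYt κ η f ρ0 τ' s t ^ 2) *
        (pieceXs κ η id ρ0 τ' s t ^ 2 + pieceYs κ η id ρ0 τ' t ^ 2)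
      = (2 * halfSin η * τ') ^ 2 * frob κ η f ρ0 τ' s t := by
  simp only [frob, ShapeBounds.frobNum, normXs, normYs, normYt]
  field_simp
  ring

/-- The tolerances that the estimates need. -/
structure _root_.Cavity.Tolerance (c a M μ : ℝ) : Prop where
  c_pos : 0 < c
  a_pos : 0 < a
  one_le : 1 ≤ M
  μ_le : μ ≤ 1 / 1000
  μ_mul_le : 800 * M ^ 2 * μ ≤ a * c

variable {c a M : ℝ} {r r1 r2 r3 : ℝ → ℝ}

theorem profileBounds (h : IsPiece ε τ κ ρ0 τ') (hl : SmallLayer μ ε τ η) (hT : Tolerance c a M μ)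
    (hr : ProfileData c M a r r1 r2 r3) (hs : s ∈ Icc (0 : ℝ) 1) :
    ProfileBounds M τ (ε + τ) (r (ρ0 + τ')) ((r (ρ0 + τ') - r (ρ0 + τ' / 2)) / τ')
      (((4 * r (ρ0 + τ' / 2) - 3 * r ρ0 - r (ρ0 + τ'))
        + 2 * (2 * r ρ0 + 2 * r (ρ0 + τ') - 4 * r (ρ0 + τ' / 2)) * s) / τ')
      (r (ρ0 + τ') + 2 * (1 - s) * (r (ρ0 + τ' / 2) - r (ρ0 + τ')))
      (r (ρ0 + τ' * s)) (r1 (ρ0 + τ' * s)) :=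
  (hr.profileBounds hT.one_le hT.c_pos hT.a_pos hl.τ_pos (h.abs_eq hl.τ_pos) hl.le_one
    (fun _ hs => ⟨hl.ε_pos.trans_le (h.radius_mem hl.τ_pos hs).1, (h.radius_mem hl.τ_pos hs).2⟩)
    hs).1

theorem shapeBounds (h : IsPiece ε τ κ ρ0 τ') (hl : SmallLayer μ ε τ η) (hμ : μ ≤ 1 / 1000)
    (hst : InTri s t) :
    ShapeBounds (vers η) τ τ' t (shapeMs κ s t) (shapeMt κ s) (shapeNs κ s) (shapeNt κ t)
      (shapeZt κ s t) (shapeZs κ) :=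
  hst.shapeBounds κ hl.vers_pos (hl.vers_le.trans (by linarith)) hl.τ_pos
    (by linarith [hl.le_one, hl.ε_pos]) (h.abs_eq hl.τ_pos)

theorem abs_vol_sub (h : IsPiece ε τ κ ρ0 τ') (hl : SmallLayer μ ε τ η) (hT : Tolerance c a M μ)
    (hr : ProfileData c M a r r1 r2 r3) (hst : InTri s t) :
    |vol κ η r ρ0 τ' s t - r (ρ0 + τ' * s) * r1 (ρ0 + τ' * s)| ≤
      100 * M ^ 2 * (τ ^ 2 + vers η * (ε + τ) + vers η ^ 2 / τ) := by
  have hs : s ∈ Icc (0 : ℝ) 1 := ⟨hst.1.trans hst.2.1, hst.2.2⟩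
  have h1 := (h.shapeBounds hl hT.μ_le hst).abs_det_sub (h.profileBounds hl hT hr hs)
  have hτ' := h.ne_zero hl.τ_pos
  rw [vol, normXs_eq r hτ', normYs_eq r hτ' hl.halfSin_pos.ne', normYt_eq r hl.halfSin_pos.ne',
    pieceXt_eq r hτ']
  exact h1

theorem radius_pos (h : IsPiece ε τ κ ρ0 τ') (hl : SmallLayer μ ε τ η) (hst : InTri s t) :
    0 < ρ0 + τ' * s ∧ ρ0 + τ' * s ≤ 1 := by
  have := h.radius_mem hl.τ_pos (s := s) ⟨hst.1.trans hst.2.1, hst.2.2⟩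
  exact ⟨hl.ε_pos.trans_le this.1, this.2.trans hl.le_one⟩

/-- `R R'` lies between `a c ρ` and `M² ρ`, and each error term is at most a multiple of `μ ε ≤ μ
ρ`; the tolerance makes their sum at most `a c ρ / 2`. -/
theorem vol_mem (h : IsPiece ε τ κ ρ0 τ') (hl : SmallLayer μ ε τ η) (hT : Tolerance c a M μ)
    (hr : ProfileData c M a r r1 r2 r3) (hst : InTri s t) :
    a * c * (ρ0 + τ' * s) / 2 ≤ vol κ η r ρ0 τ' s t ∧
      vol κ η r ρ0 τ' s t ≤ 2 * M ^ 2 * (ρ0 + τ' * s) := by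
  have hs : s ∈ Icc (0 : ℝ) 1 := ⟨hst.1.trans hst.2.1, hst.2.2⟩
  have hv := h.abs_vol_sub hl hT hr hst
  have hρ := h.radius_pos hl hst
  have hρε := (h.radius_mem hl.τ_pos hs).1
  have hc := hT.c_pos
  have ha := hT.a_pos
  have hM := hT.one_le
  have hμ0 : 0 < μ := hl.vers_pos.trans_le hl.vers_le
  have hε := hl.ε_pos
  have e1 : vers η * (ε + τ) ≤ 2 * (μ * ε) := by
    nlinarith [hl.vers_le, hl.vers_mul_le, hl.ε_pos]
  have e2 := hl.τ_sq_le
  have e3 := vers_sq_div_le hl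
  have e4 : 100 * M ^ 2 * (τ ^ 2 + vers η * (ε + τ) + vers η ^ 2 / τ) ≤ 100 * M ^ 2 * (4 * (μ * ε)) :=
    mul_le_mul_of_nonneg_left (by linarith) (by positivity)
  set ρ := ρ0 + τ' * s
  have hmem : ρ ∈ Ioc (0 : ℝ) 1 := hρ
  have e5 : 100 * M ^ 2 * (4 * (μ * ε)) ≤ a * c * ρ / 2 := by
    have : 800 * M ^ 2 * μ * ε ≤ a * c * ρ := mul_le_mul hT.μ_mul_le hρε hε.le (by positivity)
    linarith
  have r1l := hr.deriv_lower ρ hmem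
  have r1u := hr.deriv_upper ρ hmem
  have rl := hr.lower ρ hmem
  have ru := hr.le_M ρ hmem
  have f1 : a * c * ρ ≤ r ρ * r1 ρ := by
    have : c * (a * ρ) ≤ r ρ * r1 ρ := mul_le_mul rl r1l (mul_nonneg ha.le hρ.1.le) (by linarith)
    linarith
  have f2 : r ρ * r1 ρ ≤ M ^ 2 * ρ := by
    have : r ρ * r1 ρ ≤ M * (M * ρ) :=
      mul_le_mul ru r1u (le_trans (mul_nonneg ha.le hρ.1.le) r1l) (by linarith)
    linarith
  have := abs_le.1 hv
  constructor <;> linarith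

theorem vol_id_mem (h : IsPiece ε τ κ ρ0 τ') (hl : SmallLayer μ ε τ η) (hμ : μ ≤ 1 / 1000)
    (hst : InTri s t) : (ρ0 + τ' * s) / 2 ≤ vol κ η id ρ0 τ' s t ∧
      vol κ η id ρ0 τ' s t ≤ 2 * (ρ0 + τ' * s) := by
  rw [vol_id (h.ne_zero hl.τ_pos) hl.halfSin_pos.ne']; exact h.jac_mem hl hμ hst

theorem vol_id_pos (h : IsPiece ε τ κ ρ0 τ') (hl : SmallLayer μ ε τ η) (hμ : μ ≤ 1 / 1000)
    (hst : InTri s t) : 0 < vol κ η id ρ0 τ' s t := by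
  linarith [(h.vol_id_mem hl hμ hst).1, (h.radius_pos hl hst).1]

theorem vol_pos (h : IsPiece ε τ κ ρ0 τ') (hl : SmallLayer μ ε τ η) (hT : Tolerance c a M μ)
    (hr : ProfileData c M a r r1 r2 r3) (hst : InTri s t) : 0 < vol κ η r ρ0 τ' s t := by
  have h1 := (h.radius_pos hl hst).1
  have := hT.c_pos
  have := hT.a_pos
  have h2 : 0 < a * c * (ρ0 + τ' * s) / 2 := by positivity
  exact h2.trans_le (h.vol_mem hl hT hr hst).1

theorem abs_frob_sub (h : IsPiece ε τ κ ρ0 τ') (hl : SmallLayer μ ε τ η) (hT : Tolerance c a M μ)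
    (hr : ProfileData c M a r r1 r2 r3) (hst : InTri s t) {H : ℝ} (hkH : vers η ≤ H)
    (hwH : vers η ^ 2 / τ ≤ H) (hτH : τ ^ 2 ≤ H) :
    |frob κ η r ρ0 τ' s t - (r (ρ0 + τ' * s) ^ 2 + (ρ0 + τ' * s) ^ 2 * r1 (ρ0 + τ' * s) ^ 2)| ≤
      400000 * M ^ 4 * H := by
  have hs : s ∈ Icc (0 : ℝ) 1 := ⟨hst.1.trans hst.2.1, hst.2.2⟩
  have hτ' := h.ne_zero hl.τ_pos
  have hσ := hl.halfSin_pos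
  have hρ := h.radius_pos hl hst
  have hf := h.radius_one_mem hl.τ_pos
  rw [frob, normXs_eq r hτ', normYs_eq r hτ' hσ.ne', normYt_eq r hσ.ne', pieceXt_eq r hτ',
    normXs_id hτ', normYs_id hτ' hσ.ne', normYt_id hσ.ne', pieceXt_id hτ']
  refine (h.shapeBounds hl hT.μ_le hst).abs_frobNum_sub (h.profileBounds hl hT hr hs) hσ
    (halfSin_sq η) ?_ ?_ hkH hwH hτH ?_ (v := 1 - s) (by ring) ?_ ?_
  · rw [abs_of_pos (hl.ε_pos.trans_le hf.1)]; exact hf.2.trans hl.le_one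
  · rw [abs_of_pos hρ.1]; exact hρ.2
  · have := vers_sq_div_le hl
    have hε1 : ε ≤ 1 := by linarith [hl.le_one, hl.τ_pos]
    have := hT.μ_le
    nlinarith [hl.ε_pos]
  · rw [abs_of_nonneg (by linarith [hs.2])]; linarith [hs.1]
  · field_simp; ring

theorem exists_abs_density_sub_le {ω p : ℝ} {g : ℝ → ℝ} (hp : 1 < p) (hp2 : p < 2)
    (hω : 0 < ω) (hg : IsVolumetricEnergy g) (hc : 0 < c) (ha : 0 < a) (hM : 1 ≤ M) :
    ∃ K : ℝ, 0 ≤ K ∧ ∀ {μ ε τ η H : ℝ} {κ : Bool} {ρ0 τ' s t : ℝ} {r r1 r2 r3 : ℝ → ℝ},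
      IsPiece ε τ κ ρ0 τ' → SmallLayer μ ε τ η → Tolerance c a M μ →
      ProfileData c M a r r1 r2 r3 → InTri s t → vers η ≤ H → vers η ^ 2 / τ ≤ H → τ ^ 2 ≤ H →
      |density ω p g κ η r ρ0 τ' s t
        - radialDensity ω p g (r1 (ρ0 + τ' * s)) (r (ρ0 + τ' * s)) (ρ0 + τ' * s) * (ρ0 + τ' * s)|
      ≤ K * H * ((ρ0 + τ' * s + (ρ0 + τ')) * (ρ0 + τ' * s) ^ (-p)) := by
  obtain ⟨K, hK, key⟩ := exists_density_diff_le (K₁ := 400000 * M ^ 4) hp hp2 hω hg hc ha hM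
    (by positivity)
  refine ⟨K, hK, fun {μ ε τ η H κ ρ0 τ' s t r r1 r2 r3} h hl hT hr hst hkH hwH hτH => ?_⟩
  have hρ := h.radius_pos hl hst
  have hf := h.radius_one_mem hl.τ_pos
  have hf0 := hl.ε_pos.trans_le hf.1
  have hj := h.vol_id_mem hl hT.μ_le hst
  have hv := h.vol_mem hl hT hr hst
  have hH : 0 < H := hl.vers_pos.trans_le hkH
  have hM4 : 1 ≤ M ^ 4 := one_le_pow₀ hM
  have hM2 : M ^ 2 ≤ M ^ 4 := pow_le_pow_right₀ hM (by norm_num)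
  refine key H (ρ0 + τ' * s + (ρ0 + τ')) _ _ _ _ _ _ hH.le hρ.1 hρ.2 (by linarith)
    (hr.lower _ hρ) (hr.le_M _ hρ) (hr.deriv_lower _ hρ) (hr.deriv_upper _ hρ) ?_ hj.1 hj.2 ?_
    hv.1 hv.2 (frob_nonneg r) (h.abs_frob_sub hl hT hr hst hkH hwH hτH)
  · rw [vol_id (h.ne_zero hl.τ_pos) hl.halfSin_pos.ne']
    refine (h.abs_jac_sub hl (hT.μ_le.trans (by norm_num)) hst).trans ?_
    refine mul_le_mul_of_nonneg_right ?_ (by linarith)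
    nlinarith
  · refine (h.abs_vol_sub hl hT hr hst).trans ?_
    have : vers η * (ε + τ) ≤ H :=
      (mul_le_of_le_one_right hl.vers_pos.le hl.le_one).trans hkH
    have h2 : τ ^ 2 + vers η * (ε + τ) + vers η ^ 2 / τ ≤ 3 * H := by linarith
    have h3 : M ^ 2 * H ≤ M ^ 4 * H := mul_le_mul_of_nonneg_right hM2 hH.le
    have h4 : 100 * M ^ 2 * (τ ^ 2 + vers η * (ε + τ) + vers η ^ 2 / τ) ≤ 100 * M ^ 2 * (3 * H) :=
      mul_le_mul_of_nonneg_left h2 (by positivity)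
    have : 0 < M ^ 4 * H := by positivity
    linarith

end IsPiece

/-! ### Linear maps of the plane -/

/-- The linear map of the plane with the matrix `((a, b), (c, d))`. -/
def linMap (a b c d : ℝ) : Plane →L[ℝ] Plane := Matrix.toEuclideanCLM (𝕜 := ℝ) !![a, b; c, d]

theorem linMap_apply (a b c d : ℝ) (x : Plane) :
    linMap a b c d x = !₂[a * x 0 + b * x 1, c * x 0 + d * x 1] := by
  ext i
  rw [linMap, Matrix.ofLp_toEuclideanCLM]
  fin_cases i <;> simp [Matrix.mulVec, dotProduct, Fin.sum_univ_two]

theorem linMap_eq (A : Plane →L[ℝ] Plane) :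
    A = linMap (A (EuclideanSpace.single 0 1) 0) (A (EuclideanSpace.single 1 1) 0)
      (A (EuclideanSpace.single 0 1) 1) (A (EuclideanSpace.single 1 1) 1) := by
  ext x i
  have hx : x = x 0 • EuclideanSpace.single 0 1 + x 1 • EuclideanSpace.single 1 1 := by
    ext j; fin_cases j <;> simp
  rw [linMap_apply]
  conv_lhs => rw [hx]
  rw [map_add, map_smul, map_smul]
  fin_cases i <;> simp <;> ring

theorem det_linMap (a b c d : ℝ) : (linMap a b c d).det = a * d - b * c := by
  have : (linMap a b c d : Plane →ₗ[ℝ] Plane)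
      = Matrix.toLin (EuclideanSpace.basisFun (Fin 2) ℝ).toBasis
        (EuclideanSpace.basisFun (Fin 2) ℝ).toBasis !![a, b; c, d] := by
    rw [linMap, Matrix.coe_toEuclideanCLM_eq_toEuclideanLin,
      Matrix.toEuclideanLin_eq_toLin_orthonormal]
  rw [ContinuousLinearMap.det, this, LinearMap.det_toLin, Matrix.det_fin_two_of]

theorem frobeniusNorm_linMap (a b c d : ℝ) :
    frobeniusNorm (linMap a b c d) = √(a ^ 2 + b ^ 2 + c ^ 2 + d ^ 2) := by
  rw [frobeniusNorm]
  congr 1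
  simp only [Fin.sum_univ_two, linMap_apply]
  simp
  ring

theorem linMap_comp (a b c d a' b' c' d' : ℝ) : (linMap a b c d).comp (linMap a' b' c' d')
    = linMap (a * a' + b * c') (a * b' + b * d') (c * a' + d * c') (c * b' + d * d') := by
  ext x i
  rw [ContinuousLinearMap.comp_apply, linMap_apply, linMap_apply, linMap_apply]
  fin_cases i <;> simp <;> ring

theorem linMap_inj {a b c d a' b' c' d' : ℝ} (h : linMap a b c d = linMap a' b' c' d') :
    a = a' ∧ b = b' ∧ c = c' ∧ d = d' := by
  have h0 := congrArg (fun A : Plane →L[ℝ] Plane => A (EuclideanSpace.single 0 1)) h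
  have h1 := congrArg (fun A : Plane →L[ℝ] Plane => A (EuclideanSpace.single 1 1)) h
  simp only [linMap_apply] at h0 h1
  have h00 := congrArg (fun x : Plane => x 0) h0
  have h01 := congrArg (fun x : Plane => x 1) h0
  have h10 := congrArg (fun x : Plane => x 0) h1
  have h11 := congrArg (fun x : Plane => x 1) h1
  simp at h00 h01 h10 h11
  exact ⟨h00, h10, h01, h11⟩

/-- From `D A = B` follows `D det A = B adj A`; taking norms avoids inverting `A`. -/
theorem frobeniusNorm_mul_sq {D : Plane →L[ℝ] Plane} {a b c d a' b' c' d' : ℝ}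
    (h : D.comp (linMap a b c d) = linMap a' b' c' d') :
    frobeniusNorm D ^ 2 * (a * d - b * c) ^ 2 = (a' ^ 2 + c' ^ 2) * (b ^ 2 + d ^ 2)
      - 2 * (a' * b' + c' * d') * (a * b + c * d) + (b' ^ 2 + d' ^ 2) * (a ^ 2 + c ^ 2) := by
  rw [linMap_eq D, linMap_comp] at h
  rw [linMap_eq D, frobeniusNorm_linMap, Real.sq_sqrt (by positivity)]
  obtain ⟨rfl, rfl, rfl, rfl⟩ := linMap_inj h
  ring

/-! ### The derivative of a map in a parametrisation -/

/-- Near `Ψ x` the map `w` is `Φ` composed with the local inverse of `Ψ` from the inverse function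
theorem. -/
theorem exists_hasFDerivAt_of_param {E : Type*} [NormedAddCommGroup E] [NormedSpace ℝ E]
    [FiniteDimensional ℝ E] {Ψ Φ w : E → E} {A B : E →L[ℝ] E} {x : E} {U : Set E} (hU : U ∈ 𝓝 x)
    (hΨ : HasStrictFDerivAt Ψ A x) (hA : A.det ≠ 0) (hΦ : HasFDerivAt Φ B x)
    (hw : ∀ y ∈ U, w (Ψ y) = Φ y) : ∃ D : E →L[ℝ] E, HasFDerivAt w D (Ψ x) ∧ D.comp A = B := by
  have : CompleteSpace E := FiniteDimensional.complete ℝ E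
  set A' : E ≃L[ℝ] E := A.toContinuousLinearEquivOfDetNeZero hA
  have hA' : (A' : E →L[ℝ] E) = A := by ext; rfl
  rw [← hA'] at hΨ
  set G := hΨ.localInverse Ψ A' x
  have hG : HasFDerivAt G (A'.symm : E →L[ℝ] E) (Ψ x) := hΨ.to_localInverse.hasFDerivAt
  have hGx : G (Ψ x) = x := hΨ.localInverse_apply_image
  have hΦ' : HasFDerivAt Φ B (G (Ψ x)) := by rw [hGx]; exact hΦ
  refine ⟨B.comp (A'.symm : E →L[ℝ] E), (hΦ'.comp (Ψ x) hG).congr_of_eventuallyEq ?_, ?_⟩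
  · have h1 : ∀ᶠ y in 𝓝 (Ψ x), Ψ (G y) = y := hΨ.eventually_right_inverse
    have h2 : ∀ᶠ y in 𝓝 (Ψ x), G y ∈ U := hG.continuousAt.eventually_mem (by rw [hGx]; exact hU)
    filter_upwards [h1, h2] with y hy hy'
    rw [Function.comp_apply, ← hw _ hy', hy]
  · rw [← hA']; ext y; simp

/-! ### The element maps on the open reference triangle -/

/-- The midpoint formula expresses any increment through `P` and `Q` at the midpoint, and these tend
to their values at `x` as both ends do; this is strict differentiability. -/
theorem hasStrictFDerivAt_of_mid {F P Q : ℝ → ℝ → ℝ}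
    (hF : ∀ s t s' t', F s' t' - F s t = P ((s + s') / 2) ((t + t') / 2) * (s' - s)
      + Q ((s + s') / 2) ((t + t') / 2) * (t' - t))
    (hP : Continuous fun x : ℝ × ℝ => P x.1 x.2) (hQ : Continuous fun x : ℝ × ℝ => Q x.1 x.2)
    (x : Plane) : HasStrictFDerivAt (fun x : Plane => F (x 0) (x 1))
      (P (x 0) (x 1) • (EuclideanSpace.proj 0 : Plane →L[ℝ] ℝ)
        + Q (x 0) (x 1) • (EuclideanSpace.proj 1 : Plane →L[ℝ] ℝ)) x := by
  have hc : ∀ {P : ℝ → ℝ → ℝ}, Continuous (fun x : ℝ × ℝ => P x.1 x.2) →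
      (fun p : Plane × Plane => P ((p.2 0 + p.1 0) / 2) ((p.2 1 + p.1 1) / 2) - P (x 0) (x 1))
        =o[𝓝 (x, x)] (fun _ => (1 : ℝ)) := by
    intro P hP
    rw [Asymptotics.isLittleO_one_iff]
    have h2 : Continuous fun p : Plane × Plane =>
        P ((p.2 0 + p.1 0) / 2) ((p.2 1 + p.1 1) / 2) - P (x 0) (x 1) :=
      (hP.comp (f := fun p : Plane × Plane => ((p.2 0 + p.1 0) / 2, (p.2 1 + p.1 1) / 2))
        (by fun_prop)).sub continuous_const
    have := h2.tendsto (x, x)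
    simpa using this
  have hO : ∀ i : Fin 2, (fun p : Plane × Plane => p.1 i - p.2 i) =O[𝓝 (x, x)]
      (fun p => ‖p.1 - p.2‖) := fun i => Asymptotics.isBigO_of_le _ fun p => by
    simpa using PiLp.norm_apply_le (p.1 - p.2) i
  refine HasStrictFDerivAt.of_isLittleO ?_
  have h := ((hc hP).mul_isBigO (hO 0)).add ((hc hQ).mul_isBigO (hO 1))
  simp only [one_mul] at h
  refine (h.congr_left fun p => ?_).of_norm_right
  have := hF (p.2 0) (p.2 1) (p.1 0) (p.1 1)
  simp
  linarith


def pieceMap (κ : Bool) (η : ℝ) (f : ℝ → ℝ) (ρ0 τ' φ o : ℝ) (x : Plane) : Plane :=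
  piecePt κ η f ρ0 τ' φ o (x 0) (x 1)

def pieceDeriv (κ : Bool) (η : ℝ) (f : ℝ → ℝ) (ρ0 τ' φ o : ℝ) (x : Plane) : Plane →L[ℝ] Plane :=
  linMap
    (Real.cos φ * pieceXs κ η f ρ0 τ' (x 0) (x 1) - o * Real.sin φ * pieceYs κ η f ρ0 τ' (x 1))
    (Real.cos φ * pieceXt κ η f ρ0 τ' (x 0) (x 1) - o * Real.sin φ * pieceYt κ η f ρ0 τ' (x 0) (x 1))
    (Real.sin φ * pieceXs κ η f ρ0 τ' (x 0) (x 1) + o * Real.cos φ * pieceYs κ η f ρ0 τ' (x 1))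
    (Real.sin φ * pieceXt κ η f ρ0 τ' (x 0) (x 1) + o * Real.cos φ * pieceYt κ η f ρ0 τ' (x 0) (x 1))

section

variable (κ : Bool) (η : ℝ) (f : ℝ → ℝ) (ρ0 τ' φ o : ℝ)

theorem continuous_pieceXs :
    Continuous fun x : ℝ × ℝ => pieceXs κ η f ρ0 τ' x.1 x.2 := by
  cases κ <;> simp only [pieceXs, quadXs, shapeMs, shapeNs, Bool.false_eq_true, if_true,
    if_false] <;> fun_prop

theorem continuous_pieceXt :
    Continuous fun x : ℝ × ℝ => pieceXt κ η f ρ0 τ' x.1 x.2 := by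
  cases κ <;> simp only [pieceXt, quadXt, shapeMt, shapeNt, Bool.false_eq_true, if_true,
    if_false] <;> fun_prop

theorem continuous_pieceYs : Continuous fun x : ℝ × ℝ => pieceYs κ η f ρ0 τ' x.2 := by
  cases κ <;> simp only [pieceYs, quadYs, shapeZs, Bool.false_eq_true, if_true,
    if_false] <;> fun_prop

theorem continuous_pieceYt :
    Continuous fun x : ℝ × ℝ => pieceYt κ η f ρ0 τ' x.1 x.2 := by
  cases κ <;> simp only [pieceYt, quadYt, shapeZt, Bool.false_eq_true, if_true,
    if_false] <;> fun_prop

theorem hasStrictFDerivAt_pieceMap (x : Plane) :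
    HasStrictFDerivAt (pieceMap κ η f ρ0 τ' φ o) (pieceDeriv κ η f ρ0 τ' φ o x) x := by
  have hX := hasStrictFDerivAt_of_mid (F := pieceX κ η f ρ0 τ') (fun s t s' t' =>
    quadX_sub κ (vers η) (f ρ0) (f (ρ0 + τ' / 2)) (f (ρ0 + τ')) s t s' t')
    (P := pieceXs κ η f ρ0 τ') (Q := pieceXt κ η f ρ0 τ')
    (continuous_pieceXs κ η f ρ0 τ') (continuous_pieceXt κ η f ρ0 τ') x
  have hY := hasStrictFDerivAt_of_mid (F := pieceY κ η f ρ0 τ') (fun s t s' t' =>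
    quadY_sub κ (vers η) (halfSin η) (f (ρ0 + τ' / 2)) (f (ρ0 + τ')) s t s' t')
    (P := fun _ t => pieceYs κ η f ρ0 τ' t) (Q := pieceYt κ η f ρ0 τ')
    (continuous_pieceYs κ η f ρ0 τ') (continuous_pieceYt κ η f ρ0 τ') x
  rw [hasStrictFDerivAt_euclidean]
  intro i
  fin_cases i
  · refine ((hX.const_mul (Real.cos φ)).sub (hY.const_mul (o * Real.sin φ))).congr_fderiv ?_
    ext y
    simp [pieceDeriv, linMap_apply]
    ring
  · refine ((hX.const_mul (Real.sin φ)).add (hY.const_mul (o * Real.cos φ))).congr_fderiv ?_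
    ext y
    simp [pieceDeriv, linMap_apply]
    ring

theorem det_pieceDeriv {o : ℝ} (ho : o = 1 ∨ o = -1) (hτ' : τ' ≠ 0) (hσ : halfSin η ≠ 0) (x : Plane) :
    (pieceDeriv κ η f ρ0 τ' φ o x).det
      = o * (2 * halfSin η * τ' * IsPiece.vol κ η f ρ0 τ' (x 0) (x 1)) := by
  rw [← IsPiece.det_eq f hτ' hσ, pieceDeriv, det_linMap]
  have := Real.sin_sq_add_cos_sq φ
  rcases ho with rfl | rfl
  · linear_combination (pieceXs κ η f ρ0 τ' (x 0) (x 1) * pieceYt κ η f ρ0 τ' (x 0) (x 1)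
      - pieceXt κ η f ρ0 τ' (x 0) (x 1) * pieceYs κ η f ρ0 τ' (x 1)) * this
  · linear_combination -(pieceXs κ η f ρ0 τ' (x 0) (x 1) * pieceYt κ η f ρ0 τ' (x 0) (x 1)
      - pieceXt κ η f ρ0 τ' (x 0) (x 1) * pieceYs κ η f ρ0 τ' (x 1)) * this

theorem frobeniusNorm_of_pieceDeriv {o : ℝ} (ho : o = 1 ∨ o = -1) (hτ' : τ' ≠ 0)
    (hσ : halfSin η ≠ 0) {x : Plane} (hv : 0 < IsPiece.vol κ η id ρ0 τ' (x 0) (x 1))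
    {D : Plane →L[ℝ] Plane}
    (h : D.comp (pieceDeriv κ η id ρ0 τ' φ o x) = pieceDeriv κ η f ρ0 τ' φ o x) :
    frobeniusNorm D = √(IsPiece.frob κ η f ρ0 τ' (x 0) (x 1))
      / IsPiece.vol κ η id ρ0 τ' (x 0) (x 1) := by
  have h1 := frobeniusNorm_mul_sq h
  have h2 := det_pieceDeriv κ η id ρ0 τ' φ ho hτ' hσ x
  have h3 := IsPiece.frob_eq (κ := κ) (ρ0 := ρ0) (s := x 0) (t := x 1) f hτ' hσ
  rw [pieceDeriv, det_linMap] at h2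
  rw [h2] at h1
  have h5 : (2 * halfSin η * τ') ^ 2 ≠ 0 := by positivity
  have h4 : frobeniusNorm D ^ 2 * (2 * halfSin η * τ') ^ 2 * IsPiece.vol κ η id ρ0 τ' (x 0) (x 1) ^ 2
      = (2 * halfSin η * τ') ^ 2 * IsPiece.frob κ η f ρ0 τ' (x 0) (x 1) := by
    rw [← h3]
    have ho2 : o ^ 2 = 1 := by rcases ho with rfl | rfl <;> norm_num
    have hcs := Real.sin_sq_add_cos_sq φ
    have gram : ∀ a b a' b' : ℝ, (Real.cos φ * a - o * Real.sin φ * b) * (Real.cos φ * a' - o * Real.sin φ * b')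
      + (Real.sin φ * a + o * Real.cos φ * b) * (Real.sin φ * a' + o * Real.cos φ * b') = a * a' + b * b' := by
      intro a b a' b'
      linear_combination (a * a' + o ^ 2 * b * b') * hcs + b * b' * ho2
    have gram2 : ∀ a b : ℝ, (Real.cos φ * a - o * Real.sin φ * b) ^ 2
      + (Real.sin φ * a + o * Real.cos φ * b) ^ 2 = a ^ 2 + b ^ 2 := by
      intro a b
      linear_combination gram a b a b
    rw [gram2, gram2, gram2, gram2, gram, gram] at h1
    rw [← h1]
    linear_combination -(frobeniusNorm D ^ 2 * (2 * halfSin η * τ') ^ 2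
      * IsPiece.vol κ η id ρ0 τ' (x 0) (x 1) ^ 2) * ho2
  have h6 : frobeniusNorm D ^ 2 * IsPiece.vol κ η id ρ0 τ' (x 0) (x 1) ^ 2
      = IsPiece.frob κ η f ρ0 τ' (x 0) (x 1) := by
    apply mul_left_cancel₀ h5; linarith
  have h7 : 0 ≤ frobeniusNorm D := Real.sqrt_nonneg _
  rw [← h6, ← mul_pow, Real.sqrt_sq (by positivity), mul_div_cancel_right₀ _ hv.ne']

end

/-! ### The parameter triangle -/

def openTri : Set Plane := {x | 0 < x 1 ∧ x 1 < x 0 ∧ x 0 < 1}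

def closedTri : Set Plane := {x | InTri (x 0) (x 1)}

theorem openTri_subset : openTri ⊆ closedTri := fun _ hx => ⟨hx.1.le, hx.2.1.le, hx.2.2.le⟩

theorem continuous_coord (i : Fin 2) : Continuous fun x : Plane => x i := by fun_prop

theorem isOpen_openTri : IsOpen openTri :=
  (isOpen_lt continuous_const (continuous_coord 1)).inter
    ((isOpen_lt (continuous_coord 1) (continuous_coord 0)).inter
      (isOpen_lt (continuous_coord 0) continuous_const))

theorem isCompact_closedTri : IsCompact closedTri := by
  refine Metric.isCompact_of_isClosed_isBounded ?_ ?_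
  · exact (isClosed_le continuous_const (continuous_coord 1)).inter
      ((isClosed_le (continuous_coord 1) (continuous_coord 0)).inter
        (isClosed_le (continuous_coord 0) continuous_const))
  · refine (Metric.isBounded_closedBall (x := (0 : Plane)) (r := 2)).subset fun x hx => ?_
    obtain ⟨h1, h2, h3⟩ := hx
    rw [mem_closedBall_zero_iff, EuclideanSpace.norm_eq, Fin.sum_univ_two, Real.sqrt_le_iff]
    refine ⟨by norm_num, ?_⟩
    simp only [Real.norm_eq_abs, sq_abs]
    nlinarith

theorem volume_setOf_eq (L : Plane →L[ℝ] ℝ) (hL : L ≠ 0) (c : ℝ) :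
    volume {x | L x = c} = 0 := by
  obtain ⟨v, hv⟩ : ∃ v, L v ≠ 0 := by
    by_contra! h
    exact hL (ContinuousLinearMap.ext h)
  set p : Plane := (c / L v) • v
  have hp : L p = c := by simp [p, hv]
  have hs : {x | L x = c} = (AffineSubspace.mk' p L.ker : Set Plane) := by
    ext x
    rw [SetLike.mem_coe, AffineSubspace.mem_mk', LinearMap.mem_ker, mem_ofPred_eq, vsub_eq_sub]
    simp [hp, sub_eq_zero]
  rw [hs]
  refine Measure.addHaar_affineSubspace _ _ fun h => ?_
  have h1 : v + p ∈ (⊤ : AffineSubspace ℝ Plane) := AffineSubspace.mem_top _ _ _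
  rw [← h, AffineSubspace.mem_mk', LinearMap.mem_ker] at h1
  exact hv (by simpa using h1)

theorem volume_closedTri_diff : volume (closedTri \ openTri) = 0 := by
  have e0 : (EuclideanSpace.proj 0 : Plane →L[ℝ] ℝ) ≠ 0 := fun h => by
    have := congrArg (fun L : Plane →L[ℝ] ℝ => L (EuclideanSpace.single 0 1)) h
    simp at this
  have e1 : (EuclideanSpace.proj 1 : Plane →L[ℝ] ℝ) ≠ 0 := fun h => by
    have := congrArg (fun L : Plane →L[ℝ] ℝ => L (EuclideanSpace.single 1 1)) h
    simp at this
  have e2 : (EuclideanSpace.proj 0 - EuclideanSpace.proj 1 : Plane →L[ℝ] ℝ) ≠ 0 := fun h => by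
    have := congrArg (fun L : Plane →L[ℝ] ℝ => L (EuclideanSpace.single 1 1)) h
    simp at this
  refine measure_mono_null (fun x hx => ?_) (measure_union_null (volume_setOf_eq _ e1 0)
    (measure_union_null (volume_setOf_eq _ e2 0) (volume_setOf_eq _ e0 1)))
  obtain ⟨⟨h1, h2, h3⟩, h4⟩ := hx
  rcases h1.eq_or_lt with h | h1
  · exact Or.inl h.symm
  rcases h2.eq_or_lt with h | h2
  · exact Or.inr (Or.inl (by simp [h]))
  rcases h3.eq_or_lt with h | h3
  · exact Or.inr (Or.inr h)
  exact absurd ⟨h1, h2, h3⟩ h4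

/-- The slice of the triangle at `s` has length `s`. This weight later absorbs the poor estimate
near the apex of inner pieces. -/
theorem integral_openTri {b : ℝ → ℝ} (hb : ContinuousOn b (Icc 0 1)) :
    ∫ x in openTri, b (x 0) = ∫ s in (0 : ℝ)..1, s * b s := by
  set T : Set (ℝ × ℝ) := {x | 0 < x.2 ∧ x.2 < x.1 ∧ x.1 < 1} with hT
  have hTm : MeasurableSet T := ((isOpen_lt continuous_const continuous_snd).inter
    ((isOpen_lt continuous_snd continuous_fst).inter
      (isOpen_lt continuous_fst continuous_const))).measurableSet
  set e : Plane ≃ᵐ ℝ × ℝ :=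
    (MeasurableEquiv.toLp 2 (Fin 2 → ℝ)).symm.trans (MeasurableEquiv.finTwoArrow (α := ℝ)) with he
  have hmp : MeasurePreserving e volume volume :=
    (volume_preserving_finTwoArrow ℝ).comp
      (EuclideanSpace.volume_preserving_symm_measurableEquiv_toLp (Fin 2))
  have h1 : ∫ x in openTri, b (x 0) = ∫ x in T, b x.1 := by
    rw [← hmp.setIntegral_preimage_emb e.measurableEmbedding]
    rfl
  rw [h1]
  have hsub : T ⊆ Ioo 0 1 ×ˢ Ioo 0 1 := fun x hx =>
    ⟨⟨hx.1.trans hx.2.1, hx.2.2⟩, hx.1, hx.2.1.trans hx.2.2⟩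
  have hint : IntegrableOn (fun x : ℝ × ℝ => b x.1) (Icc (0 : ℝ) 1 ×ˢ Icc (0 : ℝ) 1) := by
    refine ContinuousOn.integrableOn_compact (isCompact_Icc.prod isCompact_Icc) ?_
    exact hb.comp continuousOn_fst fun x hx => hx.1
  have hint2 : IntegrableOn (T.indicator fun x : ℝ × ℝ => b x.1) (Ioo (0 : ℝ) 1 ×ˢ Ioo (0 : ℝ) 1) :=
    (hint.mono_set (prod_mono Ioo_subset_Icc_self Ioo_subset_Icc_self)).indicator hTm
  have h2 : ∫ x in T, b x.1 = ∫ x in Ioo (0 : ℝ) 1 ×ˢ Ioo (0 : ℝ) 1, T.indicator (fun x => b x.1) x := by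
    rw [setIntegral_indicator hTm, inter_eq_right.2 hsub]
  rw [h2, Measure.volume_eq_prod, setIntegral_prod _ hint2, intervalIntegral.integral_of_le zero_le_one,
    integral_Ioc_eq_integral_Ioo]
  refine setIntegral_congr_fun measurableSet_Ioo fun s hs => ?_
  have h3 : ∀ t, T.indicator (fun x : ℝ × ℝ => b x.1) (s, t) = (Ioo 0 s).indicator (fun _ => b s) t := by
    intro t
    by_cases ht : t ∈ Ioo 0 s
    · rw [indicator_of_mem ht, indicator_of_mem (show (s, t) ∈ T from ⟨ht.1, ht.2, hs.2⟩)]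
    · rw [indicator_of_notMem ht, indicator_of_notMem (fun h => ht ⟨h.1, h.2.1⟩)]
  simp only [h3]
  rw [setIntegral_indicator measurableSet_Ioo, Ioo_inter_Ioo, setIntegral_const]
  simp [hs.1.le, hs.2.le]

/-! ### The energy on a piece -/

namespace IsPiece

variable {μ ε τ η : ℝ} {κ : Bool} {ρ0 τ' φ o : ℝ} {c a M : ℝ} {r r1 r2 r3 : ℝ → ℝ}

theorem continuous_vol (κ : Bool) (η : ℝ) (f : ℝ → ℝ) (ρ0 τ' : ℝ) :
    Continuous fun x : Plane => vol κ η f ρ0 τ' (x 0) (x 1) := by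
  have hx : Continuous fun x : Plane => (x 0, x 1) := by fun_prop
  have h1 := (continuous_pieceXs κ η f ρ0 τ').comp hx
  have h2 := (continuous_pieceXt κ η f ρ0 τ').comp hx
  have h3 := (continuous_pieceYs κ η f ρ0 τ').comp hx
  have h4 := (continuous_pieceYt κ η f ρ0 τ').comp hx
  simp only [Function.comp_def] at h1 h2 h3 h4
  unfold vol normXs normYs normYt
  fun_prop

theorem continuous_frob (κ : Bool) (η : ℝ) (f : ℝ → ℝ) (ρ0 τ' : ℝ) :
    Continuous fun x : Plane => frob κ η f ρ0 τ' (x 0) (x 1) := by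
  have hx : Continuous fun x : Plane => (x 0, x 1) := by fun_prop
  have h1 := (continuous_pieceXs κ η f ρ0 τ').comp hx
  have h2 := (continuous_pieceXt κ η f ρ0 τ').comp hx
  have h3 := (continuous_pieceYs κ η f ρ0 τ').comp hx
  have h4 := (continuous_pieceYt κ η f ρ0 τ').comp hx
  have h1' := (continuous_pieceXs κ η id ρ0 τ').comp hx
  have h2' := (continuous_pieceXt κ η id ρ0 τ').comp hx
  have h3' := (continuous_pieceYs κ η id ρ0 τ').comp hx
  have h4' := (continuous_pieceYt κ η id ρ0 τ').comp hx
  simp only [Function.comp_def] at h1 h2 h3 h4 h1' h2' h3' h4'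
  unfold frob ShapeBounds.frobNum normXs normYs normYt
  fun_prop

theorem continuousOn_density (h : IsPiece ε τ κ ρ0 τ') (hl : SmallLayer μ ε τ η)
    (hT : Tolerance c a M μ) (hr : ProfileData c M a r r1 r2 r3) {ω p : ℝ} {g : ℝ → ℝ} (hp : 1 < p)
    (hg : IsVolumetricEnergy g) :
    ContinuousOn (fun x : Plane => density ω p g κ η r ρ0 τ' (x 0) (x 1)) closedTri := by
  have hj : ∀ x ∈ closedTri, vol κ η id ρ0 τ' (x 0) (x 1) ≠ 0 := fun x hx =>
    (h.vol_id_pos hl hT.μ_le hx).ne'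
  have cj := (continuous_vol κ η id ρ0 τ').continuousOn (s := closedTri)
  have cv := (continuous_vol κ η r ρ0 τ').continuousOn (s := closedTri)
  have cf := (continuous_frob κ η r ρ0 τ').continuousOn (s := closedTri)
  have cg := hg.contDiffOn.continuousOn.comp (cv.div cj hj)
    (fun x hx => div_pos (h.vol_pos hl hT hr hx) (h.vol_id_pos hl hT.μ_le hx))
  exact ((continuousOn_const.mul ((cf.sqrt.div cj hj).rpow_const fun _ _ => Or.inr (by linarith))).add
    cg).mul cj

theorem integrableOn_density (h : IsPiece ε τ κ ρ0 τ') (hl : SmallLayer μ ε τ η)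
    (hT : Tolerance c a M μ) (hr : ProfileData c M a r r1 r2 r3) {ω p : ℝ} {g : ℝ → ℝ} (hp : 1 < p)
    (hg : IsVolumetricEnergy g) :
    IntegrableOn (fun x : Plane => density ω p g κ η r ρ0 τ' (x 0) (x 1)) openTri :=
  ((h.continuousOn_density hl hT hr hp hg).integrableOn_compact isCompact_closedTri).mono_set
    openTri_subset

/-- The derivative is `DU DF⁻¹`, so its determinant is a quotient of two positive Jacobians.
Multiplied by the Jacobian of the element map, the stored energy becomes `density` in the
parameters. -/
theorem exists_hasFDerivAt (h : IsPiece ε τ κ ρ0 τ') (hl : SmallLayer μ ε τ η)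
    (hT : Tolerance c a M μ) (hr : ProfileData c M a r r1 r2 r3) (ho : o = 1 ∨ o = -1)
    {w : Plane → Plane}
    (hw : ∀ x ∈ openTri, w (pieceMap κ η id ρ0 τ' φ o x) = pieceMap κ η r ρ0 τ' φ o x)
    {x : Plane} (hx : x ∈ openTri) :
    ∃ D : Plane →L[ℝ] Plane, HasFDerivAt w D (pieceMap κ η id ρ0 τ' φ o x) ∧ 0 < D.det ∧
      ∀ ω p g, |(pieceDeriv κ η id ρ0 τ' φ o x).det| * storedEnergy ω p g D
        = 2 * halfSin η * τ * density ω p g κ η r ρ0 τ' (x 0) (x 1) := by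
  have hτ' := h.ne_zero hl.τ_pos
  have hσ := hl.halfSin_pos
  have hj := h.vol_id_pos hl hT.μ_le (openTri_subset hx)
  have hv := h.vol_pos hl hT hr (openTri_subset hx)
  have ho0 : o ≠ 0 := by rcases ho with rfl | rfl <;> norm_num
  have hdet := det_pieceDeriv κ η id ρ0 τ' φ ho hτ' hσ.ne' x
  have hdet0 : (pieceDeriv κ η id ρ0 τ' φ o x).det ≠ 0 := by rw [hdet]; positivity
  obtain ⟨D, hD, hDA⟩ := exists_hasFDerivAt_of_param (isOpen_openTri.mem_nhds hx)
    (hasStrictFDerivAt_pieceMap κ η id ρ0 τ' φ o x) hdet0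
    (hasStrictFDerivAt_pieceMap κ η r ρ0 τ' φ o x).hasFDerivAt hw
  have hDdet : D.det = vol κ η r ρ0 τ' (x 0) (x 1) / vol κ η id ρ0 τ' (x 0) (x 1) := by
    have h1 : D.det * (pieceDeriv κ η id ρ0 τ' φ o x).det = (pieceDeriv κ η r ρ0 τ' φ o x).det :=
      (LinearMap.det_comp _ _).symm.trans (congrArg ContinuousLinearMap.det hDA)
    rw [hdet, det_pieceDeriv κ η r ρ0 τ' φ ho hτ' hσ.ne' x] at h1
    rw [eq_div_iff hj.ne']
    apply mul_left_cancel₀ (show o * (2 * halfSin η * τ') ≠ 0 by positivity)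
    linarith
  refine ⟨D, hD, by rw [hDdet]; positivity, fun ω p g => ?_⟩
  rw [storedEnergy, hDdet, frobeniusNorm_of_pieceDeriv κ η r ρ0 τ' φ ho hτ' hσ.ne' hj hDA, hdet,
    density]
  have : |o * (2 * halfSin η * τ' * vol κ η id ρ0 τ' (x 0) (x 1))|
      = 2 * halfSin η * τ * vol κ η id ρ0 τ' (x 0) (x 1) := by
    have ho1 : |o| = 1 := by rcases ho with rfl | rfl <;> simp
    rw [abs_mul, ho1, abs_mul, abs_mul, h.abs_eq hl.τ_pos, abs_of_pos hj,
      abs_of_pos (show 0 < 2 * halfSin η by linarith), one_mul]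
  rw [this]
  ring

theorem differentiable_of_mem_image (h : IsPiece ε τ κ ρ0 τ') (hl : SmallLayer μ ε τ η)
    (hT : Tolerance c a M μ) (hr : ProfileData c M a r r1 r2 r3) (ho : o = 1 ∨ o = -1)
    {w : Plane → Plane}
    (hw : ∀ x ∈ openTri, w (pieceMap κ η id ρ0 τ' φ o x) = pieceMap κ η r ρ0 τ' φ o x) {z : Plane}
    (hz : z ∈ pieceMap κ η id ρ0 τ' φ o '' openTri) :
    DifferentiableAt ℝ w z ∧ 0 < (fderiv ℝ w z).det := by
  obtain ⟨x, hx, rfl⟩ := hz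
  obtain ⟨D, hD, hdet, -⟩ := h.exists_hasFDerivAt hl hT hr ho hw hx
  exact ⟨hD.differentiableAt, by rw [hD.fderiv]; exact hdet⟩

theorem measurableSet_image (hinj : InjOn (pieceMap κ η id ρ0 τ' φ o) openTri) :
    MeasurableSet (pieceMap κ η id ρ0 τ' φ o '' openTri) :=
  measurable_image_of_fderivWithin isOpen_openTri.measurableSet (fun x _ =>
    (hasStrictFDerivAt_pieceMap κ η id ρ0 τ' φ o x).hasFDerivAt.hasFDerivWithinAt) hinj

theorem integrableOn_image (h : IsPiece ε τ κ ρ0 τ') (hl : SmallLayer μ ε τ η)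
    (hT : Tolerance c a M μ) (hr : ProfileData c M a r r1 r2 r3) (ho : o = 1 ∨ o = -1)
    {w : Plane → Plane}
    (hw : ∀ x ∈ openTri, w (pieceMap κ η id ρ0 τ' φ o x) = pieceMap κ η r ρ0 τ' φ o x)
    (hinj : InjOn (pieceMap κ η id ρ0 τ' φ o) openTri) {ω p : ℝ} {g : ℝ → ℝ} (hp : 1 < p)
    (hg : IsVolumetricEnergy g) :
    HasFiniteEnergy ω p g w (pieceMap κ η id ρ0 τ' φ o '' openTri) ∧
    energy ω p g w (pieceMap κ η id ρ0 τ' φ o '' openTri)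
      = 2 * halfSin η * τ * ∫ x in openTri, density ω p g κ η r ρ0 τ' (x 0) (x 1) := by
  have hd : ∀ x ∈ openTri, HasFDerivWithinAt (pieceMap κ η id ρ0 τ' φ o)
      (pieceDeriv κ η id ρ0 τ' φ o x) openTri x := fun x _ =>
    (hasStrictFDerivAt_pieceMap κ η id ρ0 τ' φ o x).hasFDerivAt.hasFDerivWithinAt
  have hm := isOpen_openTri.measurableSet
  have heq : EqOn (fun x => |(pieceDeriv κ η id ρ0 τ' φ o x).det| •
        storedEnergy ω p g (fderiv ℝ w (pieceMap κ η id ρ0 τ' φ o x)))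
      (fun x => 2 * halfSin η * τ * density ω p g κ η r ρ0 τ' (x 0) (x 1)) openTri := by
    intro x hx
    obtain ⟨D, hD, -, he⟩ := h.exists_hasFDerivAt hl hT hr ho hw hx
    simp only [hD.fderiv, smul_eq_mul, he]
  constructor
  · rw [HasFiniteEnergy, integrableOn_image_iff_integrableOn_abs_det_fderiv_smul volume hm hd hinj,
      integrableOn_congr_fun heq hm]
    exact (h.integrableOn_density hl hT hr hp hg).const_mul _
  · rw [energy, integral_image_eq_integral_abs_det_fderiv_smul volume hm hd hinj,
      setIntegral_congr_fun hm heq, integral_const_mul]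

end IsPiece

/-- The difference is contained in the differentiable image of the three sides, a null set. -/
theorem volume_pieceMap_image {κ : Bool} {η : ℝ} {f : ℝ → ℝ} {ρ0 τ' φ o : ℝ} :
    volume (pieceMap κ η f ρ0 τ' φ o '' closedTri \ pieceMap κ η f ρ0 τ' φ o '' openTri) = 0 := by
  refine measure_mono_null (t := pieceMap κ η f ρ0 τ' φ o '' (closedTri \ openTri)) ?_
    (addHaar_image_eq_zero_of_differentiableOn_of_addHaar_eq_zero volume ?_ volume_closedTri_diff)
  · rintro z ⟨⟨x, hx, rfl⟩, hn⟩
    exact ⟨x, ⟨hx, fun h => hn ⟨x, h, rfl⟩⟩, rfl⟩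
  · exact fun x _ => (hasStrictFDerivAt_pieceMap κ η f ρ0 τ' φ o x).hasFDerivAt.differentiableAt
      |>.differentiableWithinAt

/-! ### The energy on the layers of a mesh -/

def sgn (β : Bool) : ℝ := if β then 1 else -1

theorem sgn_eq (β : Bool) : sgn β = 1 ∨ sgn β = -1 := by cases β <;> simp [sgn]

theorem sgn_neg_eq (β : Bool) : -sgn β = 1 ∨ -sgn β = -1 := by cases β <;> simp [sgn]

theorem sgn_injective : Function.Injective sgn := by
  intro β β' h; cases β <;> cases β' <;> simp [sgn] at h ⊢ <;> norm_num at h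

namespace RingMesh

variable {μ : ℝ} {m : ℕ} {ε τ η : ℕ → ℝ} {N : ℕ → ℕ} {κ : ℕ → Bool} {ψ : ℕ → ℝ}

/-- The element map on the lower (`γ = false`) or upper part of a sector. -/
def cellMap (ε τ η : ℕ → ℝ) (κ : ℕ → Bool) (ψ : ℕ → ℝ) (f : ℝ → ℝ) (i j : ℕ) (β γ : Bool) :
    Plane → Plane :=
  pieceMap (if γ then κ i else false) (η i) f (if γ then ε i + τ i else ε i)
    (if γ then -τ i else τ i) (if γ then ψ i + 2 * (j : ℤ) * η i + sgn β * η i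
      else ψ i + 2 * (j : ℤ) * η i) (if γ then -sgn β else sgn β)

/-- The interior of the lower or upper part of a sector. -/
def cell (ε τ η : ℕ → ℝ) (κ : ℕ → Bool) (ψ : ℕ → ℝ) (q : Σ _ : ℕ, ℕ × Bool × Bool) : Set Plane :=
  cellMap ε τ η κ ψ id q.1 q.2.1 q.2.2.1 q.2.2.2 '' openTri

def cells (N : ℕ → ℕ) (T : Finset ℕ) : Finset (Σ _ : ℕ, ℕ × Bool × Bool) :=
  T.sigma fun i => Finset.range (N i) ×ˢ (Finset.univ ×ˢ Finset.univ)

theorem cellMap_eq_pt (f : ℝ → ℝ) (i j : ℕ) (β γ : Bool) {x : Plane} (hx : x ∈ closedTri) :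
    cellMap ε τ η κ ψ f i j β γ x = pt ε τ η κ ψ f i j (sgn β) (if γ then 1 - x 0 else x 0)
      (if γ then 1 - x 1 else x 1) := by
  cases γ
  · simp only [cellMap, pieceMap, pt, Bool.false_eq_true, if_false]
    rw [secPt, if_pos hx.2.1]
  · simp only [cellMap, pieceMap, pt, if_true]
    rw [secPt_upper _ _ _ _ _ _ (sgn_eq β) (by linarith [hx.2.1])]
    simp

theorem param_mem (γ : Bool) {x : Plane} (hx : x ∈ closedTri) :
    (if γ then 1 - x 0 else x 0) ∈ Icc (0 : ℝ) 1 ∧ (if γ then 1 - x 1 else x 1) ∈ Icc (0 : ℝ) 1 := by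
  obtain ⟨h1, h2, h3⟩ := hx
  cases γ <;> simp <;> refine ⟨⟨?_, ?_⟩, ?_, ?_⟩ <;> linarith

/-- Interior parameters avoid all shared curves, so `pt_congr` identifies the sector up to a full
turn; the range of `j` removes the turn, and the side of the diagonal determines `γ`. -/
theorem cellMap_congr (hM : RingMesh μ m ε τ η N κ ψ) {i i' j j' : ℕ} {β β' γ γ' : Bool}
    (hi : i ≤ m) (hi' : i' ≤ m) (hj : j < N i) (hj' : j' < N i') {x x' : Plane} (hx : x ∈ openTri)
    (hx' : x' ∈ openTri)
    (h : cellMap ε τ η κ ψ id i j β γ x = cellMap ε τ η κ ψ id i' j' β' γ' x') :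
    i = i' ∧ j = j' ∧ β = β' ∧ γ = γ' ∧ x = x' := by
  rw [cellMap_eq_pt _ _ _ _ _ (openTri_subset hx), cellMap_eq_pt _ _ _ _ _ (openTri_subset hx')] at h
  obtain ⟨m1, m2⟩ := param_mem γ (openTri_subset hx)
  obtain ⟨m1', m2'⟩ := param_mem γ' (openTri_subset hx')
  obtain ⟨h1, h2, h3⟩ := hx
  obtain ⟨h1', h2', h3'⟩ := hx'
  obtain ⟨rfl, e2, e3, e4, n, hn⟩ := (hM.pt_congr hi hi' (sgn_eq β) (sgn_eq β') m1 m2 m1' m2' h).2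
    (by cases γ <;> simp <;> linarith) (by cases γ <;> simp <;> linarith)
    (by cases γ <;> simp <;> linarith) (by cases γ <;> simp <;> linarith)
  have hjj : j = j' := by
    have a1 : (j : ℤ) < N i := by exact_mod_cast hj
    have a2 : (j' : ℤ) < N i := by exact_mod_cast hj'
    have : n = 0 := by
      have b1 : n < 1 := by by_contra hh; nlinarith
      have b2 : -1 < n := by by_contra hh; nlinarith
      omega
    rw [this] at hn; omega
  refine ⟨rfl, hjj, sgn_injective e4, ?_⟩
  have ext : ∀ {x x' : Plane}, x 0 = x' 0 → x 1 = x' 1 → x = x' := by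
    intro x x' h0 h1; ext k; fin_cases k
    · exact h0
    · exact h1
  cases γ <;> cases γ' <;> simp at e2 e3 ⊢
  · exact ext e2 e3
  · linarith
  · linarith
  · exact ext e2 e3

theorem injOn_cellMap (hM : RingMesh μ m ε τ η N κ ψ) {i j : ℕ} (β γ : Bool) (hi : i ≤ m)
    (hj : j < N i) : InjOn (cellMap ε τ η κ ψ id i j β γ) openTri := fun _ hx _ hx' h =>
  (hM.cellMap_congr hi hi hj hj hx hx' h).2.2.2.2

theorem mem_cells {T : Finset ℕ} {q : Σ _ : ℕ, ℕ × Bool × Bool} :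
    q ∈ cells N T ↔ q.1 ∈ T ∧ q.2.1 < N q.1 := by
  simp [cells]

theorem pairwiseDisjoint_cell (hM : RingMesh μ m ε τ η N κ ψ) {T : Finset ℕ} (hT : ∀ i ∈ T, i ≤ m) :
    (cells N T : Set (Σ _ : ℕ, ℕ × Bool × Bool)).PairwiseDisjoint (cell ε τ η κ ψ) := by
  rintro ⟨i, j, β, γ⟩ hq ⟨i', j', β', γ'⟩ hq' hne
  rw [Finset.mem_coe, mem_cells] at hq hq'
  refine Set.disjoint_left.2 ?_
  rintro _ ⟨x, hx, rfl⟩ ⟨x', hx', h⟩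
  obtain ⟨rfl, rfl, rfl, rfl, -⟩ := hM.cellMap_congr (hT _ hq'.1) (hT _ hq.1) hq'.2 hq.2 hx' hx h
  exact hne rfl

/-- The elements of the layers with index in `T`. -/
def layers (ε τ : ℕ → ℝ) (N : ℕ → ℕ) (κ : ℕ → Bool) (ψ : ℕ → ℝ) (T : Finset ℕ) : Set Element :=
  {E | ∃ i ∈ T, E ∈ layerElems (κ i) (ε i) (τ i) (N i) (ψ i)}

/-- Open pieces lie in the region and closed pieces cover it, so the two sets differ by images of
edges only. -/
theorem region_ae_eq (hM : RingMesh μ m ε τ η N κ ψ) {T : Finset ℕ} (hT : ∀ i ∈ T, i ≤ m) :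
    region (layers ε τ N κ ψ T) =ᵐ[volume] ⋃ q ∈ cells N T, cell ε τ η κ ψ q := by
  have hsub : (⋃ q ∈ cells N T, cell ε τ η κ ψ q) ⊆ region (layers ε τ N κ ψ T) := by
    refine iUnion₂_subset ?_
    rintro ⟨i, j, β, γ⟩ hq
    rw [mem_cells] at hq
    rintro _ ⟨x, hx, rfl⟩
    obtain ⟨m1, m2⟩ := param_mem γ (openTri_subset hx)
    obtain ⟨E, hE, y, hy, h⟩ := hM.exists_elem_of_pt (hT _ hq.1) j (sgn_eq β) m1 m2
    refine mem_iUnion₂.2 ⟨E, ⟨i, hq.1, hE⟩, y, hy, ?_⟩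
    simp only
    rw [cellMap_eq_pt _ _ _ _ _ (openTri_subset hx), ← h id id isRadial_id]
    rfl
  have hsup : region (layers ε τ N κ ψ T) ⊆ ⋃ q ∈ cells N T,
      cellMap ε τ η κ ψ id q.1 q.2.1 q.2.2.1 q.2.2.2 '' closedTri := by
    refine iUnion₂_subset ?_
    rintro E ⟨i, hi, hE⟩ _ ⟨y, hy, rfl⟩
    have him := hT i hi
    obtain ⟨j, o, s, t, ho, hs, ht, h⟩ := hM.exists_pt_of_elem him hE hy
    obtain ⟨j', hj', n, hn⟩ := exists_int_mod (hM.N_pos i him) j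
    obtain ⟨β, rfl⟩ : ∃ β, o = sgn β := by
      rcases ho with rfl | rfl
      · exact ⟨true, rfl⟩
      · exact ⟨false, rfl⟩
    have hNη : (N i : ℝ) * η i = Real.pi := by
      have := hM.N_pos i him
      rw [← hM.η_eq i him]; field_simp
    have hz : E.map y = pt ε τ η κ ψ id i j' (sgn β) s t := by
      have h1 : E.map y = _ := h id id isRadial_id
      rw [h1, pt, pt, ← secPt_add_int_mul_two_pi _ _ _ _ _ (ψ i + 2 * ((j' : ℤ) : ℝ) * η i) _ _ _ n]
      congr 1
      rw [hn, ← hNη]; push_cast; ring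
    rw [hz]
    refine mem_iUnion₂.2 ⟨⟨i, j', β, decide (s < t)⟩, mem_cells.2 ⟨hi, hj'⟩, ?_⟩
    by_cases hst : s < t
    · have hx : (!₂[1 - s, 1 - t] : Plane) ∈ closedTri :=
        ⟨by simp [ht.2], by simp; linarith, by simp [hs.1]⟩
      refine ⟨_, hx, ?_⟩
      rw [cellMap_eq_pt _ _ _ _ _ hx]
      simp [hst]
    · have hx : (!₂[s, t] : Plane) ∈ closedTri :=
        ⟨by simp [ht.1], by simp [not_lt.1 hst], by simp [hs.2]⟩
      refine ⟨_, hx, ?_⟩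
      rw [cellMap_eq_pt _ _ _ _ _ hx]
      simp [hst]
  refine ae_eq_set.2 ⟨?_, by rw [sdiff_eq_empty.2 hsub, measure_empty]⟩
  refine measure_mono_null (t := ⋃ q ∈ cells N T,
    (cellMap ε τ η κ ψ id q.1 q.2.1 q.2.2.1 q.2.2.2 '' closedTri \ cell ε τ η κ ψ q)) ?_ ?_
  · rintro z ⟨hz, hz'⟩
    obtain ⟨q, hq, hzq⟩ := mem_iUnion₂.1 (hsup hz)
    exact mem_iUnion₂.2 ⟨q, hq, hzq, fun h => hz' (mem_iUnion₂.2 ⟨q, hq, h⟩)⟩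
  · refine (measure_biUnion_null_iff (cells N T).countable_toSet).2 ?_
    exact fun q _ => volume_pieceMap_image

variable {c a M : ℝ} {r r1 r2 r3 : ℝ → ℝ}

/-- The integral of the energy density over a piece, in its parameters. -/
def _root_.Cavity.pieceEnergy (ω p : ℝ) (g : ℝ → ℝ) (κ : Bool) (η : ℝ) (f : ℝ → ℝ) (ρ0 τ' : ℝ) : ℝ :=
  ∫ x in openTri, IsPiece.density ω p g κ η f ρ0 τ' (x 0) (x 1)

/-- A layer has `2 N` sectors, each made of an inner and an outer piece; `2 σ τ` is the constant
factor of the Jacobians. -/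
def layerEnergy (ε τ η : ℕ → ℝ) (N : ℕ → ℕ) (κ : ℕ → Bool) (ω p : ℝ) (g : ℝ → ℝ) (f : ℝ → ℝ)
    (i : ℕ) : ℝ :=
  2 * N i * (2 * halfSin (η i) * τ i) * (pieceEnergy ω p g false (η i) f (ε i) (τ i)
    + pieceEnergy ω p g (κ i) (η i) f (ε i + τ i) (-τ i))

/-- `w` is the interpolant of the radial map with the profile `r`. -/
def Interpolates (m : ℕ) (ε τ η : ℕ → ℝ) (κ : ℕ → Bool) (ψ : ℕ → ℝ) (r : ℝ → ℝ)
    (w : Plane → Plane) : Prop :=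
  ∀ i ≤ m, ∀ (j : ℤ) (o s t : ℝ), (o = 1 ∨ o = -1) → s ∈ Icc (0 : ℝ) 1 → t ∈ Icc (0 : ℝ) 1 →
    w (pt ε τ η κ ψ id i j o s t) = pt ε τ η κ ψ r i j o s t

variable {w : Plane → Plane} {T : Finset ℕ}

theorem isPiece_cell (i : ℕ) (γ : Bool) : IsPiece (ε i) (τ i) (if γ then κ i else false)
    (if γ then ε i + τ i else ε i) (if γ then -τ i else τ i) := by
  cases γ
  · exact isPiece_lower _ _
  · exact isPiece_upper _ _ _

theorem side_cell (β γ : Bool) :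
    (if γ then -sgn β else sgn β) = 1 ∨ (if γ then -sgn β else sgn β) = -1 := by
  cases γ
  · exact sgn_eq β
  · exact sgn_neg_eq β

theorem Interpolates.eq_cellMap (hw : Interpolates m ε τ η κ ψ r w) {i : ℕ} (hi : i ≤ m) (j : ℕ)
    (β γ : Bool) {x : Plane} (hx : x ∈ openTri) :
    w (cellMap ε τ η κ ψ id i j β γ x) = cellMap ε τ η κ ψ r i j β γ x := by
  obtain ⟨m1, m2⟩ := param_mem γ (openTri_subset hx)
  rw [cellMap_eq_pt _ _ _ _ _ (openTri_subset hx), cellMap_eq_pt _ _ _ _ _ (openTri_subset hx),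
    hw i hi j _ _ _ (sgn_eq β) m1 m2]

theorem measurableSet_cell (hM : RingMesh μ m ε τ η N κ ψ) (hTm : ∀ i ∈ T, i ≤ m)
    {q : Σ _ : ℕ, ℕ × Bool × Bool} (hq : q ∈ cells N T) : MeasurableSet (cell ε τ η κ ψ q) := by
  rw [mem_cells] at hq
  exact IsPiece.measurableSet_image (hM.injOn_cellMap _ _ (hTm _ hq.1) hq.2)

theorem energy_cell (hM : RingMesh μ m ε τ η N κ ψ) (hT : Tolerance c a M μ)
    (hr : ProfileData c M a r r1 r2 r3) (hw : Interpolates m ε τ η κ ψ r w) {ω p : ℝ} {g : ℝ → ℝ}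
    (hp : 1 < p) (hg : IsVolumetricEnergy g) {i j : ℕ} (β γ : Bool) (hi : i ≤ m) (hj : j < N i) :
    HasFiniteEnergy ω p g w (cell ε τ η κ ψ ⟨i, j, β, γ⟩) ∧
    energy ω p g w (cell ε τ η κ ψ ⟨i, j, β, γ⟩) = 2 * halfSin (η i) * τ i *
      pieceEnergy ω p g (if γ then κ i else false) (η i) r (if γ then ε i + τ i else ε i)
        (if γ then -τ i else τ i) :=
  (isPiece_cell i γ).integrableOn_image (hM.small i hi) hT hr (side_cell β γ)
    (fun _ hx => hw.eq_cellMap hi j β γ hx) (hM.injOn_cellMap β γ hi hj) hp hg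

theorem ae_differentiableAt (hM : RingMesh μ m ε τ η N κ ψ) (hT : Tolerance c a M μ)
    (hr : ProfileData c M a r r1 r2 r3) (hw : Interpolates m ε τ η κ ψ r w)
    (hTm : ∀ i ∈ T, i ≤ m) :
    ∀ᵐ x ∂volume.restrict (region (layers ε τ N κ ψ T)),
      DifferentiableAt ℝ w x ∧ 0 < (fderiv ℝ w x).det := by
  rw [Measure.restrict_congr_set (hM.region_ae_eq hTm), ae_restrict_biUnion_finset_iff]
  rintro ⟨i, j, β, γ⟩ hq
  have hm := hM.measurableSet_cell hTm hq
  rw [mem_cells] at hq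
  refine (ae_restrict_iff' hm).2 (Eventually.of_forall fun z hz => ?_)
  exact (isPiece_cell i γ).differentiable_of_mem_image (hM.small i (hTm i hq.1)) hT hr (side_cell β γ)
    (fun _ hx => hw.eq_cellMap (hTm i hq.1) j β γ hx) hz

theorem energy_layers (hM : RingMesh μ m ε τ η N κ ψ) (hT : Tolerance c a M μ)
    (hr : ProfileData c M a r r1 r2 r3) (hw : Interpolates m ε τ η κ ψ r w)
    (hTm : ∀ i ∈ T, i ≤ m) {ω p : ℝ} {g : ℝ → ℝ} (hp : 1 < p) (hg : IsVolumetricEnergy g) :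
    HasFiniteEnergy ω p g w (region (layers ε τ N κ ψ T)) ∧
    energy ω p g w (region (layers ε τ N κ ψ T)) = ∑ i ∈ T, layerEnergy ε τ η N κ ω p g r i := by
  have hint : ∀ q ∈ cells N T, HasFiniteEnergy ω p g w (cell ε τ η κ ψ q) := by
    rintro ⟨i, j, β, γ⟩ hq
    rw [mem_cells] at hq
    exact (hM.energy_cell hT hr hw hp hg β γ (hTm _ hq.1) hq.2).1
  have hae := hM.region_ae_eq hTm
  constructor
  · rw [HasFiniteEnergy, integrableOn_congr_set_ae hae, integrableOn_finset_iUnion]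
    exact hint
  · rw [energy, setIntegral_congr_set hae, integral_biUnion_finset _
      (fun q hq => hM.measurableSet_cell hTm hq) (hM.pairwiseDisjoint_cell hTm) hint, cells,
      Finset.sum_sigma]
    refine Finset.sum_congr rfl fun i hi => ?_
    have h1 : ∀ x ∈ Finset.range (N i) ×ˢ (Finset.univ ×ˢ Finset.univ : Finset (Bool × Bool)),
        ∫ z in cell ε τ η κ ψ ⟨i, x⟩, storedEnergy ω p g (fderiv ℝ w z) = 2 * halfSin (η i) * τ i *
        pieceEnergy ω p g (if x.2.2 then κ i else false) (η i) r (if x.2.2 then ε i + τ i else ε i)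
        (if x.2.2 then -τ i else τ i) := by
      rintro ⟨j, β, γ⟩ hx
      exact (hM.energy_cell hT hr hw hp hg β γ (hTm i hi) (by simpa using hx)).2
    rw [Finset.sum_congr rfl h1, Finset.sum_product]
    simp [Finset.sum_product, layerEnergy]
    ring

end RingMesh

/-! ### Comparison with the energy of the radial map -/

/-- The energy density of a radial map, per unit of angle and radius. -/
def radialWeight (ω p : ℝ) (g r r1 : ℝ → ℝ) (ρ : ℝ) : ℝ := radialDensity ω p g (r1 ρ) (r ρ) ρ * ρ

variable {c a M : ℝ} {r r1 r2 r3 : ℝ → ℝ} {ω p : ℝ} {g : ℝ → ℝ}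

theorem ProfileData.continuousOn_radialWeight (hr : ProfileData c M a r r1 r2 r3) (hc : 0 < c)
    (ha : 0 < a) (hp : 1 < p) (hg : IsVolumetricEnergy g) :
    ContinuousOn (radialWeight ω p g r r1) (Ioc 0 1) := by
  have h0 : ∀ ρ ∈ Ioc (0 : ℝ) 1, ρ ≠ 0 := fun ρ h => h.1.ne'
  have cg := hg.contDiffOn.continuousOn.comp ((hr.cont1.mul hr.cont).div continuousOn_id h0)
    (fun ρ hρ => div_pos (mul_pos ((mul_pos ha hρ.1).trans_le (hr.deriv_lower ρ hρ))
      (hc.trans_le (hr.lower ρ hρ))) hρ.1)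
  have cf : ContinuousOn (fun ρ => √(r1 ρ ^ 2 + (r ρ / ρ) ^ 2)) (Ioc 0 1) :=
    ((hr.cont1.pow 2).add ((hr.cont.div continuousOn_id h0).pow 2)).sqrt
  exact ((continuousOn_const.mul (cf.rpow_const fun _ _ => Or.inr (by linarith))).add cg).mul
    continuousOn_id

/-- The pointwise error is integrated over the triangle, where the slice length `s` improves `ρ +
f1` to `2 ρ`; then `ρ ^ (1 - p)` is bounded by the radial weight. -/
theorem exists_pieceEnergy_sub_le (hp : 1 < p) (hp2 : p < 2) (hω : 0 < ω)
    (hg : IsVolumetricEnergy g) (hc : 0 < c) (ha : 0 < a) (hM : 1 ≤ M) :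
    ∃ K : ℝ, 0 ≤ K ∧ ∀ {μ ε τ η H : ℝ} {κ : Bool} {ρ0 τ' : ℝ} {r r1 r2 r3 : ℝ → ℝ},
      IsPiece ε τ κ ρ0 τ' → SmallLayer μ ε τ η → Tolerance c a M μ →
      ProfileData c M a r r1 r2 r3 → vers η ≤ H → vers η ^ 2 / τ ≤ H → τ ^ 2 ≤ H →
      |pieceEnergy ω p g κ η r ρ0 τ' - ∫ s in (0 : ℝ)..1, s * radialWeight ω p g r r1 (ρ0 + τ' * s)|
      ≤ K * H * ∫ s in (0 : ℝ)..1, radialWeight ω p g r r1 (ρ0 + τ' * s) := by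
  obtain ⟨K, hK, key⟩ := IsPiece.exists_abs_density_sub_le hp hp2 hω hg hc ha hM
  obtain ⟨_, _, hb⟩ := radialDensity_bounds (a := a) hp hp2 hω hg hc ha hM
  have hcp : 0 < ω * c ^ p := by positivity
  refine ⟨2 * K / (ω * c ^ p), by positivity,
    fun {μ ε τ η H κ ρ0 τ' r r1 r2 r3} h hl hT hr hkH hwH hτH => ?_⟩
  have hH : 0 < H := hl.vers_pos.trans_le hkH
  have hmem : MapsTo (fun s : ℝ => ρ0 + τ' * s) (Icc 0 1) (Ioc 0 1) := fun s hs =>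
    ⟨hl.ε_pos.trans_le (h.radius_mem hl.τ_pos hs).1, (h.radius_mem hl.τ_pos hs).2.trans hl.le_one⟩
  have hlin : ContinuousOn (fun s : ℝ => ρ0 + τ' * s) (Icc 0 1) := by fun_prop
  have hbc : ContinuousOn (fun s => radialWeight ω p g r r1 (ρ0 + τ' * s)) (Icc 0 1) :=
    (hr.continuousOn_radialWeight hc ha hp hg).comp hlin hmem
  have hfc : ContinuousOn (fun s => K * H * ((ρ0 + τ' * s + (ρ0 + τ')) * (ρ0 + τ' * s) ^ (-p)))
      (Icc 0 1) :=
    continuousOn_const.mul ((hlin.add continuousOn_const).mul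
      (hlin.rpow_const fun s hs => Or.inl (hmem hs).1.ne'))
  have hx0 : ContinuousOn (fun x : Plane => x 0) closedTri := (continuous_coord 0).continuousOn
  have hx1 : MapsTo (fun x : Plane => x 0) closedTri (Icc 0 1) := fun x hx =>
    ⟨hx.1.trans hx.2.1, hx.2.2⟩
  have hbi : IntegrableOn (fun x : Plane => radialWeight ω p g r r1 (ρ0 + τ' * x 0)) openTri :=
    ((hbc.comp hx0 hx1).integrableOn_compact isCompact_closedTri).mono_set openTri_subset
  have hfi : IntegrableOn (fun x : Plane =>
      K * H * ((ρ0 + τ' * x 0 + (ρ0 + τ')) * (ρ0 + τ' * x 0) ^ (-p))) openTri :=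
    ((hfc.comp hx0 hx1).integrableOn_compact isCompact_closedTri).mono_set openTri_subset
  have hdi := h.integrableOn_density hl hT hr (ω := ω) hp hg
  rw [pieceEnergy, ← integral_openTri hbc, ← integral_sub hdi hbi]
  have h1 : |∫ x in openTri, (IsPiece.density ω p g κ η r ρ0 τ' (x 0) (x 1)
      - radialWeight ω p g r r1 (ρ0 + τ' * x 0))| ≤
      ∫ x in openTri, K * H * ((ρ0 + τ' * x 0 + (ρ0 + τ')) * (ρ0 + τ' * x 0) ^ (-p)) := by
    rw [← Real.norm_eq_abs]
    refine norm_integral_le_of_norm_le hfi ?_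
    refine (ae_restrict_iff' isOpen_openTri.measurableSet).2 (Eventually.of_forall fun x hx => ?_)
    exact key h hl hT hr (openTri_subset hx) hkH hwH hτH
  refine h1.trans ?_
  rw [integral_openTri hfc, ← intervalIntegral.integral_const_mul]
  refine intervalIntegral.integral_mono_on zero_le_one ?_ ?_ fun s hs => ?_
  · exact (continuousOn_id.mul hfc).intervalIntegrable_of_Icc zero_le_one
  · exact (continuousOn_const.mul hbc).intervalIntegrable_of_Icc zero_le_one
  · obtain ⟨hρ, hρ1⟩ := hmem hs
    have hw := (hb _ _ _ hρ hρ1 (hr.lower _ (hmem hs)) (hr.le_M _ (hmem hs))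
      (hr.deriv_lower _ (hmem hs)) (hr.deriv_upper _ (hmem hs))).1
    change _ ≤ radialWeight ω p g r r1 (ρ0 + τ' * s) at hw
    -- On an inner piece `s f1 = s (ε + τ) ≤ ε + τ s = ρ`; on an outer piece already `f1 = ε ≤ ρ`.
    have hl1 : s * (ρ0 + τ' * s + (ρ0 + τ')) ≤ 2 * (ρ0 + τ' * s) := by
      have := hl.ε_pos
      have := hl.τ_pos
      have h3 := h.radius_mem hl.τ_pos hs
      rcases h with ⟨rfl, rfl, -⟩ | ⟨rfl, rfl⟩ <;> nlinarith [hs.1, hs.2, mul_nonneg hs.1 hs.1]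
    have e : (ρ0 + τ' * s) ^ (1 - p) = (ρ0 + τ' * s) * (ρ0 + τ' * s) ^ (-p) := by
      rw [sub_eq_add_neg, Real.rpow_add hρ, Real.rpow_one]
    have hq : 0 < (ρ0 + τ' * s) ^ (-p) := Real.rpow_pos_of_pos hρ _
    calc s * (K * H * ((ρ0 + τ' * s + (ρ0 + τ')) * (ρ0 + τ' * s) ^ (-p)))
        = K * H * (s * (ρ0 + τ' * s + (ρ0 + τ'))) * (ρ0 + τ' * s) ^ (-p) := by ring
      _ ≤ K * H * (2 * (ρ0 + τ' * s)) * (ρ0 + τ' * s) ^ (-p) := by gcongr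
      _ = 2 * K / (ω * c ^ p) * H * (ω * c ^ p * (ρ0 + τ' * s) ^ (1 - p)) := by
        rw [e]; field_simp
      _ ≤ _ := by gcongr

namespace RingMesh

/-- The densities `s` and `1 - s` of the two pieces add up to `1`. In the constant `2 K + 1` each
piece contributes `K`, and `1` accounts for replacing `2 sin (η / 2)` by `η`. -/
theorem exists_layerEnergy_sub_le (hp : 1 < p) (hp2 : p < 2) (hω : 0 < ω)
    (hg : IsVolumetricEnergy g) (hc : 0 < c) (ha : 0 < a) (hM : 1 ≤ M) :
    ∃ K : ℝ, 0 ≤ K ∧ ∀ {μ H : ℝ} {m : ℕ} {ε τ η : ℕ → ℝ} {N : ℕ → ℕ} {κ : ℕ → Bool} {ψ : ℕ → ℝ}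
      {r r1 r2 r3 : ℝ → ℝ} {i : ℕ}, RingMesh μ m ε τ η N κ ψ → Tolerance c a M μ →
      ProfileData c M a r r1 r2 r3 → i ≤ m → vers (η i) ≤ H → vers (η i) ^ 2 / τ i ≤ H →
      τ i ^ 2 ≤ H →
      |layerEnergy ε τ η N κ ω p g r i
        - 2 * Real.pi * ∫ ρ in ε i..ε i + τ i, radialWeight ω p g r r1 ρ|
      ≤ K * H * (2 * Real.pi * ∫ ρ in ε i..ε i + τ i, radialWeight ω p g r r1 ρ) := by
  obtain ⟨K, hK, key⟩ := exists_pieceEnergy_sub_le hp hp2 hω hg hc ha hM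
  obtain ⟨_, _, hb⟩ := radialDensity_bounds (a := a) hp hp2 hω hg hc ha hM
  refine ⟨2 * K + 1, by positivity,
    fun {μ H m ε τ η N κ ψ r r1 r2 r3 i} hMe hT hr hi hkH hwH hτH => ?_⟩
  have hl := hMe.small i hi
  have hH : 0 < H := hl.vers_pos.trans_le hkH
  have k1 := key (isPiece_lower (ε i) (τ i)) hl hT hr hkH hwH hτH
  have k2 := key (isPiece_upper (ε i) (τ i) (κ i)) hl hT hr hkH hwH hτH
  have hmem : MapsTo (fun s : ℝ => ε i + τ i * s) (Icc 0 1) (Ioc 0 1) := fun s hs =>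
    ⟨hl.ε_pos.trans_le ((isPiece_lower (ε i) (τ i)).radius_mem hl.τ_pos hs).1,
      ((isPiece_lower (ε i) (τ i)).radius_mem hl.τ_pos hs).2.trans hl.le_one⟩
  have hlin : ContinuousOn (fun s : ℝ => ε i + τ i * s) (Icc 0 1) := by fun_prop
  have hbc : ContinuousOn (fun s => radialWeight ω p g r r1 (ε i + τ i * s)) (Icc 0 1) :=
    (hr.continuousOn_radialWeight hc ha hp hg).comp hlin hmem
  set b : ℝ → ℝ := fun s => radialWeight ω p g r r1 (ε i + τ i * s) with hbd
  set I : ℝ := ∫ s in (0 : ℝ)..1, b s with hI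
  have hI0 : 0 ≤ I := by
    refine intervalIntegral.integral_nonneg zero_le_one fun s hs => ?_
    have hρ := hmem hs
    have hw := (hb _ _ _ hρ.1 hρ.2 (hr.lower _ hρ) (hr.le_M _ hρ)
      (hr.deriv_lower _ hρ) (hr.deriv_upper _ hρ)).1
    have : 0 < (ε i + τ i * s) ^ (1 - p) := Real.rpow_pos_of_pos hρ.1 _
    exact le_trans (by positivity) hw
  have e1 : ∫ ρ in ε i..ε i + τ i, radialWeight ω p g r r1 ρ = τ i * I := by
    have := intervalIntegral.mul_integral_comp_add_mul (a := 0) (b := 1)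
      (f := radialWeight ω p g r r1) (τ i) (ε i)
    rw [mul_zero, add_zero, mul_one] at this
    exact this.symm
  have e2 : ∫ s in (0 : ℝ)..1, radialWeight ω p g r r1 (ε i + τ i + -τ i * s) = I := by
    have := intervalIntegral.integral_comp_sub_left (a := 0) (b := 1) b 1
    rw [sub_self, sub_zero] at this
    rw [hI, ← this]
    congr 1; ext s; simp only [hbd]; congr 1; ring
  -- The outer piece runs inwards, so the reflection `s ↦ 1 - s` turns its density `s` into `1 - s`.
  have e3 : ∫ s in (0 : ℝ)..1, s * radialWeight ω p g r r1 (ε i + τ i + -τ i * s)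
      = I - ∫ s in (0 : ℝ)..1, s * b s := by
    have := intervalIntegral.integral_comp_sub_left (a := 0) (b := 1) (fun s => (1 - s) * b s) 1
    rw [sub_self, sub_zero] at this
    have h2 : ∫ s in (0 : ℝ)..1, s * radialWeight ω p g r r1 (ε i + τ i + -τ i * s)
        = ∫ s in (0 : ℝ)..1, (1 - s) * b s := by
      rw [← this]
      congr 1; ext s; simp only [hbd]; congr 1
      · ring
      · congr 1; ring
    have h3 : IntervalIntegrable (fun s => s * b s) volume 0 1 :=
      (continuousOn_id.mul hbc).intervalIntegrable_of_Icc zero_le_one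
    rw [h2, hI, ← intervalIntegral.integral_sub (hbc.intervalIntegrable_of_Icc zero_le_one) h3]
    congr 1; ext s; ring
  rw [e2, e3] at k2
  set P := pieceEnergy ω p g false (η i) r (ε i) (τ i)
  set Q := pieceEnergy ω p g (κ i) (η i) r (ε i + τ i) (-τ i)
  set J := ∫ s in (0 : ℝ)..1, s * b s
  have hPQ : |P + Q - I| ≤ 2 * K * H * I := by
    have : P + Q - I = (P - J) + (Q - (I - J)) := by ring
    rw [this]
    exact (abs_add_le_add' k1 k2).trans (by linarith)
  have hNη : (N i : ℝ) * η i = Real.pi := by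
    have := hMe.N_pos i hi
    rw [← hMe.η_eq i hi]; field_simp
  have hτ := hl.τ_pos
  have hη := hl.η_pos
  have hσ := hl.halfSin_pos
  have hσ1 : 2 * halfSin (η i) ≤ η i := by
    have := Real.sin_lt (x := η i / 2) (by linarith)
    unfold halfSin; linarith
  -- This is `x cos x ≤ sin x` at `x = η / 2`, obtained from `x ≤ tan x`.
  have hσ2 : η i - 2 * halfSin (η i) ≤ η i * vers (η i) := by
    have h1 := Real.le_tan (x := η i / 2) (by linarith) (by linarith [hl.η_lt])
    have h2 : 0 < Real.cos (η i / 2) :=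
      Real.cos_pos_of_mem_Ioo ⟨by linarith [hl.η_lt], by linarith [hl.η_lt]⟩
    rw [Real.tan_eq_sin_div_cos, le_div_iff₀ h2] at h1
    unfold halfSin vers; linarith
  rw [e1, layerEnergy]
  have e4 : 2 * N i * (2 * halfSin (η i) * τ i) * (P + Q) - 2 * Real.pi * (τ i * I)
      = 2 * N i * τ i * (2 * halfSin (η i) * (P + Q - I) - (η i - 2 * halfSin (η i)) * I) := by
    rw [← hNη]; ring
  have h1 : |2 * halfSin (η i) * (P + Q - I) - (η i - 2 * halfSin (η i)) * I|
      ≤ η i * (2 * K * H * I) + η i * H * I := by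
    refine abs_sub_le_add' (abs_mul_le_mul' ?_ hPQ) ?_
    · rw [abs_of_pos (by linarith)]; exact hσ1
    · rw [abs_of_nonneg (mul_nonneg (by linarith) hI0)]
      refine mul_le_mul_of_nonneg_right (hσ2.trans ?_) hI0
      exact mul_le_mul_of_nonneg_left hkH hη.le
  have hN0 : 0 ≤ 2 * (N i : ℝ) * τ i := by positivity
  rw [e4, abs_mul, abs_of_nonneg hN0]
  refine (mul_le_mul_of_nonneg_left h1 hN0).trans (le_of_eq ?_)
  rw [← hNη]; ring

end RingMesh

/-! ### The energy of the radial map -/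

theorem hasFDerivAt_norm_plane {x : Plane} (hx : x ≠ 0) :
    HasFDerivAt (fun x : Plane => ‖x‖) ((1 / ‖x‖) • innerSL ℝ x) x := by
  have hn : ‖x‖ ≠ 0 := norm_ne_zero_iff.2 hx
  have h := (hasStrictFDerivAt_norm_sq x).hasFDerivAt.sqrt (by positivity)
  simp only [Real.sqrt_sq (norm_nonneg _)] at h
  refine h.congr_fderiv ?_
  ext y
  simp
  field_simp

/-- The gradient is `q I + (R' - q) n ⊗ n` with `q = R / ρ` and `n = x / ρ`; its principal stretches
are `R'` and `q`. -/
theorem hasFDerivAt_radialMap {r : ℝ → ℝ} {x : Plane} {R' : ℝ} (hx : x ≠ 0)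
    (hr : HasDerivAt r R' ‖x‖) :
    HasFDerivAt (radialMap r)
      (linMap (r ‖x‖ / ‖x‖ + (R' - r ‖x‖ / ‖x‖) / ‖x‖ ^ 2 * x 0 ^ 2)
        ((R' - r ‖x‖ / ‖x‖) / ‖x‖ ^ 2 * (x 0 * x 1))
        ((R' - r ‖x‖ / ‖x‖) / ‖x‖ ^ 2 * (x 0 * x 1))
        (r ‖x‖ / ‖x‖ + (R' - r ‖x‖ / ‖x‖) / ‖x‖ ^ 2 * x 1 ^ 2)) x := by
  have hn : ‖x‖ ≠ 0 := norm_ne_zero_iff.2 hx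
  have h1 := (hr.div (hasDerivAt_id ‖x‖) hn).comp_hasFDerivAt x (hasFDerivAt_norm_plane hx)
  have h2 := h1.smul (hasFDerivAt_id x)
  refine h2.congr_fderiv ?_
  ext y i
  rw [linMap_apply]
  fin_cases i <;>
  · simp [PiLp.inner_apply, Fin.sum_univ_two]
    field_simp
    ring

theorem storedEnergy_fderiv_radialMap {r : ℝ → ℝ} {x : Plane} {R' : ℝ} (hx : x ≠ 0)
    (hr : HasDerivAt r R' ‖x‖) (ω p : ℝ) (g : ℝ → ℝ) :
    storedEnergy ω p g (fderiv ℝ (radialMap r) x) = radialDensity ω p g R' (r ‖x‖) ‖x‖ := by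
  have hn : ‖x‖ ≠ 0 := norm_ne_zero_iff.2 hx
  have hs : ‖x‖ ^ 2 = x 0 ^ 2 + x 1 ^ 2 := by
    rw [EuclideanSpace.norm_sq_eq, Fin.sum_univ_two]; simp
  rw [(hasFDerivAt_radialMap hx hr).fderiv, storedEnergy, frobeniusNorm_linMap, det_linMap,
    radialDensity]
  set q := r ‖x‖ / ‖x‖ with hq
  obtain ⟨k, hk⟩ : ∃ k, k = (R' - q) / ‖x‖ ^ 2 := ⟨_, rfl⟩
  have hR : R' = q + k * (x 0 ^ 2 + x 1 ^ 2) := by rw [hk, ← hs]; field_simp; ring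
  have e2 : R' * r ‖x‖ / ‖x‖ = R' * q := by rw [hq]; ring
  rw [← hk, e2, hR]
  congr 3
  · congr 1; ring
  · ring

variable {c a M : ℝ} {r r1 r2 r3 : ℝ → ℝ} {ω p : ℝ} {g : ℝ → ℝ}

theorem norm_mem_of_mem_annulus {ε₀ : ℝ} (hε : 0 < ε₀) {x : Plane} (hx : x ∈ annulus ε₀) :
    x ≠ 0 ∧ ‖x‖ ∈ Ico ε₀ 1 ∧ ‖x‖ ∈ Ioo (0 : ℝ) 1 := by
  have h1 : ‖x‖ < 1 := by simpa using hx.1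
  have h2 : ε₀ ≤ ‖x‖ := by simpa using hx.2
  exact ⟨norm_pos_iff.1 (hε.trans_le h2), ⟨h2, h1⟩, hε.trans_le h2, h1⟩

theorem energy_radialMap (hr : ProfileData c M a r r1 r2 r3) (hc : 0 < c) (ha : 0 < a) (hp : 1 < p)
    (hg : IsVolumetricEnergy g) {ε₀ : ℝ} (hε : 0 < ε₀) (hε1 : ε₀ < 1) :
    HasFiniteEnergy ω p g (radialMap r) (annulus ε₀) ∧
    energy ω p g (radialMap r) (annulus ε₀)
      = 2 * Real.pi * ∫ ρ in ε₀..1, radialWeight ω p g r r1 ρ := by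
  have hm : MeasurableSet (annulus ε₀) := measurableSet_ball.diff measurableSet_ball
  set f : ℝ → ℝ := fun ρ => radialDensity ω p g (r1 ρ) (r ρ) ρ with hf
  have heq : EqOn (fun x => storedEnergy ω p g (fderiv ℝ (radialMap r) x)) (fun x => f ‖x‖)
      (annulus ε₀) := by
    intro x hx
    obtain ⟨h0, -, h1⟩ := norm_mem_of_mem_annulus hε hx
    exact storedEnergy_fderiv_radialMap h0 (hr.hasDeriv _ h1) ω p g
  have hfc : ContinuousOn f (Ioc 0 1) := by
    refine ((hr.continuousOn_radialWeight (ω := ω) hc ha hp hg).div continuousOn_id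
      fun ρ hρ => hρ.1.ne').congr fun ρ hρ => ?_
    have := hρ.1.ne'
    simp [radialWeight, hf, this]
  constructor
  · rw [HasFiniteEnergy, integrableOn_congr_fun heq hm]
    have hK : IsCompact (Metric.closedBall (0 : Plane) 1 \ Metric.ball 0 ε₀) :=
      (isCompact_closedBall _ _).diff Metric.isOpen_ball
    refine IntegrableOn.mono_set (ContinuousOn.integrableOn_compact hK
      (hfc.comp continuous_norm.continuousOn fun x hx => ?_))
      (sdiff_subset_sdiff_left Metric.ball_subset_closedBall)
    have h1 : ‖x‖ ≤ 1 := by simpa using hx.1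
    have h2 : ε₀ ≤ ‖x‖ := by simpa using hx.2
    exact ⟨hε.trans_le h2, h1⟩
  · rw [energy, setIntegral_congr_fun hm heq, ← integral_indicator hm]
    have h1 : (annulus ε₀).indicator (fun x => f ‖x‖) = fun x => (Ico ε₀ 1).indicator f ‖x‖ := by
      ext x
      by_cases hx : x ∈ annulus ε₀
      · rw [indicator_of_mem hx, indicator_of_mem (norm_mem_of_mem_annulus hε hx).2.1]
      · rw [indicator_of_notMem hx, indicator_of_notMem]
        intro h
        exact hx ⟨by simpa using h.2, by simpa using h.1⟩
    have hvol : volume.real (Metric.ball (0 : Plane) 1) = Real.pi := by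
      rw [Measure.real, EuclideanSpace.volume_ball_fin_two]
      simp [Real.pi_pos.le]
    rw [h1, integral_fun_norm_addHaar volume, hvol]
    have hsub : Ico ε₀ 1 ⊆ Ioi 0 := fun ρ hρ => hε.trans_le hρ.1
    have h2 : ∫ y in Ioi (0 : ℝ), y ^ (Module.finrank ℝ Plane - 1) • (Ico ε₀ 1).indicator f y
        = ∫ ρ in ε₀..1, radialWeight ω p g r r1 ρ := by
      rw [intervalIntegral.integral_of_le hε1.le, ← integral_Ico_eq_integral_Ioc,
        ← inter_eq_right.2 hsub, ← setIntegral_indicator measurableSet_Ico]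
      congr 1
      ext y
      rw [inter_eq_right.2 hsub]
      by_cases hy : y ∈ Ico ε₀ 1
      · rw [indicator_of_mem hy, indicator_of_mem hy]
        simp [radialWeight, hf, mul_comm]
      · rw [indicator_of_notMem hy, indicator_of_notMem hy, smul_zero]
    rw [h2]
    simp
    ring

/-! ### Meshes produced by the strategy -/

/-- Increments of a convex function over steps of fixed length increase: `u + k` and `v` are
complementary convex combinations of `u` and `v + k`. -/
theorem rpow_add_sub_mono {P u v k : ℝ} (hP : 1 ≤ P) (hu : 0 ≤ u) (huv : u ≤ v) (hk : 0 < k) :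
    (u + k) ^ P - u ^ P ≤ (v + k) ^ P - v ^ P := by
  have hf := convexOn_rpow hP
  have hd : 0 < v - u + k := by linarith
  have hu' : u ∈ Ici (0 : ℝ) := hu
  have hv' : v + k ∈ Ici (0 : ℝ) := by simp only [mem_Ici]; linarith
  have l0 : 0 ≤ k / (v - u + k) := by positivity
  have l1 : 0 ≤ (v - u) / (v - u + k) := div_nonneg (by linarith) hd.le
  have l2 : (v - u) / (v - u + k) + k / (v - u + k) = 1 := by rw [← add_div, div_self hd.ne']
  have h1 := hf.2 hu' hv' l1 l0 l2
  have h2 := hf.2 hu' hv' l0 l1 (by rw [add_comm, l2])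
  simp only [smul_eq_mul] at h1 h2
  have e1 : (v - u) / (v - u + k) * u + k / (v - u + k) * (v + k) = u + k := by field_simp; ring
  have e2 : k / (v - u + k) * u + (v - u) / (v - u + k) * (v + k) = v := by field_simp; ring
  rw [e1] at h1
  rw [e2] at h2
  have : k / (v - u + k) = 1 - (v - u) / (v - u + k) := by linarith
  rw [this] at h1 h2
  linarith

theorem thicknessBound_eq {p C x h : ℝ} (hp2 : p < 2) (hx : 0 ≤ x) : thicknessBound p C x h =
    (x ^ (2 - p) + C * h) ^ (1 / (2 - p)) - (x ^ (2 - p)) ^ (1 / (2 - p)) := by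
  have : 2 - p ≠ 0 := by linarith
  rw [thicknessBound, ← Real.rpow_mul hx, mul_one_div_cancel this, Real.rpow_one]

theorem thicknessBound_mono {p C x y h : ℝ} (hp : 1 < p) (hp2 : p < 2) (hCh : 0 < C * h) (hx : 0 ≤ x)
    (hxy : x ≤ y) : thicknessBound p C x h ≤ thicknessBound p C y h := by
  rw [thicknessBound_eq hp2 hx, thicknessBound_eq hp2 (hx.trans hxy)]
  refine rpow_add_sub_mono ?_ (by positivity) (Real.rpow_le_rpow hx hxy (by linarith)) hCh
  rw [le_div_iff₀ (by linarith)]; linarith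

/-- By monotonicity the worst radius is `1`, and there the power of exponent `1 / (2 - p) ≥ 1` lies
below its chord over `[1, 2]`. -/
theorem thicknessBound_le {p C x h : ℝ} (hp : 1 < p) (hp2 : p < 2) (hCh : 0 < C * h)
    (hCh1 : C * h ≤ 1) (hx : 0 ≤ x) (hx1 : x ≤ 1) :
    thicknessBound p C x h ≤ (2 ^ (1 / (2 - p)) - 1) * (C * h) := by
  refine (thicknessBound_mono hp hp2 hCh hx hx1).trans ?_
  have hP : 1 ≤ 1 / (2 - p) := by rw [le_div_iff₀ (by linarith)]; linarith
  have h1 := (convexOn_rpow hP).2 (show (1 : ℝ) ∈ Ici 0 by simp) (show (2 : ℝ) ∈ Ici 0 by simp)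
    (show 0 ≤ 1 - C * h by linarith) hCh.le (by ring)
  simp only [smul_eq_mul, Real.one_rpow, mul_one] at h1
  rw [show 1 - C * h + C * h * 2 = 1 + C * h by ring] at h1
  rw [thicknessBound, Real.one_rpow]
  linarith

theorem Admissible.mono {C C₂ h ε τ ε' τ' : ℝ} {N N' : ℕ} (hC₂ : 0 < C₂) (hε : 0 < ε) (hτ : 0 < τ)
    (hεε : ε ≤ ε') (hττ : τ ≤ τ') (hN : N ≤ N') (hA : Admissible C C₂ h ε τ N) :
    Admissible C C₂ h ε' τ' N' := by
  obtain ⟨h0, h1⟩ := hA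
  have h0' : (0 : ℝ) < N := by exact_mod_cast h0
  refine ⟨h0.trans_le hN, (inv_anti₀ h0' (by exact_mod_cast hN)).trans (h1.trans ?_)⟩
  have hε' : 0 ≤ ε' := hε.le.trans hεε
  gcongr

theorem Admissible.pow_four_le {C C₂ h ε τ : ℝ} {N : ℕ} (hε : 0 < ε) (hτ : 0 < τ)
    (hA : Admissible C C₂ h ε τ N) :
    (N : ℝ)⁻¹ ^ 4 ≤ C₂ ^ 4 * (ε * τ) ∧ (N : ℝ)⁻¹ ^ 4 ≤ C ^ 2 * τ * h ^ 2 := by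
  have h4 : ∀ x : ℝ, 0 ≤ x → (x ^ (1 / 4 : ℝ)) ^ 4 = x := by
    intro x hx
    rw [← Real.rpow_natCast, ← Real.rpow_mul hx]; norm_num
  obtain ⟨h0, h1⟩ := hA
  have hN : (0 : ℝ) ≤ (N : ℝ)⁻¹ := by positivity
  constructor
  · have := pow_le_pow_left₀ hN (h1.trans (min_le_left _ _)) 4
    rwa [mul_pow, h4 _ (by positivity)] at this
  · have := pow_le_pow_left₀ hN (h1.trans (min_le_right _ _)) 4
    rwa [h4 _ (by positivity)] at this

theorem vers_pi_div_le (N : ℕ) : vers (Real.pi / N) ≤ 2 * (N : ℝ)⁻¹ ^ 2 := by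
  have h1 := Real.one_sub_sq_div_two_le_cos (x := Real.pi / N / 2)
  have h2 : (Real.pi / N / 2) ^ 2 / 2 = Real.pi ^ 2 / 8 * (N : ℝ)⁻¹ ^ 2 := by ring
  have h3 : Real.pi ^ 2 / 8 ≤ 2 := by nlinarith [Real.pi_le_four, Real.pi_pos]
  have h4 : 0 ≤ (N : ℝ)⁻¹ ^ 2 := by positivity
  unfold vers
  nlinarith

/-- Admissibility gives `vers² ≤ 4 N⁻⁴ ≤ 4 C₂⁴ ε τ`, and `C₂ ≤ μ / 4` with `π ≤ 4` also gives `π / N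
≤ μ`. The bound `τ ≤ C₁ √ε` gives `τ² ≤ μ ε`. -/
theorem smallLayer_of_admissible {C C₁ C₂ h ε τ μ : ℝ} {N : ℕ} (hμ : 0 < μ) (hμ1 : μ ≤ 1)
    (hC₁ : 0 < C₁) (hC₁μ : C₁ ≤ μ) (hC₂ : 0 < C₂) (hC₂μ : C₂ ≤ μ / 4) (hε : 0 < ε) (hτ : 0 < τ)
    (hle : ε + τ ≤ 1) (hτC : τ ≤ C₁ * √ε) (hA : Admissible C C₂ h ε τ N) :
    SmallLayer μ ε τ (Real.pi / N) := by
  have hv := vers_pi_div_le N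
  have hN : (0 : ℝ) < N := by exact_mod_cast hA.1
  have h4 := (hA.pow_four_le hε hτ).1
  have hv0 : 0 ≤ vers (Real.pi / N) := by unfold vers; linarith [Real.cos_le_one (Real.pi / N / 2)]
  have hv2 : vers (Real.pi / N) ^ 2 ≤ 4 * C₂ ^ 4 * (ε * τ) := by
    have := pow_le_pow_left₀ hv0 hv 2
    calc vers (Real.pi / N) ^ 2 ≤ 4 * (N : ℝ)⁻¹ ^ 4 := this.trans (le_of_eq (by ring))
      _ ≤ _ := by linarith
  have hετ : 0 < ε * τ := mul_pos hε hτ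
  have hετ1 : ε * τ ≤ 1 := by nlinarith
  have hC4 : 4 * C₂ ^ 4 ≤ μ ^ 4 := by
    have := pow_le_pow_left₀ hC₂.le hC₂μ 4
    have h5 : 0 < μ ^ 4 := by positivity
    calc 4 * C₂ ^ 4 ≤ 4 * (μ / 4) ^ 4 := by linarith
      _ ≤ μ ^ 4 := by ring_nf; linarith
  have hμ42 : μ ^ 4 ≤ μ ^ 2 := pow_le_pow_of_le_one hμ.le hμ1 (by norm_num)
  have hμ21 : μ ^ 2 ≤ μ := by nlinarith
  have hτ2 : τ ^ 2 ≤ μ * ε := by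
    have h1 := pow_le_pow_left₀ hτ.le hτC 2
    rw [mul_pow, Real.sq_sqrt hε.le] at h1
    have h2 : C₁ ^ 2 ≤ μ := by nlinarith
    exact h1.trans (mul_le_mul_of_nonneg_right h2 hε.le)
  have hv2' : vers (Real.pi / N) ^ 2 ≤ μ ^ 2 * (ε * τ) :=
    hv2.trans (mul_le_mul_of_nonneg_right (hC4.trans hμ42) hετ.le)
  refine ⟨hε, hτ, hle, by positivity, ?_, ?_, ?_, ?_, hτ2⟩
  · have h1 : (N : ℝ)⁻¹ ^ 4 ≤ (μ / 4) ^ 4 := by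
      have h5 := pow_le_pow_left₀ hC₂.le hC₂μ 4
      have h6 : C₂ ^ 4 * (ε * τ) ≤ C₂ ^ 4 := mul_le_of_le_one_right (by positivity) hετ1
      linarith
    have h2 := (pow_le_pow_iff_left₀ (by positivity) (by positivity) (by norm_num)).1 h1
    have h3 := Real.pi_le_four
    have h5 : (0 : ℝ) < (N : ℝ)⁻¹ := by positivity
    rw [div_eq_mul_inv]
    nlinarith
  · refine (pow_le_pow_iff_left₀ hv0 hμ.le two_ne_zero).1 (hv2'.trans ?_)
    exact mul_le_of_le_one_right (by positivity) hετ1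
  · refine hv2'.trans ?_
    rw [mul_assoc]
    exact mul_le_mul_of_nonneg_right hμ21 hετ.le
  · refine (pow_le_pow_iff_left₀ (by positivity) (by positivity) two_ne_zero).1 ?_
    have h1 : vers (Real.pi / N) ^ 2 ≤ μ * ε := by
      refine hv2'.trans ?_
      have : ε * τ ≤ ε := mul_le_of_le_one_right hε.le (by linarith)
      nlinarith
    calc (vers (Real.pi / N) * τ) ^ 2 = vers (Real.pi / N) ^ 2 * τ ^ 2 := by ring
      _ ≤ (μ * ε) * (μ * ε) := mul_le_mul h1 hτ2 (by positivity) (by positivity)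
      _ = (μ * ε) ^ 2 := by ring

namespace StrategyMesh

variable {p C C₁ C₂ A₁ A₂ h ε₀ : ℝ} (J : StrategyMesh p C C₁ C₂ A₁ A₂ h ε₀)

theorem ε_mono {i j : ℕ} (hij : i ≤ j) (hj : j ≤ J.m + 1) : J.ε i ≤ J.ε j := by
  induction j, hij using Nat.le_induction with
  | base => exact le_rfl
  | succ j hij ih => exact (ih (by omega)).trans (J.ε_lt j (by omega)).le

theorem ε_pos (hε : 0 < ε₀) {i : ℕ} (hi : i ≤ J.m + 1) : 0 < J.ε i := by
  have := J.ε_mono (Nat.zero_le i) hi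
  rw [J.ε_zero] at this
  linarith

theorem ε_le_one {i : ℕ} (hi : i ≤ J.m + 1) : J.ε i ≤ 1 := by
  rw [← J.ε_last]; exact J.ε_mono hi le_rfl

theorem τ_pos {i : ℕ} (hi : i ≤ J.m) : 0 < J.τ i := by
  have h1 := J.ε_lt i hi
  rw [J.ε_succ i hi] at h1
  linarith

theorem τ_le {i : ℕ} (hi : i ≤ J.m) :
    J.τ i ≤ min (C₁ * √(J.ε i)) (thicknessBound p C (J.ε i) h) := by
  rcases Nat.eq_zero_or_pos i with rfl | h0
  · rw [J.τ_zero, J.ε_zero]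
  · rw [J.τ_eq i h0 hi]; exact min_le_right _ _

/-- Only the last layer can be cut off by `1 - ε`: otherwise the next radius would already be `1`,
leaving no room for a further layer. -/
theorem τ_eq_of_lt {i : ℕ} (hi : i < J.m) :
    J.τ i = min (C₁ * √(J.ε i)) (thicknessBound p C (J.ε i) h) := by
  rcases Nat.eq_zero_or_pos i with rfl | h0
  · rw [J.τ_zero, J.ε_zero]
  · have h1 := J.τ_eq i h0 hi.le
    rcases min_choice (1 - J.ε i) (min (C₁ * √(J.ε i)) (thicknessBound p C (J.ε i) h)) with h2 | h2
    · rw [h2] at h1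
      have h3 := J.ε_succ i hi.le
      have h4 := J.ε_lt (i + 1) hi
      have h5 := J.ε_le_one (i := i + 1 + 1) (by omega)
      linarith
    · rw [h1, h2]

theorem τ_mono (hε : 0 < ε₀) (hp : 1 < p) (hp2 : p < 2) (hC₁ : 0 < C₁) (hCh : 0 < C * h) {i : ℕ}
    (hi : i + 1 < J.m) : J.τ i ≤ J.τ (i + 1) := by
  rw [J.τ_eq_of_lt (by omega), J.τ_eq_of_lt hi]
  have h1 := J.ε_mono (Nat.le_succ i) (by omega)
  exact min_le_min (mul_le_mul_of_nonneg_left (Real.sqrt_le_sqrt h1) hC₁.le)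
    (thicknessBound_mono hp hp2 hCh (J.ε_pos hε (by omega)).le h1)

/-- At most `k` halvings occur, so each division by `2` is exact and the node number never falls
below `Ntil`. -/
theorem N_eq {i : ℕ} (hi : i ≤ J.m) : J.κ i ≤ J.k ∧ J.N i = 2 ^ (J.k - J.κ i) * J.Ntil := by
  induction i with
  | zero => rw [J.κ_zero, J.N_zero]; exact ⟨Nat.zero_le _, rfl⟩
  | succ i ih =>
    obtain ⟨h1, h2⟩ := ih (by omega)
    by_cases hc : J.κ i < J.k ∧ Admissible C C₂ h (J.ε (i + 1)) (J.τ (i + 1)) (J.N i / 2)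
    · obtain ⟨h3, h4⟩ := J.halve i hi hc.1 hc.2
      rw [h3, h4, h2]
      refine ⟨hc.1, ?_⟩
      have : J.k - J.κ i = (J.k - (J.κ i + 1)) + 1 := by omega
      rw [this, pow_succ, mul_right_comm, Nat.mul_div_cancel _ two_pos]
    · obtain ⟨h3, h4⟩ := J.keep i hi hc
      rw [h3, h4]
      exact ⟨h1, h2⟩

theorem Ntil_le {i : ℕ} (hi : i ≤ J.m) : J.Ntil ≤ J.N i := by
  rw [(J.N_eq hi).2]
  exact Nat.le_mul_of_pos_left _ (by positivity)

theorem N_pos {i : ℕ} (hi : i ≤ J.m) : 0 < J.N i := J.Ntil_pos.trans_le (J.Ntil_le hi)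

theorem N_succ {i : ℕ} (hi : i < J.m) : J.N i = 2 * J.N (i + 1) ∨ J.N (i + 1) = J.N i := by
  by_cases hc : J.κ i < J.k ∧ Admissible C C₂ h (J.ε (i + 1)) (J.τ (i + 1)) (J.N i / 2)
  · left
    have h1 := (J.N_eq hi.le).2
    have h2 := (J.N_eq (i := i + 1) hi).2
    have h3 := (J.halve i hi hc.1 hc.2).1
    rw [h1, h2, h3]
    have : J.k - J.κ i = (J.k - (J.κ i + 1)) + 1 := by omega
    rw [this, pow_succ]; ring
  · exact Or.inr (J.keep i hi hc).2

/-- If the node number is kept, admissibility is inherited because `ε` and `τ` do not decrease. The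
thickness is monotone only before the last, possibly truncated, layer, for which admissibility is
the hypothesis `hm`. -/
theorem admissible (hε : 0 < ε₀) (hp : 1 < p) (hp2 : p < 2) (hC₁ : 0 < C₁) (hC₂ : 0 < C₂)
    (hCh : 0 < C * h) (hm : Admissible C C₂ h (J.ε J.m) (J.τ J.m) (J.N J.m)) {i : ℕ} (hi : i ≤ J.m) :
    Admissible C C₂ h (J.ε i) (J.τ i) (J.N i) := by
  rcases hi.eq_or_lt with rfl | hi
  · exact hm
  induction i with
  | zero =>
    have h1 := J.Nbar_least.1
    have h2 := J.k_least.1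
    rw [J.ε_zero, J.N_zero]
    exact Admissible.mono hC₂ hε (J.τ_pos (Nat.zero_le _)) le_rfl le_rfl h2 h1
  | succ i ih =>
    have h1 := ih (by omega) (by omega)
    by_cases hc : J.κ i < J.k ∧ Admissible C C₂ h (J.ε (i + 1)) (J.τ (i + 1)) (J.N i / 2)
    · rw [(J.halve i (by omega) hc.1 hc.2).2]; exact hc.2
    · rw [(J.keep i (by omega) hc).2]
      exact Admissible.mono hC₂ (J.ε_pos hε (by omega)) (J.τ_pos (by omega))
        (J.ε_mono (Nat.le_succ i) (by omega)) (J.τ_mono hε hp hp2 hC₁ hCh hi) le_rfl h1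

/-- Whether layer `i` is a conforming layer. -/
def conf (i : ℕ) : Bool := decide (1 ≤ i ∧ J.N (i - 1) = 2 * J.N i)

theorem layer_eq (i : ℕ) : J.layer i = layerElems (J.conf i) (J.ε i) (J.τ i) (J.N i) (J.ψ i) := by
  simp [layer, layerElems, conf]

theorem elements_eq : J.elements = RingMesh.elems J.m J.ε J.τ J.N J.conf J.ψ := by
  simp only [elements, RingMesh.elems, layer_eq]

theorem ringMesh (hε : 0 < ε₀) (hp : 1 < p) (hp2 : p < 2) (hC₁ : 0 < C₁) (hC₂ : 0 < C₂)
    (hCh : 0 < C * h) (hm : Admissible C C₂ h (J.ε J.m) (J.τ J.m) (J.N J.m)) {μ : ℝ} (hμ : 0 < μ)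
    (hμ1 : μ ≤ 1 / 1000) (hC₁μ : C₁ ≤ μ) (hC₂μ : C₂ ≤ μ / 4) :
    RingMesh μ J.m J.ε J.τ (fun i => Real.pi / J.N i) J.N J.conf J.ψ where
  μ_le := hμ1
  small i hi := smallLayer_of_admissible hμ (by linarith) hC₁ hC₁μ hC₂ hC₂μ (J.ε_pos hε (by omega))
    (J.τ_pos hi) (by rw [← J.ε_succ i hi]; exact J.ε_le_one (by omega))
    ((J.τ_le hi).trans (min_le_left _ _)) (J.admissible hε hp hp2 hC₁ hC₂ hCh hm hi)
  N_pos _ hi := J.N_pos hi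
  η_eq _ _ := rfl
  ε_succ i hi := J.ε_succ i hi.le
  join i hi := by
    obtain ⟨q, hq⟩ := J.ψ_succ i hi
    exact ⟨q, by rw [hq]; ring⟩
  standard i hi hκ := by
    rcases J.N_succ hi with h1 | h1
    · simp [conf, h1] at hκ
    · rw [h1]
  conforming i hi hκ := by
    have h1 : J.N i = 2 * J.N (i + 1) := by simpa [conf] using hκ
    have := J.N_pos (i := i + 1) hi
    rw [h1]; push_cast; field_simp

/-- The three summands of the constant come, in order, from `N ≥ Ntil ≥ (A₂ h)⁻¹`, from `N⁻⁴ ≤ C² τ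
h²`, and from the thickness bound, which is linear in `C h`. -/
theorem sizes_le (hε : 0 < ε₀) (hp : 1 < p) (hp2 : p < 2) (hC₁ : 0 < C₁) (hC₂ : 0 < C₂)
    (hA₂ : 0 < A₂) (hh : 0 < h)
    (hCh : 0 < C * h) (hCh1 : C * h ≤ 1) (hm : Admissible C C₂ h (J.ε J.m) (J.τ J.m) (J.N J.m))
    {i : ℕ} (hi : i ≤ J.m) :
    vers (Real.pi / J.N i) ≤ (2 * A₂ ^ 2 + 4 * C ^ 2 + ((2 ^ (1 / (2 - p)) - 1) * C) ^ 2) * h ^ 2 ∧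
    vers (Real.pi / J.N i) ^ 2 / J.τ i
      ≤ (2 * A₂ ^ 2 + 4 * C ^ 2 + ((2 ^ (1 / (2 - p)) - 1) * C) ^ 2) * h ^ 2 ∧
    J.τ i ^ 2 ≤ (2 * A₂ ^ 2 + 4 * C ^ 2 + ((2 ^ (1 / (2 - p)) - 1) * C) ^ 2) * h ^ 2 := by
  have hv := vers_pi_div_le (J.N i)
  have hτ := J.τ_pos hi
  have hv0 : 0 ≤ vers (Real.pi / J.N i) := by
    unfold vers; linarith [Real.cos_le_one (Real.pi / J.N i / 2)]
  have a1 : 0 ≤ A₂ ^ 2 * h ^ 2 := by positivity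
  have a2 : 0 ≤ C ^ 2 * h ^ 2 := by positivity
  have a3 : 0 ≤ ((2 ^ (1 / (2 - p)) - 1) * C) ^ 2 * h ^ 2 := by positivity
  refine ⟨?_, ?_, ?_⟩
  · have hN : (J.N i : ℝ)⁻¹ ≤ A₂ * h := by
      rw [inv_le_comm₀ (by exact_mod_cast J.N_pos hi) (by positivity)]
      exact J.Ntil_mem.1.trans (by exact_mod_cast J.Ntil_le hi)
    have := pow_le_pow_left₀ (by positivity) hN 2
    rw [mul_pow] at this
    linarith
  · have h4 := ((J.admissible hε hp hp2 hC₁ hC₂ hCh hm hi).pow_four_le (J.ε_pos hε (by omega)) hτ).2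
    rw [div_le_iff₀ hτ]
    have h5 := pow_le_pow_left₀ hv0 hv 2
    have h6 : vers (Real.pi / J.N i) ^ 2 ≤ 4 * (C ^ 2 * h ^ 2) * J.τ i :=
      calc _ ≤ 4 * (J.N i : ℝ)⁻¹ ^ 4 := h5.trans (le_of_eq (by ring))
        _ ≤ _ := by linarith
    refine h6.trans (mul_le_mul_of_nonneg_right ?_ hτ.le)
    linarith
  · have h1 := (J.τ_le hi).trans (min_le_right _ _)
    have h2 := h1.trans (thicknessBound_le hp hp2 hCh hCh1 (J.ε_pos hε (by omega)).le
      (J.ε_le_one (by omega)))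
    have h3 := pow_le_pow_left₀ hτ.le h2 2
    calc _ ≤ ((2 ^ (1 / (2 - p)) - 1) * C) ^ 2 * h ^ 2 := h3.trans (le_of_eq (by ring))
      _ ≤ _ := by linarith

end StrategyMesh

/-! ### The energy of the interpolant -/

theorem mul_le_one_of_le_min {p C h : ℝ} (hp : 1 < p) (hp2 : p < 2) (hC : 0 < C)
    (hh : h ≤ min ((2 - p) / (2 ^ (2 - p) * C)) ((2 - p) / (2 ^ (p - 1) * C))) : C * h ≤ 1 := by
  have h1 := hh.trans (min_le_left _ _)
  have h2 : (1 : ℝ) ≤ 2 ^ (2 - p) := Real.one_le_rpow (by norm_num) (by linarith)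
  rw [le_div_iff₀ (by positivity)] at h1
  have h3 : C * h ≤ 2 ^ (2 - p) * (C * h) ∨ C * h ≤ 0 := by
    rcases le_total 0 (C * h) with h4 | h4
    · exact Or.inl (le_mul_of_one_le_left h4 h2)
    · exact Or.inr h4
  rcases h3 with h3 | h3 <;> linarith

namespace StrategyMesh

variable {p C C₁ C₂ A₁ A₂ h ε₀ : ℝ}

theorem region_layers (J : StrategyMesh p C C₁ C₂ A₁ A₂ h ε₀) :
    J.elements = RingMesh.layers J.ε J.τ J.N J.conf J.ψ (Finset.range (J.m + 1)) ∧
    ∀ i, J.layer i = RingMesh.layers J.ε J.τ J.N J.conf J.ψ {i} := by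
  constructor
  · ext T; simp [elements, RingMesh.layers, layer_eq]
  · intro i; ext T; simp [RingMesh.layers, layer_eq]

theorem sum_integral (J : StrategyMesh p C C₁ C₂ A₁ A₂ h ε₀) (hε : 0 < ε₀) {b : ℝ → ℝ}
    (hb : ContinuousOn b (Ioc 0 1)) :
    ∑ i ∈ Finset.range (J.m + 1), ∫ ρ in J.ε i..J.ε i + J.τ i, b ρ = ∫ ρ in ε₀..1, b ρ := by
  have h1 := intervalIntegral.sum_integral_adjacent_intervals (f := b) (μ := volume) (a := J.ε)
    (n := J.m + 1) fun i hi => ContinuousOn.intervalIntegrable (hb.mono ?_)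
  · rw [J.ε_zero, J.ε_last] at h1
    rw [← h1]
    refine Finset.sum_congr rfl fun i hi => ?_
    rw [J.ε_succ i (Nat.lt_succ_iff.1 (Finset.mem_range.1 hi))]
  · rw [uIcc_of_le (J.ε_lt i (by omega)).le]
    exact fun x hx => ⟨(J.ε_pos hε (by omega)).trans_le hx.1, hx.2.trans (J.ε_le_one (by omega))⟩

end StrategyMesh

end Cavity

end

/-! ### The main theorem -/

theorem mainTheorem1 (c B a b : ℝ) (hc : 0 < c) (ha : 0 < a) (hab : a < b) :
    ∃ C₁' > (0 : ℝ), ∃ C₂' > (0 : ℝ),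
      ∀ C₁ C₂ : ℝ, 0 < C₁ → C₁ ≤ C₁' → 0 < C₂ → C₂ ≤ C₂' →
      ∀ (p ω : ℝ) (g : ℝ → ℝ), 1 < p → p < 2 → 0 < ω → Cavity.IsVolumetricEnergy g →
      ∀ C A₁ A₂ : ℝ, (2 - p) * 2 ^ (p - 1) ≤ C → 0 < A₁ → A₁ < A₂ →
      ∃ K : ℝ, ∀ r : ℝ → ℝ, Cavity.IsCavityProfile c B a b r →
      ∀ ε₀ h : ℝ, 0 < ε₀ → ε₀ < 1 → 0 < h →
        h ≤ min ((2 - p) / (2 ^ (2 - p) * C)) ((2 - p) / (2 ^ (p - 1) * C)) →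
      ∀ J : Cavity.StrategyMesh p C C₁ C₂ A₁ A₂ h ε₀,
        Cavity.Admissible C C₂ h (J.ε J.m) (J.τ J.m) (J.N J.m) →
        -- the interpolant is well defined on the mesh
        (∀ T ∈ J.elements, ∀ x ∈ Cavity.refTriangle,
          J.interp (Cavity.radialMap r) (T.map x) = T.nodalInterp (Cavity.radialMap r) x) ∧
        -- orientation preservation
        (∀ᵐ x ∂(MeasureTheory.volume.restrict (Cavity.region J.elements)),
          DifferentiableAt ℝ (J.interp (Cavity.radialMap r)) x ∧
          0 < (fderiv ℝ (J.interp (Cavity.radialMap r)) x).det) ∧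
        -- the energies are finite
        Cavity.HasFiniteEnergy ω p g (J.interp (Cavity.radialMap r))
          (Cavity.region J.elements) ∧
        Cavity.HasFiniteEnergy ω p g (Cavity.radialMap r) (Cavity.annulus ε₀) ∧
        -- the energy of the interpolant is the sum of its energies on the layers
        Cavity.energy ω p g (J.interp (Cavity.radialMap r)) (Cavity.region J.elements) =
          ∑ i ∈ Finset.range (J.m + 1),
            Cavity.energy ω p g (J.interp (Cavity.radialMap r)) (Cavity.region (J.layer i)) ∧
        -- the relative error of the energy is of order `h ^ 2`
        |Cavity.energy ω p g (J.interp (Cavity.radialMap r)) (Cavity.region J.elements) -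
            Cavity.energy ω p g (Cavity.radialMap r) (Cavity.annulus ε₀)| ≤
          K * h ^ 2 * Cavity.energy ω p g (Cavity.radialMap r) (Cavity.annulus ε₀) := by
  set M : ℝ := max 1 (max B b) with hMdef
  have hM1 : 1 ≤ M := le_max_left _ _
  have hMB : B ≤ M := (le_max_left _ _).trans (le_max_right _ _)
  have hMb : b ≤ M := (le_max_right _ _).trans (le_max_right _ _)
  -- The tolerance depends only on `c, B, a, b`; it serves as the bound for `C₁`, and a quarter of
  -- it as the bound for `C₂`.
  set μ : ℝ := min (1 / 1000) (a * c / (800 * M ^ 2)) with hμdef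
  have hμ : 0 < μ := lt_min (by norm_num) (by positivity)
  have hμ1 : μ ≤ 1 / 1000 := min_le_left _ _
  have hT : Cavity.Tolerance c a M μ := by
    refine ⟨hc, ha, hM1, hμ1, ?_⟩
    have := min_le_right (1 / 1000) (a * c / (800 * M ^ 2))
    rw [← hμdef, le_div_iff₀ (by positivity)] at this
    linarith
  refine ⟨μ, hμ, μ / 4, by positivity, fun C₁ C₂ hC₁ hC₁μ hC₂ hC₂μ p ω g hp hp2 hω hg C A₁ A₂ hC
    hA₁ hA₁₂ => ?_⟩
  have hC0 : 0 < C := lt_of_lt_of_le (mul_pos (by linarith) (by positivity)) hC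
  obtain ⟨K, hK, key⟩ := Cavity.RingMesh.exists_layerEnergy_sub_le hp hp2 hω hg hc ha hM1
  set K₂ : ℝ := 2 * A₂ ^ 2 + 4 * C ^ 2 + ((2 ^ (1 / (2 - p)) - 1) * C) ^ 2 with hK₂
  refine ⟨K * K₂, fun r hr ε₀ h hε hε1 hh hhC J hm => ?_⟩
  have hCh : 0 < C * h := by positivity
  have hCh1 := Cavity.mul_le_one_of_le_min hp hp2 hC0 hhC
  obtain ⟨r1, r2, r3, hr⟩ := hr.exists_data (M := M) hMB hMb
  have hJ := J.ringMesh hε hp hp2 hC₁ hC₂ hCh hm hμ hμ1 hC₁μ hC₂μ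
  have hrad := Cavity.isRadial_radialMap r
  have hw : Cavity.RingMesh.Interpolates J.m J.ε J.τ (fun i => Real.pi / J.N i) J.conf J.ψ r
      (J.interp (Cavity.radialMap r)) := fun i hi j o s t ho hs ht => by
    rw [Cavity.StrategyMesh.interp, J.elements_eq]
    exact hJ.interpolant_pt hrad hi j ho hs ht
  have hlay := J.region_layers
  have hrange : ∀ i ∈ Finset.range (J.m + 1), i ≤ J.m := fun i hi =>
    Nat.lt_succ_iff.1 (Finset.mem_range.1 hi)
  obtain ⟨hfin, henergy⟩ := hJ.energy_layers hT hr hw hrange (ω := ω) hp hg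
  obtain ⟨hfin₀, henergy₀⟩ := Cavity.energy_radialMap (ω := ω) hr hc ha hp hg hε hε1
  rw [← hlay.1] at hfin henergy
  refine ⟨fun T hTe x hx => ?_, ?_, hfin, hfin₀, ?_, ?_⟩
  · rw [Cavity.StrategyMesh.interp]
    rw [J.elements_eq] at hTe ⊢
    exact hJ.interpolant_map hrad hTe hx
  · rw [hlay.1]
    exact hJ.ae_differentiableAt hT hr hw hrange
  · rw [henergy]
    refine Finset.sum_congr rfl fun i hi => ?_
    rw [hlay.2 i, (hJ.energy_layers hT hr hw (T := {i})
      (fun j hj => by rw [Finset.mem_singleton.1 hj]; exact hrange i hi) hp hg).2,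
      Finset.sum_singleton]
  · rw [henergy, henergy₀, ← J.sum_integral hε (hr.continuousOn_radialWeight hc ha hp hg),
      Finset.mul_sum, ← Finset.sum_sub_distrib, Finset.mul_sum]
    -- The relative error estimate holds layer by layer with the same factor `K * K₂ * h ^ 2`, so it
    -- survives summation.
    refine (Finset.abs_sum_le_sum_abs _ _).trans (Finset.sum_le_sum fun i hi => ?_)
    obtain ⟨s1, s2, s3⟩ := J.sizes_le hε hp hp2 hC₁ hC₂ (hA₁.trans hA₁₂) hh hCh hCh1 hm (hrange i hi)
    rw [mul_assoc K]
    exact key hJ hT hr (hrange i hi) s1 s2 s3
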